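/- **Setting.** Let $d\ge 2$ and let $T=(\underline\lambda,\pi)$ be an interval exchange transformation of $I^{(0)}=[0,1)$, with $\lambda_j>0$, $\sum_j\lambda_j=1$, $\pi$ irreducible, satisfying Keane's condition (the forward orbits of the interior endpoints $\beta_1,\dots,\beta_{d-1}$ are infinite and pairwise disjoint). Let $T^{(n)}$ be the interval exchange obtained from $T$ after $n$ steps of (unnormalized) Rauzy–Veech induction, $\underline\lambda^{(n)}$ its lengths vector, $\lambda^{(n)}=\sum_j\lambda_j^{(n)}$, $A_n$ the elementary Rauzy–Veech matrix of $T^{(n)}$, so that $\underline\lambda^{(n)}=A_n\underline\lambda^{(n+1)}$, $A^{(p,q)}=A_pA_{p+1}\cdots A_{q-1}$, $h^{(n)}_j=\sum_i A^{(0,n)}_{ij}$ and $h^{(n)}=\max_j h^{(n)}_j$. Write $\|A\|=\sum_{i,j}A_{ij}$. For $A>0$ let $D(A)$ be the diameter, in the Hilbert distance $d_H(\lambda,\lambda')=\log\frac{\max_i\lambda_i/\lambda_i'}{\min_i\lambda_i/\lambda_i'}$, of the closure of $\{A\lambda/|A\lambda| : \lambda\in\Delta_{d-1}\}$, where $\Delta_{d-1}$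 is the open unit simplex of positive vectors and $|v|=\sum_i v_i$. Fix $1<\tau<2$ and $\tau/2<\tau'<1$. A strictly increasing sequence $(n_l)_{l\in\mathbb N}$ is called *balanced* for $T$, with constants $\nu>1$, $\kappa>1$, $0<D<\infty$, $\bar l\in\mathbb N$, if for all $l$: (1) $\nu^{-1}\le \lambda_i^{(n_l)}/\lambda_j^{(n_l)}\le\nu$ for all $i,j$; (2) $\kappa^{-1}\le h_i^{(n_l)}/h_j^{(n_l)}\le\kappa$ for all $i,j$; (3) $A^{(n_l,n_{l+\bar l})}>0$ entrywise and $D(A^{(n_l,n_{l+\bar l})})\le D$; and (4) $\lim_{l\to\infty}\|A^{(n_l,n_{l+1})}\|/l^\tau=0$. Let $\mathcal M^+$ be the set of $T$ as above having a balanced sequence. Let $T^{\mathcal I}$ be the interval exchange conjugate to $T$ by the reflection $x\mapsto 1-x$, i.e. $T^{\mathcal I}=((\lambda_d,\dots,\lambda_1),\pi^{\mathcal I})$ with $\pi^{\mathcal I}(j)=d+1-\pi(d+1-j)$; let $\mathcal M^-=\{T: T^{\mathcal I}\in\mathcal M^+\}$ and $\mathcal M=\mathcal M^+\cap\mathcal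 M^-$. For $T\in\mathcal M$ let $(n_l)$ be a balanced sequence of $T$ with height constant $\kappa$, and $(n'_{l'})$ a balanced sequence of $T^{\mathcal I}$ with height constant $\kappa'$; write $\lambda_{\mathcal I}^{(n)},h_{\mathcal I}^{(n)}$ for the lengths and heights of $T^{\mathcal I}$. Put $$\sigma_l(T)=\Big(\frac{\log\|A^{(n_l,n_{l+1})}\|}{\log h^{(n_l)}}\Big)^{\tau'},\qquad \Sigma_l^+=\bigcup_{i=0}^{\lfloor\sigma_l h^{(n_{l+1})}\rfloor}T^{-i}[0,\sigma_l\lambda^{(n_l)}],$$ and, with $\sigma_{l'}=\sigma_{l'}(T^{\mathcal I})$ formed from $T^{\mathcal I}$ and $(n'_{l'})$, $$\Sigma_{l'}^-=\bigcup_{i=0}^{\lfloor\sigma_{l'} h_{\mathcal I}^{(n'_{l'+1})}\rfloor}T^{-i}[1-\sigma_{l'}\lambda_{\mathcal I}^{(n'_{l'})},1].$$ Let $C^+,C^->0$. A roof function with constants $C^\pm$ is an integrable $f\in\mathscr C^2((0,1))$, bounded below by a positive constant, with $\int_0^1 f=1$, $\lim_{x\to0^+}x^2f''(x)=C^+$ and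 $\lim_{x\to1^-}(1-x)^2f''(x)=C^-$. Write $S_r f'(x)=\sum_{i=0}^{r-1}f'(T^ix)$, $x_m=\min_{0\le i<r}T^ix$, $x_M=\max_{0\le i<r}T^ix$; a point $x$ is a singularity of $S_rf$ if $T^ix=0$ for some $0\le i<r$. **Statement.** For each $T\in\mathcal M$ (with balanced sequences as above) and each $C^+\ne C^-$ there are constants $C_1,C_2,C_3>0$ such that for every roof function $f$ with constants $C^\pm$ there is $r_0$ such that for all $r\ge r_0$ the following hold. (i) If $h^{(n_l)}\le r<h^{(n_{l+1})}$, $h_{\mathcal I}^{(n'_{l'})}\le r<h_{\mathcal I}^{(n'_{l'+1})}$, $x\in[0,1)$, $x\notin\Sigma_l^+\cup\Sigma_{l'}^-$ and $x$ is not a singularity of $S_rf$, then $$S_rf'(x)\le -C_1\,r\log r+\frac{C^+(\kappa'+1)}{1-x_M}\quad\text{if } C^+>C^-,$$ $$S_rf'(x)\ge C_1\,r\log r-\frac{C^-(\kappa+1)}{x_m}\quad\text{if } C^+<C^-,$$ $$|S_rf'(x)|\le C_2\,r\log r+\frac{C_2(\kappa+1)}{x_m}+\frac{C_2(\kappa'+1)}{1-x_M}.$$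 (ii) For all $x\in[0,1)$ that are not singularities of $S_rf$, $$|S_rf'(x)|\le C_3\,r^2+\frac{C_3(\kappa+1)}{x_m}+\frac{C_3(\kappa'+1)}{1-x_M}.$$ -/

import Mathlib

open Set Filter Topology MeasureTheory

noncomputable section

/-- The data `(λ, π)` of an interval exchange of `d = m + 1` intervals, indexed by `Fin (m + 1)`.
The interval with index `j` becomes the one in position `perm j` after the exchange. -/
@[ext]
structure IET (m : ℕ) where
  /-- the lengths vector -/
  len : Fin (m + 1) → ℝ
  /-- the permutation -/
  perm : Equiv.Perm (Fin (m + 1))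

/-- The open simplex of positive vectors with coordinates summing to one. -/
def openSimplex (m : ℕ) : Set (Fin (m + 1) → ℝ) :=
  {v | (∀ j, 0 < v j) ∧ ∑ j, v j = 1}

/-- The Hilbert projective distance between positive vectors. -/
def hilbertDist {m : ℕ} (v w : Fin (m + 1) → ℝ) : ℝ :=
  Real.log ((⨆ i, v i / w i) / (⨅ i, v i / w i))

/-- The diameter of a set for the Hilbert distance, as an extended real number. -/
def hilbertDiam {m : ℕ} (S : Set (Fin (m + 1) → ℝ)) : EReal :=
  ⨆ v ∈ S, ⨆ w ∈ S, (hilbertDist v w : EReal)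

/-- The projective map `v ↦ A v / |A v|` attached to a non-negative integer matrix. -/
def projMap {m : ℕ} (A : Matrix (Fin (m + 1)) (Fin (m + 1)) ℕ) (v : Fin (m + 1) → ℝ) :
    Fin (m + 1) → ℝ :=
  (∑ i, (A.map (Nat.cast : ℕ → ℝ)).mulVec v i)⁻¹ • (A.map (Nat.cast : ℕ → ℝ)).mulVec v

/-- `D(A)`: the Hilbert diameter of the closure of the image of the open simplex. -/
def projDiam {m : ℕ} (A : Matrix (Fin (m + 1)) (Fin (m + 1)) ℕ) : EReal :=
  hilbertDiam (closure (projMap A '' openSimplex m))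

/-- `‖A‖`, the sum of all entries. -/
def entrySum {m : ℕ} (A : Matrix (Fin (m + 1)) (Fin (m + 1)) ℕ) : ℕ := ∑ i, ∑ j, A i j

/-- The relabelling of intervals in a Rauzy step of type `a`: identity up to `s`, then
`s + 1 ↦ last`, and `j ↦ j - 1` for `j > s + 1`. -/
def relabelA {m : ℕ} (s j : Fin (m + 1)) : Fin (m + 1) :=
  if j.val ≤ s.val then j
  else if j.val = s.val + 1 then Fin.last m
  else ⟨j.val - 1, by omega⟩

/-- The relabelling of positions in a Rauzy step of type `b`: identity up to `p`, then
`v ↦ v + 1` for `p < v < last`, and `last ↦ p + 1`. -/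
def relabelB {m : ℕ} (p v : Fin (m + 1)) : Fin (m + 1) :=
  if _h : v.val ≤ p.val then v
  else if _h' : v.val < m then ⟨v.val + 1, by omega⟩
  else ⟨p.val + 1, by omega⟩

theorem relabelA_injective {m : ℕ} (s : Fin (m + 1)) : Function.Injective (relabelA s) := by
  intro i j h
  have h' := congrArg Fin.val h
  have hi := i.isLt
  have hj := j.isLt
  apply Fin.ext
  unfold relabelA at h'
  split_ifs at h' <;> (try simp only [Fin.val_last] at h') <;> omega

theorem relabelB_injective {m : ℕ} (p : Fin (m + 1)) : Function.Injective (relabelB p) := by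
  intro i j h
  have h' := congrArg Fin.val h
  have hi := i.isLt
  have hj := j.isLt
  apply Fin.ext
  unfold relabelB at h'
  split_ifs at h' <;> (try simp only at h') <;> omega

def relabelPermA {m : ℕ} (s : Fin (m + 1)) : Equiv.Perm (Fin (m + 1)) :=
  Equiv.ofBijective (relabelA s) (Finite.injective_iff_bijective.mp (relabelA_injective s))

def relabelPermB {m : ℕ} (p : Fin (m + 1)) : Equiv.Perm (Fin (m + 1)) :=
  Equiv.ofBijective (relabelB p) (Finite.injective_iff_bijective.mp (relabelB_injective p))

namespace IET

variable {m : ℕ}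

/-- The left endpoint of the `j`-th interval. -/
def left (T : IET m) (j : Fin (m + 1)) : ℝ :=
  ∑ i ∈ Finset.univ.filter (fun i => i < j), T.len i

/-- The left endpoint of the image of the `j`-th interval. -/
def imageLeft (T : IET m) (j : Fin (m + 1)) : ℝ :=
  ∑ i ∈ Finset.univ.filter (fun i => T.perm i < T.perm j), T.len i

/-- The `j`-th exchanged interval. -/
def interval (T : IET m) (j : Fin (m + 1)) : Set ℝ := Ico (T.left j) (T.left j + T.len j)

/-- The interval exchange map, translating each exchanged interval to its new place. Only its
values on the union of the intervals matter (it is the identity elsewhere). -/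
def map (T : IET m) (x : ℝ) : ℝ :=
  x + ∑ j, (T.interval j).indicator (fun _ => T.imageLeft j - T.left j) x

/-- No proper initial block of indices is invariant under the permutation. -/
def Irreducible (T : IET m) : Prop :=
  ∀ k : ℕ, 1 ≤ k → k ≤ m → ¬ ∀ j : Fin (m + 1), j.val < k → (T.perm j).val < k

/-- Keane's infinite distinct orbit condition: the forward orbits of the interior endpoints
`β_1, …, β_{d-1}` are infinite and pairwise disjoint. -/
def IDOC (T : IET m) : Prop :=
  (∀ j : Fin (m + 1), j ≠ 0 → (range fun k : ℕ => T.map^[k] (T.left j)).Infinite) ∧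
  ∀ i j : Fin (m + 1), i ≠ 0 → j ≠ 0 → i ≠ j →
    Disjoint (range fun k : ℕ => T.map^[k] (T.left i)) (range fun k : ℕ => T.map^[k] (T.left j))

/-- The index `π⁻¹(d)` of the interval that is last after the exchange. -/
def lastImage (T : IET m) : Fin (m + 1) := T.perm.symm (Fin.last m)

/-- The Rauzy step is of type `a` if this holds and of type `b` if the strict opposite
inequality holds; equality never occurs along the induction of an irreducible interval exchange
of at least two intervals satisfying `IDOC`. -/
def IsTypeA (T : IET m) : Prop := T.len (Fin.last m) < T.len T.lastImage

open Classical in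
/-- One step of Rauzy-Veech induction, without renormalization of the lengths: the first return
map to the interval shortened on the right by the smaller of `λ_d` and `λ_{π⁻¹(d)}`. -/
def rauzy (T : IET m) : IET m :=
  if T.IsTypeA then
    { len := fun j => if j = T.lastImage then T.len T.lastImage - T.len (Fin.last m)
        else T.len (relabelA T.lastImage j)
      perm := (relabelPermA T.lastImage).trans T.perm }
  else
    { len := fun j => if j = Fin.last m then T.len (Fin.last m) - T.len T.lastImage
        else T.len j
      perm := T.perm.trans (relabelPermB (T.perm (Fin.last m))) }

open Classical in
/-- The elementary Rauzy-Veech matrix: `(Id + E_{s,d}) P` for type `a`, where `P` is the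
matrix of the relabelling, and `Id + E_{d,s}` for type `b`, with `s = π⁻¹(d)`. -/
def rauzyMatrix (T : IET m) : Matrix (Fin (m + 1)) (Fin (m + 1)) ℕ :=
  if T.IsTypeA then
    (1 + Matrix.single T.lastImage (Fin.last m) 1) *
      Matrix.of fun i j => if i = relabelA T.lastImage j then 1 else 0
  else
    1 + Matrix.single (Fin.last m) T.lastImage 1

/-- `T⁽ⁿ⁾`, the interval exchange after `n` steps of induction. -/
def iter (T : IET m) (n : ℕ) : IET m := rauzy^[n] T

/-- `A⁽ᵖ'ᑫ⁾ = A_p A_{p+1} ⋯ A_{q-1}`, for `p ≤ q`. -/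
def cocycle (T : IET m) (p q : ℕ) : Matrix (Fin (m + 1)) (Fin (m + 1)) ℕ :=
  ((List.range' p (q - p)).map fun k => (T.iter k).rauzyMatrix).prod

/-- `λ⁽ⁿ⁾ = ∑ j, λ⁽ⁿ⁾_j`, the length of the `n`-th inducing interval. -/
def totalLen (T : IET m) (n : ℕ) : ℝ := ∑ j, (T.iter n).len j

/-- `h⁽ⁿ⁾_j`, the height of the `j`-th tower. -/
def height (T : IET m) (n : ℕ) (j : Fin (m + 1)) : ℕ := ∑ i, T.cocycle 0 n i j

/-- `h⁽ⁿ⁾ = max_j h⁽ⁿ⁾_j`. -/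
def maxHeight (T : IET m) (n : ℕ) : ℕ := Finset.univ.sup (T.height n)

/-- The sequence `n` of induction times is balanced with constants `ν, κ, D, lbar` and satisfies
the integrability condition with exponent `τ`. -/
structure IsBalancedSeq (T : IET m) (τ : ℝ) (n : ℕ → ℕ) (ν κ D : ℝ) (lbar : ℕ) : Prop where
  strictMono : StrictMono n
  one_lt_nu : 1 < ν
  one_lt_kappa : 1 < κ
  D_pos : 0 < D
  len_balance : ∀ l i j, 1 / ν ≤ (T.iter (n l)).len i / (T.iter (n l)).len j ∧
    (T.iter (n l)).len i / (T.iter (n l)).len j ≤ ν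
  height_balance : ∀ l i j, 1 / κ ≤ (T.height (n l) i : ℝ) / (T.height (n l) j : ℝ) ∧
    (T.height (n l) i : ℝ) / (T.height (n l) j : ℝ) ≤ κ
  positivity : ∀ l i j, 0 < T.cocycle (n l) (n (l + lbar)) i j
  diam_le : ∀ l, projDiam (T.cocycle (n l) (n (l + lbar))) ≤ (D : EReal)
  integrability :
    Tendsto (fun l : ℕ => (entrySum (T.cocycle (n l) (n (l + 1))) : ℝ) / (l : ℝ) ^ τ)
      atTop (𝓝 0)

/-- `𝓜⁺`: irreducible interval exchanges of the unit interval with `IDOC` that have a balanced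
sequence of induction times with exponent `τ`. -/
def MPlus (τ : ℝ) : Set (IET m) :=
  {T | T.len ∈ openSimplex m ∧ T.Irreducible ∧ T.IDOC ∧
    ∃ (n : ℕ → ℕ) (ν κ D : ℝ) (lbar : ℕ), T.IsBalancedSeq τ n ν κ D lbar}

/-- `T^𝓘`, the conjugate of `T` by the reflection `x ↦ 1 - x`. -/
def reflect (T : IET m) : IET m where
  len := fun j => T.len (Fin.rev j)
  perm := (Fin.revPerm.trans T.perm).trans Fin.revPerm

/-- `𝓜⁻`: those `T` whose reflection is in `𝓜⁺`. -/
def MMinus (τ : ℝ) : Set (IET m) := {T | T.reflect ∈ MPlus τ}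

/-- `𝓜 = 𝓜⁺ ∩ 𝓜⁻`. -/
def MSet (τ : ℝ) : Set (IET m) := MPlus τ ∩ MMinus τ

/-- The threshold `σ_l(T)`, for the sequence of times `n` and the exponent `τ'`. -/
def sigma (T : IET m) (τ' : ℝ) (n : ℕ → ℕ) (l : ℕ) : ℝ :=
  (Real.log (entrySum (T.cocycle (n l) (n (l + 1)))) / Real.log (T.maxHeight (n l))) ^ τ'

/-- `Σ⁺_l(T)`: points of `[0,1)` visiting `[0, σ_l λ^{(n_l)}]` at a time
`0 ≤ i ≤ ⌊σ_l h^{(n_{l+1})}⌋`. -/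
def sigmaPlus (T : IET m) (τ' : ℝ) (n : ℕ → ℕ) (l : ℕ) : Set ℝ :=
  {x ∈ Ico (0 : ℝ) 1 | ∃ i : ℕ, i ≤ ⌊T.sigma τ' n l * (T.maxHeight (n (l + 1)) : ℝ)⌋₊ ∧
    T.map^[i] x ∈ Icc 0 (T.sigma τ' n l * T.totalLen (n l))}

/-- `Σ⁻_l(T)`: points of `[0,1)` visiting (under `T`) the interval `[1 - σ_l λ^{(n_l)}, 1]` at a
time `0 ≤ i ≤ ⌊σ_l h^{(n_{l+1})}⌋`; here `σ`, `λ`, `h` and the times `n` are those of the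
reflection of `T`. -/
def sigmaMinus (T : IET m) (τ' : ℝ) (n : ℕ → ℕ) (l : ℕ) : Set ℝ :=
  {x ∈ Ico (0 : ℝ) 1 | ∃ i : ℕ,
    i ≤ ⌊T.reflect.sigma τ' n l * (T.reflect.maxHeight (n (l + 1)) : ℝ)⌋₊ ∧
    T.map^[i] x ∈ Icc (1 - T.reflect.sigma τ' n l * T.reflect.totalLen (n l)) 1}

/-- `x_m`, the minimum of `T^i x` over `0 ≤ i < r` (used for `r ≥ 1`). -/
def orbitMin (T : IET m) (r : ℕ) (x : ℝ) : ℝ := ⨅ i : Fin r, T.map^[i] x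

/-- `x_M`, the maximum of `T^i x` over `0 ≤ i < r` (used for `r ≥ 1`). -/
def orbitMax (T : IET m) (r : ℕ) (x : ℝ) : ℝ := ⨆ i : Fin r, T.map^[i] x

/-- `x` is a singularity of the `r`-th Birkhoff sum of a function whose only singularity is at
the origin: one of the points `T^i x`, `0 ≤ i < r`, is the origin. -/
def IsSingularity (T : IET m) (r : ℕ) (x : ℝ) : Prop := ∃ i < r, T.map^[i] x = 0

end IET

/-- A roof function on the unit interval with a single logarithmic singularity at the origin,
with constants `Cp = C⁺` (on the right of `0`) and `Cm = C⁻` (on the left of `1`). -/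
structure IsLogRoof (f : ℝ → ℝ) (Cp Cm : ℝ) : Prop where
  contDiffOn : ContDiffOn ℝ 2 f (Ioo 0 1)
  lower_bound : ∃ mf : ℝ, 0 < mf ∧ ∀ x ∈ Ioo (0 : ℝ) 1, mf ≤ f x
  integrableOn : IntegrableOn f (Ioo 0 1)
  integral_eq_one : ∫ x in Ioo (0 : ℝ) 1, f x = 1
  tendsto_zero : Tendsto (fun x => deriv (deriv f) x / (1 / x ^ 2)) (𝓝[>] 0) (𝓝 Cp)
  tendsto_one : Tendsto (fun x => deriv (deriv f) x / (1 / (1 - x)) ^ 2) (𝓝[<] 1) (𝓝 Cm)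

end

/-! Integrating the asymptotics of `f''` shows that `f'` equals `-C⁺/x + C⁻/(1-x)` up to `ε(1/x +
1/(1-x)) + M` (`IsLogRoof.abs_deriv_le`). Hence `S_r f'` is compared with `-C⁺ U + C⁻ V`, where `U`
and `V` are the Birkhoff sums of `1/x` and `1/(1-x)`. Both are close to `r log r`, apart from the
few closest approaches to the singularity, which cost at most `(κ+1)/x_m` and `(κ'+1)/(1-x_M)`. The
leading term is therefore `(C⁻ - C⁺) r log r`, and the asymmetry decides its sign.

The estimate of `U` rests on equidistribution in Rokhlin towers. A bound on the Hilbert diameter of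
positive blocks bounds the cross ratios of their entries, so each block contracts ratios by a fixed
factor (`mulVec_ratio_contraction`). The columns of a long product are then nearly proportional to
the lengths vector, and its entries are nearly products of a height and a length
(`IsBalancedSeq.cocycle_asymp`). Consequently an orbit of length `r`, at least the maximal height at
level `k + L` with `L` fixed, visits each tower floor of level `k` about `r` times its length
(`IsBalancedSeq.visits_asymp`). Comparing `1/y` with its average over a floor turns such frequencies
into integrals of `1/t`, that is, into logarithms of the base length.

For the upper bound (`IsBalancedSeq.birkhoffSum_one_div_le`), let `r` lie between the maximal
heights of levels `l` and `l + 1`, and let `Λ_k` be the inducing length at level `k`. The interval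
is cut at `Λ_l` and `Λ_{l-L}`. Equidistribution on `[Λ_{l-L}, 1)` produces `r log r`. On the middle
piece a crude bound on frequencies suffices: heights grow at least exponentially in `l` while the
norms of the cocycle grow polynomially, so `log(Λ_{l-L}/Λ_l)` is negligible against `log r`. On `[0,
Λ_l)` the set `Σ⁺` enters (`IsBalancedSeq.birkhoffSum_near_le`): either the whole orbit stays beyond
`σ Λ_l`, or `r` exceeds `σ` times the next height and the towers of level `l + 1` can be used. Both
cases cost about `(r/σ) log ‖A‖`, which is `o(r log r)` since `τ' < 1`. The lower bound keeps only
the far piece and holds at every point of `[0,1)`.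

For all points, the towers of level `l + 1` alone give the bound `r²`, as the next height is
eventually at most the power `3/2` of the current one. The sum `V` is treated through the reflected
exchange. The reflection conjugates the maps only up to endpoints of intervals, so it is applied to
points displaced by a small `ε > 0`, and the estimates pass to the limit. -/

/-! ### Blocks laid out along the line -/

/-- The left endpoint of the block of index `j` when blocks of lengths `w` are laid out in the
order given by `σ`. -/
noncomputable def blockLeft {m : ℕ} (σ : Equiv.Perm (Fin (m + 1))) (w : Fin (m + 1) → ℝ)
    (j : Fin (m + 1)) : ℝ :=
  ∑ i ∈ Finset.univ.filter (fun i => σ i < σ j), w i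

section blocks

variable {m : ℕ} {σ : Equiv.Perm (Fin (m + 1))} {w : Fin (m + 1) → ℝ}

theorem blockLeft_nonneg (hw : ∀ j, 0 < w j) (j : Fin (m + 1)) : 0 ≤ blockLeft σ w j :=
  Finset.sum_nonneg fun i _ => (hw i).le

theorem blockLeft_add (j : Fin (m + 1)) :
    blockLeft σ w j + w j = ∑ i ∈ Finset.univ.filter (fun i => σ i ≤ σ j), w i := by
  have h : Finset.univ.filter (fun i => σ i ≤ σ j)
      = insert j (Finset.univ.filter (fun i => σ i < σ j)) := by
    ext i
    simp only [Finset.mem_filter, Finset.mem_univ, true_and, Finset.mem_insert]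
    rw [le_iff_lt_or_eq, σ.injective.eq_iff]
    tauto
  rw [h, Finset.sum_insert (by simp), blockLeft, add_comm]

theorem blockLeft_add_le (hw : ∀ j, 0 < w j) {i j : Fin (m + 1)} (h : σ i < σ j) :
    blockLeft σ w i + w i ≤ blockLeft σ w j := by
  rw [blockLeft_add]
  refine Finset.sum_le_sum_of_subset_of_nonneg ?_ fun k _ _ => (hw k).le
  intro k hk
  simp only [Finset.mem_filter, Finset.mem_univ, true_and] at hk ⊢
  exact hk.trans_lt h

theorem blockLeft_add_le_sum (hw : ∀ j, 0 < w j) (j : Fin (m + 1)) :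
    blockLeft σ w j + w j ≤ ∑ i, w i := by
  rw [blockLeft_add]
  exact Finset.sum_le_sum_of_subset_of_nonneg (Finset.filter_subset _ _) fun k _ _ => (hw k).le

theorem blockLeft_add_eq_sum {j : Fin (m + 1)} (hj : σ j = Fin.last m) :
    blockLeft σ w j + w j = ∑ i, w i := by
  rw [blockLeft_add, hj]
  congr 1
  ext i
  simp [Fin.le_last]

/-- The block is located by the first partial sum, in the order of positions, that exceeds `x`. -/
theorem exists_mem_block {x : ℝ} (hx : x ∈ Ico 0 (∑ i, w i)) :
    ∃ j, x ∈ Ico (blockLeft σ w j) (blockLeft σ w j + w j) := by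
  classical
  let c : ℕ → ℝ := fun k => ∑ i ∈ Finset.univ.filter (fun i => (σ i).val < k), w i
  have hc : ∃ k, x < c k := ⟨m + 1, by
    have : Finset.univ.filter (fun i => (σ i).val < m + 1) = Finset.univ := by
      ext i; simp [(σ i).is_le]
    simpa only [c, this] using hx.2⟩
  have h0 : Nat.find hc ≠ 0 := by
    intro h
    have := Nat.find_spec hc
    rw [h] at this
    simp only [c, not_lt_zero, Finset.filter_false, Finset.sum_empty] at this
    exact absurd this (not_lt.2 hx.1)
  obtain ⟨k, hk⟩ := Nat.exists_eq_succ_of_ne_zero h0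
  have h1 : x < c (k + 1) := by
    have := Nat.find_spec hc
    rwa [hk] at this
  have h2 : c k ≤ x := not_lt.1 (Nat.find_min hc (by omega))
  have hkm : k < m + 1 := by
    by_contra hcon
    have : c (k + 1) = c k := by
      simp only [c]
      congr 1
      ext i
      have := (σ i).isLt
      simp only [Finset.mem_filter, Finset.mem_univ, true_and]
      omega
    linarith
  have hσ : σ (σ.symm ⟨k, hkm⟩) = ⟨k, hkm⟩ := σ.apply_symm_apply _
  have e1 : blockLeft σ w (σ.symm ⟨k, hkm⟩) = c k := by
    simp only [blockLeft, c, hσ, Fin.lt_def]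
  have e2 : blockLeft σ w (σ.symm ⟨k, hkm⟩) + w (σ.symm ⟨k, hkm⟩) = c (k + 1) := by
    rw [blockLeft_add, hσ]
    simp only [c, Fin.le_def, Nat.lt_succ_iff]
  exact ⟨σ.symm ⟨k, hkm⟩, e1.trans_le h2, h1.trans_eq e2.symm⟩

theorem block_unique (hw : ∀ j, 0 < w j) {x : ℝ} {i j : Fin (m + 1)}
    (hi : x ∈ Ico (blockLeft σ w i) (blockLeft σ w i + w i))
    (hj : x ∈ Ico (blockLeft σ w j) (blockLeft σ w j + w j)) : i = j := by
  rcases lt_trichotomy (σ i) (σ j) with h | h | h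
  · have := blockLeft_add_le hw h
    exact absurd hj.1 (not_le.2 (hi.2.trans_le this))
  · exact σ.injective h
  · have := blockLeft_add_le hw h
    exact absurd hi.1 (not_le.2 (hj.2.trans_le this))

end blocks

/-! ### The interval exchange map -/

namespace IET

variable {m : ℕ} {T : IET m}

/-- The length of the interval on which the exchange acts. -/
noncomputable def total (T : IET m) : ℝ := ∑ j, T.len j

theorem left_eq_blockLeft (T : IET m) (j : Fin (m + 1)) :
    T.left j = blockLeft (Equiv.refl _) T.len j := rfl

theorem imageLeft_eq_blockLeft (T : IET m) (j : Fin (m + 1)) :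
    T.imageLeft j = blockLeft T.perm T.len j := rfl

theorem left_nonneg (hT : ∀ j, 0 < T.len j) (j : Fin (m + 1)) : 0 ≤ T.left j :=
  blockLeft_nonneg (σ := Equiv.refl _) hT j

theorem left_add_le_total (hT : ∀ j, 0 < T.len j) (j : Fin (m + 1)) :
    T.left j + T.len j ≤ T.total :=
  blockLeft_add_le_sum (σ := Equiv.refl _) hT j

theorem left_last (T : IET m) : T.left (Fin.last m) + T.len (Fin.last m) = T.total :=
  blockLeft_add_eq_sum (σ := Equiv.refl _) rfl

theorem left_add_le_left (hT : ∀ j, 0 < T.len j) {i j : Fin (m + 1)} (h : i < j) :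
    T.left i + T.len i ≤ T.left j :=
  blockLeft_add_le (σ := Equiv.refl _) hT h

theorem imageLeft_nonneg (hT : ∀ j, 0 < T.len j) (j : Fin (m + 1)) : 0 ≤ T.imageLeft j :=
  blockLeft_nonneg hT j

theorem imageLeft_add_le_total (hT : ∀ j, 0 < T.len j) (j : Fin (m + 1)) :
    T.imageLeft j + T.len j ≤ T.total :=
  blockLeft_add_le_sum hT j

theorem imageLeft_lastImage (T : IET m) :
    T.imageLeft T.lastImage + T.len T.lastImage = T.total :=
  blockLeft_add_eq_sum (T.perm.apply_symm_apply _)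

theorem exists_mem_interval {x : ℝ} (hx : x ∈ Ico 0 T.total) : ∃ j, x ∈ T.interval j :=
  exists_mem_block (σ := Equiv.refl _) hx

theorem interval_unique (hT : ∀ j, 0 < T.len j) {x : ℝ} {i j : Fin (m + 1)}
    (hi : x ∈ T.interval i) (hj : x ∈ T.interval j) : i = j :=
  block_unique (σ := Equiv.refl _) hT hi hj

theorem interval_subset (hT : ∀ j, 0 < T.len j) (j : Fin (m + 1)) :
    T.interval j ⊆ Ico 0 T.total := fun _ hx =>
  ⟨(left_nonneg hT j).trans hx.1, hx.2.trans_le (left_add_le_total hT j)⟩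

theorem map_of_mem (hT : ∀ j, 0 < T.len j) {x : ℝ} {j : Fin (m + 1)} (hx : x ∈ T.interval j) :
    T.map x = x + (T.imageLeft j - T.left j) := by
  rw [map, Finset.sum_eq_single j]
  · rw [indicator_of_mem hx]
  · intro i _ hij
    exact indicator_of_notMem (fun hi => hij (interval_unique hT hi hx)) _
  · simp

theorem map_mem_image (hT : ∀ j, 0 < T.len j) {x : ℝ} {j : Fin (m + 1)}
    (hx : x ∈ T.interval j) :
    T.map x ∈ Ico (T.imageLeft j) (T.imageLeft j + T.len j) := by
  rw [map_of_mem hT hx]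
  obtain ⟨h1, h2⟩ := hx
  constructor <;> linarith

theorem map_mem (hT : ∀ j, 0 < T.len j) {x : ℝ} (hx : x ∈ Ico 0 T.total) :
    T.map x ∈ Ico 0 T.total := by
  obtain ⟨j, hj⟩ := exists_mem_interval hx
  have := map_mem_image hT hj
  exact ⟨(imageLeft_nonneg hT j).trans this.1, this.2.trans_le (imageLeft_add_le_total hT j)⟩

theorem iterate_map_mem (hT : ∀ j, 0 < T.len j) {x : ℝ} (hx : x ∈ Ico 0 T.total) (k : ℕ) :
    T.map^[k] x ∈ Ico 0 T.total := by
  induction k with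
  | zero => exact hx
  | succ k ih => rw [Function.iterate_succ_apply']; exact map_mem hT ih

/-- The images of the exchanged intervals are again blocks, in the order of `perm`; so equal images
force the same interval, on which the map is a translation. -/
theorem injOn_map (hT : ∀ j, 0 < T.len j) : InjOn T.map (Ico 0 T.total) := by
  intro x hx y hy h
  obtain ⟨i, hi⟩ := exists_mem_interval hx
  obtain ⟨j, hj⟩ := exists_mem_interval hy
  have h1 := map_mem_image hT hi
  have h2 := map_mem_image hT hj
  rw [h] at h1
  obtain rfl : i = j := block_unique hT h1 h2
  rw [map_of_mem hT hi, map_of_mem hT hj] at h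
  linarith

theorem iterate_map_injOn (hT : ∀ j, 0 < T.len j) {x y : ℝ} (hx : x ∈ Ico 0 T.total)
    (hy : y ∈ Ico 0 T.total) {k : ℕ} (h : T.map^[k] x = T.map^[k] y) : x = y := by
  induction k with
  | zero => exact h
  | succ k ih =>
    rw [Function.iterate_succ_apply', Function.iterate_succ_apply'] at h
    exact ih (injOn_map hT (iterate_map_mem hT hx k) (iterate_map_mem hT hy k) h)

end IET

/-! ### One step of Rauzy–Veech induction -/

namespace IET

variable {m : ℕ} {T : IET m}

theorem relabelA_eq_self_iff {s j : Fin (m + 1)} (hs : s ≠ Fin.last m) :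
    relabelA s j = s ↔ j = s := by
  have h1 : s.val ≠ m := fun h => hs (Fin.ext h)
  have h2 := s.isLt
  have h3 := j.isLt
  rw [Fin.ext_iff, Fin.ext_iff]
  unfold relabelA
  split_ifs <;> simp only [Fin.val_last] <;> omega

theorem relabelA_eq_last_iff {s j : Fin (m + 1)} (hs : s ≠ Fin.last m) :
    relabelA s j = Fin.last m ↔ j.val = s.val + 1 := by
  have h1 : s.val ≠ m := fun h => hs (Fin.ext h)
  have h2 := s.isLt
  have h3 := j.isLt
  have h4 : (Fin.last m).val = m := rfl
  rw [Fin.ext_iff]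
  unfold relabelA
  split_ifs with h5 h6
  · omega
  · simp only [h6]
  · simp only [Fin.val_last]
    omega

theorem rauzyMatrix_apply_of_typeA (hA : T.IsTypeA) (i j : Fin (m + 1)) :
    T.rauzyMatrix i j = (if i = relabelA T.lastImage j then 1 else 0) +
      if i = T.lastImage ∧ relabelA T.lastImage j = Fin.last m then 1 else 0 := by
  rw [rauzyMatrix, if_pos hA, Matrix.add_mul, Matrix.one_mul, Matrix.add_apply, Matrix.of_apply]
  congr 1
  by_cases hi : i = T.lastImage
  · subst hi
    rw [Matrix.single_mul_apply_same, Matrix.of_apply, one_mul]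
    simp [eq_comm]
  · rw [Matrix.single_mul_apply_of_ne (h := hi), if_neg fun h => hi h.1]

theorem rauzyMatrix_apply_of_not_typeA (hA : ¬T.IsTypeA) (i j : Fin (m + 1)) :
    T.rauzyMatrix i j = (if i = j then 1 else 0) +
      if i = Fin.last m ∧ j = T.lastImage then 1 else 0 := by
  rw [rauzyMatrix, if_neg hA, Matrix.add_apply, Matrix.one_apply, Matrix.single_apply]
  congr 1
  simp [eq_comm]

theorem rauzy_len_of_typeA (hA : T.IsTypeA) (j : Fin (m + 1)) :
    T.rauzy.len j = if j = T.lastImage then T.len T.lastImage - T.len (Fin.last m)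
      else T.len (relabelA T.lastImage j) := by
  rw [rauzy, if_pos hA]

theorem rauzy_len_of_not_typeA (hA : ¬T.IsTypeA) (j : Fin (m + 1)) :
    T.rauzy.len j = if j = Fin.last m then T.len (Fin.last m) - T.len T.lastImage
      else T.len j := by
  rw [rauzy, if_neg hA]

theorem IsTypeA.lastImage_ne (hA : T.IsTypeA) : T.lastImage ≠ Fin.last m := by
  intro h
  rw [IsTypeA, h] at hA
  exact lt_irrefl _ hA

/-- If the last interval kept its place, the step would be of type `b` and would subtract a length
from itself. -/
theorem lastImage_ne_last (h : T.rauzy.len (Fin.last m) ≠ 0) : T.lastImage ≠ Fin.last m := by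
  by_cases hA : T.IsTypeA
  · exact hA.lastImage_ne
  · intro hs
    rw [rauzy_len_of_not_typeA hA, if_pos rfl, hs, sub_self] at h
    exact h rfl

theorem sum_ite_add_ite_mul (i a : Fin (m + 1)) (P : Prop) [Decidable P] (g : Fin (m + 1) → ℝ) :
    ∑ k, (((if i = k then 1 else 0) + if P ∧ k = a then 1 else 0 : ℕ) : ℝ) * g k =
      g i + if P then g a else 0 := by
  push_cast
  simp only [add_mul, Finset.sum_add_distrib]
  by_cases hP : P <;> simp [hP]

/-- An algebraic identity that needs no sign of the lengths; it can therefore carry positivity as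
well as negativity backwards. -/
theorem len_eq_sum_rauzyMatrix (hs : T.lastImage ≠ Fin.last m) (i : Fin (m + 1)) :
    T.len i = ∑ j, (T.rauzyMatrix i j : ℝ) * T.rauzy.len j := by
  by_cases hA : T.IsTypeA
  · let ρ := relabelPermA T.lastImage
    have hρ : ∀ j, ρ j = relabelA T.lastImage j := fun _ => rfl
    have hlen : ∀ j, T.rauzy.len j =
        (fun k => if k = T.lastImage then T.len T.lastImage - T.len (Fin.last m)
          else T.len k) (ρ j) := by
      intro j
      simp only [rauzy_len_of_typeA hA, hρ, relabelA_eq_self_iff hs]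
    simp only [rauzyMatrix_apply_of_typeA hA, hlen, ← hρ]
    rw [Equiv.sum_comp ρ (fun k => (((if i = k then 1 else 0) +
      if i = T.lastImage ∧ k = Fin.last m then 1 else 0 : ℕ) : ℝ) *
      if k = T.lastImage then T.len T.lastImage - T.len (Fin.last m) else T.len k)]
    rw [sum_ite_add_ite_mul]
    by_cases hi : i = T.lastImage
    · simp [hi, hs.symm]
    · simp [hi]
  · simp only [rauzyMatrix_apply_of_not_typeA hA, sum_ite_add_ite_mul,
      rauzy_len_of_not_typeA hA]
    by_cases hi : i = Fin.last m
    · simp [hi, hs]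
    · simp [hi]

theorem rauzy_total_of_typeA (hA : T.IsTypeA) :
    T.rauzy.total = T.total - T.len (Fin.last m) := by
  have hs := hA.lastImage_ne
  let ρ := relabelPermA T.lastImage
  have hlen : ∀ j, T.rauzy.len j =
      (fun k => T.len k - if k = T.lastImage then T.len (Fin.last m) else 0) (ρ j) := by
    intro j
    have hρ : ρ j = relabelA T.lastImage j := rfl
    simp only [rauzy_len_of_typeA hA, hρ, relabelA_eq_self_iff hs]
    split_ifs with h
    · rw [h, (relabelA_eq_self_iff hs).2 rfl]
    · simp
  rw [total, Finset.sum_congr rfl fun j _ => hlen j,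
    Equiv.sum_comp ρ (fun k => T.len k - if k = T.lastImage then T.len (Fin.last m) else 0)]
  simp [total]

theorem rauzy_total_of_not_typeA (hA : ¬T.IsTypeA) :
    T.rauzy.total = T.total - T.len T.lastImage := by
  have hlen : ∀ j, T.rauzy.len j = T.len j - if j = Fin.last m then T.len T.lastImage else 0 := by
    intro j
    rw [rauzy_len_of_not_typeA hA]
    split_ifs with h
    · rw [h]
    · simp
  simp only [total, hlen]
  simp

theorem left_succ (T : IET m) {i j : Fin (m + 1)} (h : j.val = i.val + 1) :
    T.left j = T.left i + T.len i := by
  rw [left_eq_blockLeft, left_eq_blockLeft, blockLeft_add, blockLeft]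
  congr 1
  ext k
  simp only [Finset.mem_filter, Finset.mem_univ, true_and, Equiv.refl_apply, Fin.lt_def,
    Fin.le_def]
  omega

section typeA

theorem rauzy_left_of_typeA_le (hA : T.IsTypeA) {j : Fin (m + 1)} (hj : j ≤ T.lastImage) :
    T.rauzy.left j = T.left j := by
  refine Finset.sum_congr rfl fun i hi => ?_
  have hi' : i < T.lastImage := (Finset.mem_filter.1 hi).2.trans_le hj
  rw [rauzy_len_of_typeA hA, if_neg hi'.ne, relabelA, if_pos (Fin.le_def.1 hi'.le)]

theorem rauzy_left_of_typeA_succ (hA : T.IsTypeA) {j : Fin (m + 1)}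
    (hj : j.val = T.lastImage.val + 1) :
    T.rauzy.left j = T.left T.lastImage + (T.len T.lastImage - T.len (Fin.last m)) := by
  rw [left_succ _ hj, rauzy_left_of_typeA_le hA le_rfl, rauzy_len_of_typeA hA, if_pos rfl]

/-- The two pieces of the split interval have the same total length as before, so everything to
their right stays in place under a shifted index; `k` counts the steps beyond them. -/
theorem rauzy_left_of_typeA_gt (hA : T.IsTypeA) (k : ℕ) :
    ∀ j : Fin (m + 1), j.val = T.lastImage.val + 2 + k →
      T.rauzy.left j = T.left (relabelA T.lastImage j) := by
  have hs := hA.lastImage_ne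
  induction k with
  | zero =>
    intro j hj
    have hjl := j.isLt
    let i : Fin (m + 1) := ⟨T.lastImage.val + 1, by omega⟩
    have hi : i.val = T.lastImage.val + 1 := rfl
    have hρ : relabelA T.lastImage j = i := by
      apply Fin.ext
      unfold relabelA
      split_ifs <;> simp only [i] <;> omega
    rw [left_succ _ (i := i) (by omega), rauzy_left_of_typeA_succ hA hi, rauzy_len_of_typeA hA,
      if_neg (fun h => by have := congrArg Fin.val h; omega), (relabelA_eq_last_iff hs).2 hi, hρ,
      left_succ T hi]
    ring
  | succ k ih =>
    intro j hj
    have hjl := j.isLt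
    let i : Fin (m + 1) := ⟨T.lastImage.val + 2 + k, by omega⟩
    have hi : i.val = T.lastImage.val + 2 + k := rfl
    have hρ : (relabelA T.lastImage j).val = (relabelA T.lastImage i).val + 1 := by
      unfold relabelA
      split_ifs <;> (try simp only) <;> omega
    rw [left_succ _ (i := i) (by omega), ih i hi, rauzy_len_of_typeA hA,
      if_neg (fun h => by have := congrArg Fin.val h; omega), left_succ T hρ]

/-- The relabelling is absorbed by the new permutation. The only shortened interval occupies the
last position, so it lies to the left of no image. -/
theorem rauzy_imageLeft_of_typeA (hA : T.IsTypeA) (j : Fin (m + 1)) :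
    T.rauzy.imageLeft j = T.imageLeft (relabelA T.lastImage j) := by
  have hs := hA.lastImage_ne
  let ρ := relabelPermA T.lastImage
  have hρ : ∀ j, ρ j = relabelA T.lastImage j := fun _ => rfl
  have hperm : ∀ i, T.rauzy.perm i = T.perm (ρ i) := by
    intro i
    rw [rauzy, if_pos hA]
    rfl
  rw [imageLeft, imageLeft, Finset.sum_filter, Finset.sum_filter,
    ← Equiv.sum_comp ρ (fun i => if T.perm i < _ then T.len i else 0)]
  refine Finset.sum_congr rfl fun i _ => ?_
  rw [hperm, hperm, ← hρ]
  by_cases h : T.perm (ρ i) < T.perm (ρ j)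
  · rw [if_pos h, if_pos h, rauzy_len_of_typeA hA, if_neg, hρ]
    rintro rfl
    have : ρ T.lastImage = T.lastImage := (relabelA_eq_self_iff hs).2 rfl
    rw [this, lastImage, Equiv.apply_symm_apply] at h
    exact absurd h (not_lt.2 (Fin.le_last _))
  · rw [if_neg h, if_neg h]

end typeA

section typeB

theorem rauzy_left_of_not_typeA (hA : ¬T.IsTypeA) (j : Fin (m + 1)) :
    T.rauzy.left j = T.left j := by
  refine Finset.sum_congr rfl fun i hi => ?_
  have hi' : i < j := (Finset.mem_filter.1 hi).2
  rw [rauzy_len_of_not_typeA hA, if_neg (hi'.trans_le (Fin.le_last _)).ne]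

theorem rauzy_perm_of_not_typeA (hA : ¬T.IsTypeA) (j : Fin (m + 1)) :
    T.rauzy.perm j = relabelB (T.perm (Fin.last m)) (T.perm j) := by
  rw [rauzy, if_neg hA]
  rfl

theorem relabelB_val (p v : Fin (m + 1)) :
    (relabelB p v).val = if v.val ≤ p.val then v.val else if v.val < m then v.val + 1
      else p.val + 1 := by
  unfold relabelB
  split_ifs <;> rfl

theorem perm_lastImage (T : IET m) : T.perm T.lastImage = Fin.last m :=
  T.perm.apply_symm_apply _

theorem perm_ne_last {j : Fin (m + 1)} (hj : j ≠ T.lastImage) : (T.perm j).val < m := by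
  have h : T.perm j ≠ Fin.last m := fun h => hj (by rw [lastImage, ← h, Equiv.symm_apply_apply])
  exact Fin.val_lt_last h

/-- The image of the last interval loses the length of `lastImage`, whose image is inserted
immediately to its right. Beyond both, the two corrections in `key` cancel. -/
theorem rauzy_imageLeft_of_not_typeA (hA : ¬T.IsTypeA) (hs : T.lastImage ≠ Fin.last m)
    {j : Fin (m + 1)} (hj : j ≠ T.lastImage) : T.rauzy.imageLeft j = T.imageLeft j := by
  have hp : (T.perm (Fin.last m)).val < m := perm_ne_last hs.symm
  have hjm := perm_ne_last hj
  rw [imageLeft, imageLeft, Finset.sum_filter, Finset.sum_filter]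
  have key : ∀ i, (if T.rauzy.perm i < T.rauzy.perm j then T.rauzy.len i else 0) =
      (if T.perm i < T.perm j then T.len i else 0) +
      ((if i = Fin.last m then
          (if T.perm (Fin.last m) < T.perm j then - T.len T.lastImage else 0) else 0) +
      (if i = T.lastImage then
          (if T.perm (Fin.last m) < T.perm j then T.len T.lastImage else 0) else 0)) := by
    intro i
    rw [rauzy_perm_of_not_typeA hA, rauzy_perm_of_not_typeA hA, rauzy_len_of_not_typeA hA]
    simp only [Fin.lt_def, relabelB_val]
    by_cases hil : i = Fin.last m
    · subst hil
      simp only [if_true, if_neg hs.symm, le_refl]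
      split_ifs <;> first | omega | ring
    · by_cases his : i = T.lastImage
      · subst his
        simp only [if_neg hil, if_true, perm_lastImage, Fin.val_last]
        split_ifs <;> first | omega | ring
      · have := perm_ne_last his
        have hne : (T.perm i).val ≠ (T.perm (Fin.last m)).val := fun h =>
          hil (T.perm.injective (Fin.ext h))
        simp only [if_neg hil, if_neg his]
        split_ifs <;> first | omega | ring
  simp only [key, Finset.sum_add_distrib, Finset.sum_ite_eq', Finset.mem_univ, if_true]
  split_ifs <;> ring

theorem rauzy_imageLeft_lastImage_of_not_typeA (hA : ¬T.IsTypeA)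
    (hs : T.lastImage ≠ Fin.last m) :
    T.rauzy.imageLeft T.lastImage =
      T.imageLeft (Fin.last m) + (T.len (Fin.last m) - T.len T.lastImage) := by
  have hp : (T.perm (Fin.last m)).val < m := perm_ne_last hs.symm
  rw [imageLeft, imageLeft, Finset.sum_filter, Finset.sum_filter]
  have key : ∀ i, (if T.rauzy.perm i < T.rauzy.perm T.lastImage then T.rauzy.len i else 0) =
      (if T.perm i < T.perm (Fin.last m) then T.len i else 0) +
      (if i = Fin.last m then T.len (Fin.last m) - T.len T.lastImage else 0) := by
    intro i
    rw [rauzy_perm_of_not_typeA hA, rauzy_perm_of_not_typeA hA, rauzy_len_of_not_typeA hA,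
      perm_lastImage]
    simp only [Fin.lt_def, relabelB_val, Fin.val_last]
    by_cases hil : i = Fin.last m
    · subst hil
      simp only [if_true, le_refl]
      split_ifs <;> first | omega | ring
    · have := (T.perm i).is_le
      have hne : (T.perm i).val ≠ (T.perm (Fin.last m)).val := fun h =>
          hil (T.perm.injective (Fin.ext h))
      simp only [if_neg hil]
      split_ifs <;> first | omega | ring
  simp only [key, Finset.sum_add_distrib, Finset.sum_ite_eq', Finset.mem_univ, if_true]

end typeB

/-- Over the `i`-th interval of the induced exchange, the induced map is the original one or its
second iterate, as recorded by the `i`-th column of the matrix. -/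
theorem rauzy_column (hT : ∀ j, 0 < T.len j) (hT' : ∀ j, 0 < T.rauzy.len j) (i : Fin (m + 1)) :
    (∃ j, (∀ k, T.rauzyMatrix k i = if k = j then 1 else 0) ∧
      ∀ z ∈ T.rauzy.interval i, z ∈ T.interval j ∧ T.rauzy.map z = T.map z) ∨
    ∃ j j', (∀ k, T.rauzyMatrix k i = (if k = j then 1 else 0) + if k = j' then 1 else 0) ∧
      ∀ z ∈ T.rauzy.interval i, z ∈ T.interval j ∧ T.map z ∈ T.interval j' ∧
        T.rauzy.total ≤ T.map z ∧ T.rauzy.map z = T.map (T.map z) := by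
  have hs := lastImage_ne_last (hT' (Fin.last m)).ne'
  have hIL := T.imageLeft_lastImage
  have hL := T.left_last
  by_cases hA : T.IsTypeA
  · by_cases hi : i.val = T.lastImage.val + 1
    · right
      have hρ := (relabelA_eq_last_iff hs).2 hi
      -- The cut-off right end of the longer interval is mapped onto the old last interval, which
      -- has been removed, so it needs a second application.
      refine ⟨T.lastImage, Fin.last m, fun k => ?_, fun z hz => ?_⟩
      · rw [rauzyMatrix_apply_of_typeA hA, hρ, add_comm]
        simp
      · have hmap := map_of_mem hT' hz
        have hneq : i ≠ T.lastImage := fun h => by rw [h] at hi; omega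
        rw [interval, rauzy_left_of_typeA_succ hA hi, rauzy_len_of_typeA hA, if_neg hneq,
          hρ] at hz
        have h0 : T.len (Fin.last m) < T.len T.lastImage := hA
        have hz1 : z ∈ T.interval T.lastImage := ⟨by linarith [hz.1], by linarith [hz.2]⟩
        have h1 := map_of_mem hT hz1
        have hz2 : T.map z ∈ T.interval (Fin.last m) := by
          rw [h1]
          exact ⟨by linarith [hz.1], by linarith [hz.2]⟩
        refine ⟨hz1, hz2, ?_, ?_⟩
        · rw [rauzy_total_of_typeA hA, ← hL]
          linarith [hz2.1]
        · rw [hmap, map_of_mem hT hz2, h1, rauzy_imageLeft_of_typeA hA, hρ,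
            rauzy_left_of_typeA_succ hA hi]
          linarith
    · left
      have hρ : relabelA T.lastImage i ≠ Fin.last m := fun h =>
        hi ((relabelA_eq_last_iff hs).1 h)
      have hleft : T.rauzy.left i = T.left (relabelA T.lastImage i) := by
        by_cases hle : i ≤ T.lastImage
        · rw [rauzy_left_of_typeA_le hA hle, relabelA, if_pos (Fin.le_def.1 hle)]
        · exact rauzy_left_of_typeA_gt hA (i.val - (T.lastImage.val + 2)) i
            (by rw [Fin.le_def] at hle; omega)
      have hlen : T.rauzy.len i ≤ T.len (relabelA T.lastImage i) := by
        rw [rauzy_len_of_typeA hA]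
        split_ifs with h
        · rw [h, (relabelA_eq_self_iff hs).2 rfl]
          linarith [hT (Fin.last m)]
        · rfl
      refine ⟨relabelA T.lastImage i, fun k => ?_, fun z hz => ?_⟩
      · rw [rauzyMatrix_apply_of_typeA hA]
        simp [hρ]
      · have hz1 : z ∈ T.interval (relabelA T.lastImage i) := by
          obtain ⟨h1, h2⟩ := hz
          exact ⟨by linarith, by linarith⟩
        refine ⟨hz1, ?_⟩
        rw [map_of_mem hT' hz, map_of_mem hT hz1, hleft, rauzy_imageLeft_of_typeA hA]
  · have hlt : T.len T.lastImage < T.len (Fin.last m) := by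
      have := hT' (Fin.last m)
      rw [rauzy_len_of_not_typeA hA, if_pos rfl] at this
      linarith
    by_cases hi : i = T.lastImage
    · right
      -- Here the image of the interval is exactly the removed right end, contained in the last
      -- interval.
      refine ⟨i, Fin.last m, fun k => ?_, fun z hz => ?_⟩
      · rw [rauzyMatrix_apply_of_not_typeA hA]
        simp [hi]
      · have hmap := map_of_mem hT' hz
        subst hi
        rw [interval, rauzy_left_of_not_typeA hA, rauzy_len_of_not_typeA hA, if_neg hs] at hz
        have h1 := map_of_mem hT (j := T.lastImage) hz
        have hz2 : T.map z ∈ T.interval (Fin.last m) := by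
          rw [h1]
          exact ⟨by linarith [hz.1], by linarith [hz.2]⟩
        refine ⟨hz, hz2, ?_, ?_⟩
        · rw [rauzy_total_of_not_typeA hA, h1]
          linarith [hz.1]
        · rw [hmap, map_of_mem hT hz2, h1, rauzy_imageLeft_lastImage_of_not_typeA hA hs,
            rauzy_left_of_not_typeA hA]
          linarith
    · left
      have hlen : T.rauzy.len i ≤ T.len i := by
        rw [rauzy_len_of_not_typeA hA]
        split_ifs with h
        · rw [h]
          linarith [hT T.lastImage]
        · rfl
      refine ⟨i, fun k => ?_, fun z hz => ?_⟩
      · rw [rauzyMatrix_apply_of_not_typeA hA]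
        simp [hi]
      · have hleft := rauzy_left_of_not_typeA hA i
        have hz1 : z ∈ T.interval i := by
          obtain ⟨h1, h2⟩ := hz
          exact ⟨by linarith, by linarith⟩
        refine ⟨hz1, ?_⟩
        rw [map_of_mem hT' hz, map_of_mem hT hz1, hleft,
          rauzy_imageLeft_of_not_typeA hA hs hi]

theorem rauzy_total_le (hT : ∀ j, 0 < T.len j) : T.rauzy.total ≤ T.total := by
  by_cases hA : T.IsTypeA
  · rw [rauzy_total_of_typeA hA]
    linarith [hT (Fin.last m)]
  · rw [rauzy_total_of_not_typeA hA]
    linarith [hT T.lastImage]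

/-- Points removed by the induction are images of remaining points. -/
theorem exists_map_eq_of_rauzy_total_le (hT : ∀ j, 0 < T.len j) (hT' : ∀ j, 0 < T.rauzy.len j)
    {z : ℝ} (hz : z ∈ Ico T.rauzy.total T.total) :
    ∃ w ∈ Ico 0 T.rauzy.total, T.map w = z := by
  have hs := lastImage_ne_last (hT' (Fin.last m)).ne'
  have hIL := T.imageLeft_lastImage
  have hL := T.left_last
  have hlt : T.left T.lastImage + T.len T.lastImage ≤ T.left (Fin.last m) :=
    left_add_le_left hT (lt_of_le_of_ne (Fin.le_last _) hs)
  have h0 := left_nonneg hT T.lastImage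
  obtain ⟨h1, h2⟩ := hz
  -- The removed piece lies inside the image of `lastImage`, and `lastImage` itself lies to the left
  -- of the last interval, hence survives the shortening.
  have key : T.left (Fin.last m) ≤ T.rauzy.total ∧ T.imageLeft T.lastImage ≤ z := by
    by_cases hA : T.IsTypeA
    · rw [rauzy_total_of_typeA hA] at h1 ⊢
      have hA' : T.len (Fin.last m) < T.len T.lastImage := hA
      exact ⟨by linarith, by linarith⟩
    · rw [rauzy_total_of_not_typeA hA] at h1 ⊢
      have hA' : T.len T.lastImage ≤ T.len (Fin.last m) := not_lt.1 hA
      exact ⟨by linarith, by linarith⟩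
  have hw : z - (T.imageLeft T.lastImage - T.left T.lastImage) ∈ T.interval T.lastImage :=
    ⟨by linarith [key.2], by linarith⟩
  refine ⟨_, ⟨h0.trans hw.1, by linarith [hw.2, key.1]⟩, ?_⟩
  rw [map_of_mem hT hw]
  ring

end IET

/-! ### Iterated induction, the cocycle and Rokhlin towers -/

namespace IET

variable {m : ℕ} {T : IET m}

theorem iter_succ (T : IET m) (n : ℕ) : T.iter (n + 1) = (T.iter n).rauzy :=
  Function.iterate_succ_apply' _ _ _

theorem cocycle_self (T : IET m) (p : ℕ) : T.cocycle p p = 1 := by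
  simp [cocycle]

theorem cocycle_succ (T : IET m) {p q : ℕ} (h : p ≤ q) :
    T.cocycle p (q + 1) = T.cocycle p q * (T.iter q).rauzyMatrix := by
  rw [cocycle, cocycle, Nat.succ_sub h, List.range'_concat]
  simp [Nat.add_sub_cancel' h]

theorem cocycle_mul (T : IET m) {p q r : ℕ} (hpq : p ≤ q) (hqr : q ≤ r) :
    T.cocycle p r = T.cocycle p q * T.cocycle q r := by
  induction r, hqr using Nat.le_induction with
  | base => rw [cocycle_self, mul_one]
  | succ r hqr ih => rw [cocycle_succ T (hpq.trans hqr), ih, mul_assoc, ← cocycle_succ T hqr]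

theorem height_zero (T : IET m) (j : Fin (m + 1)) : T.height 0 j = 1 := by
  simp [height, cocycle_self, Matrix.one_apply]

theorem height_eq_sum (T : IET m) {p q : ℕ} (h : p ≤ q) (i : Fin (m + 1)) :
    T.height q i = ∑ j, T.height p j * T.cocycle p q j i := by
  simp only [height, cocycle_mul T (Nat.zero_le p) h, Matrix.mul_apply, Finset.sum_mul]
  exact Finset.sum_comm

theorem height_succ (T : IET m) (n : ℕ) (i : Fin (m + 1)) :
    T.height (n + 1) i = ∑ j, T.height n j * (T.iter n).rauzyMatrix j i := by
  rw [height_eq_sum T n.le_succ, cocycle_succ T le_rfl, cocycle_self, one_mul]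

theorem len_eq_sum_cocycle (hT : ∀ n j, 0 < (T.iter n).len j) {p q : ℕ} (h : p ≤ q)
    (i : Fin (m + 1)) :
    (T.iter p).len i = ∑ j, (T.cocycle p q i j : ℝ) * (T.iter q).len j := by
  induction q, h using Nat.le_induction generalizing i with
  | base => simp [cocycle_self, Matrix.one_apply]
  | succ q h ih =>
    rw [ih]
    have key := len_eq_sum_rauzyMatrix (T := T.iter q)
      (lastImage_ne_last (by rw [← iter_succ]; exact (hT _ _).ne'))
    simp only [cocycle_succ T h, Matrix.mul_apply, Nat.cast_sum, Nat.cast_mul, Finset.sum_mul,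
      iter_succ]
    rw [Finset.sum_comm]
    refine Finset.sum_congr rfl fun j _ => ?_
    rw [key j, Finset.mul_sum]
    exact Finset.sum_congr rfl fun k _ => by ring

/-- Positivity of the lengths at some step propagates backwards. -/
theorem len_pos_of_rauzy (h : ∀ j, 0 < T.rauzy.len j) (j : Fin (m + 1)) : 0 < T.len j := by
  have hs := lastImage_ne_last (h (Fin.last m)).ne'
  by_cases hA : T.IsTypeA
  · have key := len_eq_sum_rauzyMatrix hs j
    obtain ⟨i, hi⟩ := (relabelPermA T.lastImage).surjective j
    rw [key]
    refine Finset.sum_pos' (fun k _ => mul_nonneg (Nat.cast_nonneg _) (h k).le)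
      ⟨i, Finset.mem_univ _, mul_pos ?_ (h i)⟩
    rw [rauzyMatrix_apply_of_typeA hA, if_pos (show j = relabelA T.lastImage i from hi.symm)]
    positivity
  · have key := len_eq_sum_rauzyMatrix hs j
    rw [key]
    refine Finset.sum_pos' (fun k _ => mul_nonneg (Nat.cast_nonneg _) (h k).le)
      ⟨j, Finset.mem_univ _, mul_pos ?_ (h j)⟩
    rw [rauzyMatrix_apply_of_not_typeA hA, if_pos rfl]
    positivity

/-- Negativity of the lengths at some step propagates backwards. -/
theorem len_neg_of_rauzy (h : ∀ j, T.rauzy.len j < 0) (j : Fin (m + 1)) : T.len j < 0 := by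
  have hs := lastImage_ne_last (h (Fin.last m)).ne
  have key := len_eq_sum_rauzyMatrix hs j
  rw [key]
  by_cases hA : T.IsTypeA
  · obtain ⟨i, hi⟩ := (relabelPermA T.lastImage).surjective j
    refine Finset.sum_neg' (fun k _ => mul_nonpos_of_nonneg_of_nonpos (Nat.cast_nonneg _) (h k).le)
      ⟨i, Finset.mem_univ _, mul_neg_of_pos_of_neg ?_ (h i)⟩
    rw [rauzyMatrix_apply_of_typeA hA, if_pos (show j = relabelA T.lastImage i from hi.symm)]
    positivity
  · refine Finset.sum_neg' (fun k _ => mul_nonpos_of_nonneg_of_nonpos (Nat.cast_nonneg _) (h k).le)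
      ⟨j, Finset.mem_univ _, mul_neg_of_pos_of_neg ?_ (h j)⟩
    rw [rauzyMatrix_apply_of_not_typeA hA, if_pos rfl]
    positivity

theorem iter_len_pos_of_le {p q : ℕ} (hpq : p ≤ q) (h : ∀ j, 0 < (T.iter q).len j) :
    ∀ j, 0 < (T.iter p).len j := by
  induction q, hpq using Nat.le_induction with
  | base => exact h
  | succ q _ ih => exact ih (len_pos_of_rauzy (by rwa [← iter_succ]))

theorem iter_len_neg (n : ℕ) (h : ∀ j, (T.iter n).len j < 0) : ∀ j, T.len j < 0 := by
  induction n with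
  | zero => exact h
  | succ q ih => exact ih (len_neg_of_rauzy (by rwa [← iter_succ]))

/-- Ratios bounded below by a positive number make the lengths at a balanced time nonzero and of one
sign. A negative sign would propagate back to the initial lengths; the positive one propagates back
to every earlier step, and `k ≤ n k`. -/
theorem IsBalancedSeq.iter_len_pos {τ ν κ D : ℝ} {n : ℕ → ℕ} {lbar : ℕ}
    (h : T.IsBalancedSeq τ n ν κ D lbar) (hT : ∀ j, 0 < T.len j) (k : ℕ) :
    ∀ j, 0 < (T.iter k).len j := by
  refine iter_len_pos_of_le (h.strictMono.id_le k) ?_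
  have hν : 0 < 1 / ν := by have := h.one_lt_nu; positivity
  have hrat : ∀ i j, 0 < (T.iter (n k)).len i / (T.iter (n k)).len j := fun i j =>
    hν.trans_le (h.len_balance k i j).1
  have h0 : (T.iter (n k)).len 0 ≠ 0 := by
    intro h0
    have := hrat 0 0
    rw [h0, zero_div] at this
    exact lt_irrefl _ this
  rcases lt_or_gt_of_ne h0 with h1 | h1
  · have hneg : ∀ j, (T.iter (n k)).len j < 0 := by
      intro j
      rcases div_pos_iff.1 (hrat j 0) with h2 | h2
      · linarith [h2.2]
      · exact h2.1
    exact absurd (iter_len_neg _ hneg 0) (not_lt.2 (hT 0).le)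
  · intro j
    rcases div_pos_iff.1 (hrat j 0) with h2 | h2
    · exact h2.1
    · linarith [h2.2]

/-- The Rokhlin towers of heights `h j` over the intervals of the exchange `S`, for the map of
`T`, when `S` is the induced map on an initial interval. -/
structure IsTower (T S : IET m) (h : Fin (m + 1) → ℕ) : Prop where
  len_pos : ∀ j, 0 < S.len j
  total_le : S.total ≤ T.total
  height_pos : ∀ j, 0 < h j
  map_eq : ∀ j, ∀ z ∈ S.interval j, T.map^[h j] z = S.map z
  avoid : ∀ j, ∀ z ∈ S.interval j, ∀ q, 0 < q → q < h j → S.total ≤ T.map^[q] z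
  translate : ∀ j, ∀ z ∈ S.interval j, ∀ z' ∈ S.interval j, ∀ q ≤ h j,
    T.map^[q] z' - T.map^[q] z = z' - z
  cover : ∀ x ∈ Ico 0 T.total, ∃ j, ∃ z ∈ S.interval j, ∃ q < h j, T.map^[q] z = x

theorem isTower_zero (hT : ∀ j, 0 < T.len j) : IsTower T T fun _ => 1 where
  len_pos := hT
  total_le := le_rfl
  height_pos _ := one_pos
  map_eq _ _ _ := rfl
  avoid _ _ _ q h0 h1 := by omega
  translate j z hz z' hz' q hq := by
    interval_cases q
    · rfl
    · simp only [Function.iterate_one]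
      rw [map_of_mem hT hz, map_of_mem hT hz']
      ring
  cover x hx := by
    obtain ⟨j, hj⟩ := exists_mem_interval hx
    exact ⟨j, x, hj, 0, one_pos, rfl⟩

/-- Each new tower is one old tower or two old towers stacked, according to its column of the Rauzy
matrix. The intermediate passage between stacked towers falls in the removed piece, which gives
`avoid`. -/
theorem IsTower.rauzy {S : IET m} {h h' : Fin (m + 1) → ℕ} (H : IsTower T S h)
    (hS' : ∀ j, 0 < S.rauzy.len j) (hh : ∀ i, h' i = ∑ j, h j * S.rauzyMatrix j i) :
    IsTower T S.rauzy h' := by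
  have col := rauzy_column H.len_pos hS'
  have htot := rauzy_total_le H.len_pos
  have one : ∀ i j, (∀ k, S.rauzyMatrix k i = if k = j then 1 else 0) → h' i = h j := by
    intro i j hc
    simp [hh, hc]
  have two : ∀ i j j', (∀ k, S.rauzyMatrix k i = (if k = j then 1 else 0) +
      if k = j' then 1 else 0) → h' i = h j' + h j := by
    intro i j j' hc
    simp [hh, hc, mul_add, Finset.sum_add_distrib, add_comm]
  have split : ∀ (q a : ℕ) (z : ℝ), a ≤ q → T.map^[q] z = T.map^[q - a] (T.map^[a] z) := by
    intro q a z haq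
    rw [← Function.iterate_add_apply, Nat.sub_add_cancel haq]
  refine ⟨hS', htot.trans H.total_le, fun i => ?_, fun i z hz => ?_, fun i z hz q hq0 hq => ?_,
    fun i z hz z' hz' q hq => ?_, fun x hx => ?_⟩
  · rcases col i with ⟨j, hc, -⟩ | ⟨j, j', hc, -⟩
    · rw [one i j hc]; exact H.height_pos j
    · rw [two i j j' hc]; exact Nat.add_pos_right _ (H.height_pos j)
  · rcases col i with ⟨j, hc, hz'⟩ | ⟨j, j', hc, hz'⟩
    · obtain ⟨h1, h2⟩ := hz' z hz
      rw [one i j hc, h2, H.map_eq j z h1]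
    · obtain ⟨h1, h2, -, h4⟩ := hz' z hz
      rw [two i j j' hc, Function.iterate_add_apply, H.map_eq j z h1, H.map_eq j' _ h2, h4]
  · rcases col i with ⟨j, hc, hz'⟩ | ⟨j, j', hc, hz'⟩
    · rw [one i j hc] at hq
      exact htot.trans (H.avoid j z (hz' z hz).1 q hq0 hq)
    · rw [two i j j' hc] at hq
      obtain ⟨h1, h2, h3, -⟩ := hz' z hz
      rcases lt_trichotomy q (h j) with hlt | heq | hgt
      · exact htot.trans (H.avoid j z h1 q hq0 hlt)
      · rw [heq, H.map_eq j z h1]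
        exact h3
      · rw [split q (h j) z hgt.le, H.map_eq j z h1]
        exact htot.trans (H.avoid j' _ h2 _ (by omega) (by omega))
  · rcases col i with ⟨j, hc, hc'⟩ | ⟨j, j', hc, hc'⟩
    · rw [one i j hc] at hq
      exact H.translate j z (hc' z hz).1 z' (hc' z' hz').1 q hq
    · rw [two i j j' hc] at hq
      obtain ⟨h1, h2, -, -⟩ := hc' z hz
      obtain ⟨h1', h2', -, -⟩ := hc' z' hz'
      rcases le_total q (h j) with hle | hge
      · exact H.translate j z h1 z' h1' q hle
      · have e := H.translate j z h1 z' h1' _ le_rfl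
        rw [H.map_eq j z h1, H.map_eq j z' h1'] at e
        rw [split q (h j) z hge, split q (h j) z' hge, H.map_eq j z h1, H.map_eq j z' h1',
          H.translate j' _ h2 _ h2' (q - h j) (by omega), e]
  · obtain ⟨j, z, hz, q, hq, rfl⟩ := H.cover x hx
    by_cases hzt : z < S.rauzy.total
    · obtain ⟨i, hi⟩ := exists_mem_interval ⟨(interval_subset H.len_pos j hz).1, hzt⟩
      refine ⟨i, z, hi, q, ?_, rfl⟩
      rcases col i with ⟨j₁, hc, hc'⟩ | ⟨j₁, j', hc, hc'⟩
      · obtain rfl := interval_unique H.len_pos hz (hc' z hi).1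
        rwa [one i j hc]
      · obtain rfl := interval_unique H.len_pos hz (hc' z hi).1
        rw [two i j j' hc]
        omega
    -- The foot `z` was removed, so it is the image of a surviving `w`. The column of `w` cannot
    -- have a single entry, and the point sits in the upper half of its stack.
    · obtain ⟨w, hw, hwz⟩ := exists_map_eq_of_rauzy_total_le H.len_pos hS'
        ⟨not_lt.1 hzt, (interval_subset H.len_pos j hz).2⟩
      obtain ⟨i, hi⟩ := exists_mem_interval hw
      rcases col i with ⟨j₁, hc, hc'⟩ | ⟨j₁, j', hc, hc'⟩
      · exfalso
        have := (map_mem hS' hw).2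
        rw [(hc' w hi).2, hwz] at this
        exact hzt this
      · obtain ⟨h1, h2, -, -⟩ := hc' w hi
        rw [hwz] at h2
        obtain rfl := interval_unique H.len_pos hz h2
        refine ⟨i, w, hi, q + h j₁, ?_, ?_⟩
        · rw [two i j₁ j hc]
          omega
        · rw [Function.iterate_add_apply, H.map_eq j₁ w h1, hwz]

theorem isTower_iter (hT : ∀ n j, 0 < (T.iter n).len j) (n : ℕ) :
    IsTower T (T.iter n) (T.height n) := by
  induction n with
  | zero =>
    have : T.height 0 = fun _ => 1 := funext T.height_zero
    rw [this]
    exact isTower_zero (hT 0)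
  | succ n ih =>
    rw [iter_succ]
    exact ih.rauzy (by rw [← iter_succ]; exact hT _) (T.height_succ n)

/-- Birkhoff sums along whole towers are composed as prescribed by the cocycle. -/
theorem birkhoffSum_height_eq (hT : ∀ n j, 0 < (T.iter n).len j) {p q : ℕ} (hpq : p ≤ q)
    {g : ℝ → ℝ} {φ : Fin (m + 1) → ℝ}
    (hφ : ∀ j, ∀ z ∈ (T.iter p).interval j, birkhoffSum T.map g (T.height p j) z = φ j) :
    ∀ i, ∀ z ∈ (T.iter q).interval i,
      birkhoffSum T.map g (T.height q i) z = ∑ j, φ j * T.cocycle p q j i := by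
  induction q, hpq using Nat.le_induction with
  | base =>
    intro i z hz
    rw [hφ i z hz, cocycle_self]
    simp [Matrix.one_apply]
  | succ q hpq ih =>
    intro i z hz
    rw [iter_succ] at hz
    have H := isTower_iter hT q
    have hsum : ∑ j, φ j * (T.cocycle p (q + 1) j i : ℝ) =
        ∑ k, (∑ j, φ j * (T.cocycle p q j k : ℝ)) * ((T.iter q).rauzyMatrix k i : ℝ) := by
      simp only [cocycle_succ T hpq, Matrix.mul_apply, Nat.cast_sum, Nat.cast_mul, Finset.sum_mul,
        Finset.mul_sum]
      rw [Finset.sum_comm]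
      exact Finset.sum_congr rfl fun _ _ => Finset.sum_congr rfl fun _ _ => by ring
    rw [hsum, height_succ]
    rcases rauzy_column H.len_pos (by rw [← iter_succ]; exact hT _) i with
      ⟨j, hc, hc'⟩ | ⟨j, j', hc, hc'⟩
    · simp [hc, ih j z (hc' z hz).1]
    · obtain ⟨h1, h2, -, -⟩ := hc' z hz
      simp only [hc, mul_add, Finset.sum_add_distrib, Nat.cast_add, Nat.cast_ite, Nat.cast_one,
        Nat.cast_zero, mul_ite, mul_one, mul_zero, Finset.sum_ite_eq', Finset.mem_univ, if_true]
      rw [birkhoffSum_add, H.map_eq j z h1, ih j z h1, ih j' _ h2]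

end IET

/-! ### From Hilbert diameter to cross ratios -/

section hilbert

variable {m : ℕ}

/-- The segment from a vertex to the barycentre is open-simplex valued away from the vertex.
Vertices matter because their images under `projMap` are the normalized columns. -/
theorem single_mem_closure_openSimplex (j : Fin (m + 1)) :
    (Pi.single j 1 : Fin (m + 1) → ℝ) ∈ closure (openSimplex m) := by
  let γ : ℝ → Fin (m + 1) → ℝ := fun ε => fun i =>
    (1 - ε) * (Pi.single j 1 : Fin (m + 1) → ℝ) i + ε * (1 / (m + 1))
  have hγ : Tendsto γ (𝓝[>] 0) (𝓝 (Pi.single j 1)) := by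
    have hc : Continuous γ := by fun_prop
    have h0 : γ 0 = Pi.single j 1 := by
      ext i
      simp [γ]
    rw [← h0]
    exact hc.continuousAt.continuousWithinAt
  refine mem_closure_of_tendsto hγ ?_
  filter_upwards [Ioo_mem_nhdsGT (zero_lt_one' ℝ)] with ε hε
  refine ⟨fun i => ?_, ?_⟩
  · have h1 : 0 ≤ (Pi.single j 1 : Fin (m + 1) → ℝ) i := by
      by_cases h : i = j
      · subst h; simp
      · simp [h]
    have h2 : 0 < ε * (1 / ((m : ℝ) + 1)) := mul_pos hε.1 (by positivity)
    have h3 : 0 ≤ 1 - ε := by linarith [hε.2]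
    have := mul_nonneg h3 h1
    simp only [γ]
    linarith
  · have : ((m : ℝ) + 1) ≠ 0 := by positivity
    simp only [γ, Finset.sum_add_distrib, ← Finset.mul_sum, Finset.sum_const, Finset.card_univ,
      Fintype.card_fin, nsmul_eq_mul]
    simp
    field_simp
    ring

theorem projMap_single {A : Matrix (Fin (m + 1)) (Fin (m + 1)) ℕ} (i j : Fin (m + 1)) :
    projMap A (Pi.single j 1) i = (∑ k, (A k j : ℝ))⁻¹ * A i j := by
  simp [projMap]

theorem hilbertDist_le_of_projDiam_le {A : Matrix (Fin (m + 1)) (Fin (m + 1)) ℕ} {D : ℝ}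
    (hA : ∀ i j, 0 < A i j) (hD : projDiam A ≤ (D : EReal)) (j l : Fin (m + 1)) :
    hilbertDist (projMap A (Pi.single j 1)) (projMap A (Pi.single l 1)) ≤ D := by
  have hmem : ∀ j, projMap A (Pi.single j 1) ∈ closure (projMap A '' openSimplex m) := by
    intro j
    -- A vertex is only a limit of the open simplex, but positive column sums make `projMap`
    -- continuous there.
    refine ContinuousWithinAt.mem_closure_image (ContinuousAt.continuousWithinAt ?_)
      (single_mem_closure_openSimplex j)
    have hc : Continuous fun v : Fin (m + 1) → ℝ => (A.map (Nat.cast : ℕ → ℝ)).mulVec v :=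
      Continuous.matrix_mulVec continuous_const continuous_id
    have hs : Continuous fun v : Fin (m + 1) → ℝ =>
        ∑ i, (A.map (Nat.cast : ℕ → ℝ)).mulVec v i :=
      continuous_finsetSum _ fun i _ => (continuous_apply i).comp hc
    refine ContinuousAt.smul (hs.continuousAt.inv₀ ?_) hc.continuousAt
    have : 0 < ∑ k, (A k j : ℝ) :=
      Finset.sum_pos (fun k _ => Nat.cast_pos.2 (hA k j)) Finset.univ_nonempty
    simpa using this.ne'
  rw [← EReal.coe_le_coe_iff]
  refine le_trans ?_ hD
  exact (le_iSup₂ (f := fun w (_ : w ∈ closure (projMap A '' openSimplex m)) =>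
      (hilbertDist (projMap A (Pi.single j 1)) w : EReal)) _ (hmem l)).trans
    (le_iSup₂ (f := fun v (_ : v ∈ closure (projMap A '' openSimplex m)) =>
      ⨆ w ∈ closure (projMap A '' openSimplex m), (hilbertDist v w : EReal)) _ (hmem j))

/-- A bound on the projective diameter bounds all cross ratios of entries. -/
theorem mul_le_exp_mul_of_projDiam_le {A : Matrix (Fin (m + 1)) (Fin (m + 1)) ℕ} {D : ℝ}
    (hA : ∀ i j, 0 < A i j) (hD : projDiam A ≤ (D : EReal)) (i k j l : Fin (m + 1)) :
    (A i j : ℝ) * A k l ≤ Real.exp D * (A i l * A k j) := by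
  have h := hilbertDist_le_of_projDiam_le hA hD j l
  set v := projMap A (Pi.single j 1) with hv
  set w := projMap A (Pi.single l 1) with hw
  have hcol : ∀ j, 0 < ∑ k, (A k j : ℝ) := fun j =>
    Finset.sum_pos (fun k _ => Nat.cast_pos.2 (hA k j)) Finset.univ_nonempty
  have hA' : ∀ i j, (0 : ℝ) < A i j := fun i j => Nat.cast_pos.2 (hA i j)
  have hv' : ∀ i, v i = (∑ k, (A k j : ℝ))⁻¹ * A i j := fun i => projMap_single i j
  have hw' : ∀ i, w i = (∑ k, (A k l : ℝ))⁻¹ * A i l := fun i => projMap_single i l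
  have hvp : ∀ i, 0 < v i := fun i => by
    rw [hv']; exact mul_pos (inv_pos.2 (hcol j)) (hA' i j)
  have hwp : ∀ i, 0 < w i := fun i => by
    rw [hw']; exact mul_pos (inv_pos.2 (hcol l)) (hA' i l)
  have hfin : (range fun i => v i / w i).Finite := finite_range _
  have hsup : v i / w i ≤ ⨆ i, v i / w i := le_ciSup hfin.bddAbove i
  have hinf : ⨅ i, v i / w i ≤ v k / w k := ciInf_le hfin.bddBelow k
  have hinfpos : 0 < ⨅ i, v i / w i := by
    obtain ⟨i₀, hi₀⟩ := exists_eq_ciInf_of_finite (f := fun i => v i / w i)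
    rw [← hi₀]
    exact div_pos (hvp _) (hwp _)
  have hsuppos : 0 < ⨆ i, v i / w i := (div_pos (hvp i) (hwp i)).trans_le hsup
  rw [hilbertDist, Real.log_le_iff_le_exp (div_pos hsuppos hinfpos), div_le_iff₀ hinfpos] at h
  have h2 : v i / w i ≤ Real.exp D * (v k / w k) :=
    hsup.trans (h.trans (mul_le_mul_of_nonneg_left hinf (Real.exp_pos _).le))
  rw [hv', hw', hv', hw', mul_div_mul_comm, mul_div_mul_comm, ← mul_assoc, mul_comm (Real.exp D),
    mul_assoc] at h2
  have h3 := le_of_mul_le_mul_left h2 (div_pos (inv_pos.2 (hcol j)) (inv_pos.2 (hcol l)))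
  rw [← mul_div_assoc, div_le_div_iff₀ (hA' _ _) (hA' _ _)] at h3
  linarith

end hilbert

/-! ### Contraction of ratios by positive matrices -/

section contraction

variable {m : ℕ} {A : Matrix (Fin (m + 1)) (Fin (m + 1)) ℝ} {c : ℝ}

theorem mulVec_apply_nonneg (hA : ∀ i j, 0 ≤ A i j) {v : Fin (m + 1) → ℝ} (hv : ∀ j, 0 ≤ v j)
    (i : Fin (m + 1)) : 0 ≤ A.mulVec v i := by
  rw [Matrix.mulVec, dotProduct]
  exact Finset.sum_nonneg fun j _ => mul_nonneg (hA i j) (hv j)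

/-- Both sides are bilinear in `x` and `w`, and the hypothesis compares the coefficients of each `x
j * w l`. -/
theorem mul_mulVec_le_of_crossRatio (hc : ∀ i k j l, c * (A i j * A k l) ≤ A i l * A k j)
    {x w : Fin (m + 1) → ℝ} (hx : ∀ j, 0 ≤ x j) (hw : ∀ j, 0 ≤ w j) (i k : Fin (m + 1)) :
    c * (A.mulVec x i * A.mulVec w k) ≤ A.mulVec x k * A.mulVec w i := by
  simp only [Matrix.mulVec, dotProduct]
  rw [Finset.sum_mul_sum, Finset.sum_mul_sum, Finset.mul_sum]
  refine Finset.sum_le_sum fun j _ => ?_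
  rw [Finset.mul_sum]
  refine Finset.sum_le_sum fun l _ => ?_
  have := mul_le_mul_of_nonneg_right (hc i k j l) (mul_nonneg (hx j) (hw l))
  linarith

/-- A positive matrix whose entries have cross ratios at least `c` contracts the oscillation of
ratios by the factor `1 - c`. -/
theorem mulVec_ratio_contraction (hA : ∀ i j, 0 ≤ A i j) (hc1 : c ≤ 1)
    (hc : ∀ i k j l, c * (A i j * A k l) ≤ A i l * A k j)
    {v w : Fin (m + 1) → ℝ} (hv : ∀ j, 0 ≤ v j) (hw : ∀ j, 0 < w j) {q : ℝ} (hq0 : 0 ≤ q)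
    (hq : ∀ i k, v i * w k ≤ (1 + q) * (v k * w i)) (i k : Fin (m + 1)) :
    A.mulVec v i * A.mulVec w k ≤ (1 + (1 - c) * q) * (A.mulVec v k * A.mulVec w i) := by
  -- Subtracting the largest multiple `μ w` below `v` leaves `0 ≤ x ≤ q μ w`. In `A x`, a proportion
  -- `c` of the product is handled by the cross ratio and only `1 - c` by the bound with `q`.
  obtain ⟨j₀, hj₀⟩ := Finite.exists_min fun j => v j / w j
  set μ := v j₀ / w j₀ with hμ
  have hμ0 : 0 ≤ μ := div_nonneg (hv _) (hw _).le
  let x : Fin (m + 1) → ℝ := fun j => v j - μ * w j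
  have hx : ∀ j, 0 ≤ x j := by
    intro j
    have := (le_div_iff₀ (hw j)).1 (hj₀ j)
    simp only [x]
    linarith
  have hx' : ∀ j, x j ≤ q * μ * w j := by
    intro j
    have h1 := hq j j₀
    have h2 : v j ≤ (1 + q) * μ * w j := by
      rw [hμ, mul_div_assoc', div_mul_eq_mul_div, le_div_iff₀ (hw _)]
      linarith
    simp only [x]
    linarith
  have hvx : v = x + μ • w := by
    ext j
    simp [x]
  have hAv : ∀ i, A.mulVec v i = A.mulVec x i + μ * A.mulVec w i := by
    intro i
    rw [hvx, Matrix.mulVec_add, Matrix.mulVec_smul]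
    rfl
  have hXnn : ∀ i, 0 ≤ A.mulVec x i := mulVec_apply_nonneg hA hx
  have hWnn : ∀ i, 0 ≤ A.mulVec w i := 
    mulVec_apply_nonneg hA fun j => (hw j).le
  have hXW : A.mulVec x i ≤ q * μ * A.mulVec w i := by
    simp only [Matrix.mulVec, dotProduct, Finset.mul_sum]
    refine Finset.sum_le_sum fun j _ => ?_
    have := mul_le_mul_of_nonneg_left (hx' j) (hA i j)
    linarith
  have h1 := mul_mulVec_le_of_crossRatio hc hx (fun j => (hw j).le) i k
  have h2 : (1 - c) * (A.mulVec x i * A.mulVec w k) ≤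
      (1 - c) * (q * μ * A.mulVec w i * A.mulVec w k) :=
    mul_le_mul_of_nonneg_left (mul_le_mul_of_nonneg_right hXW (hWnn k)) (by linarith)
  have h3 : 0 ≤ (1 - c) * q * (A.mulVec x k * A.mulVec w i) :=
    mul_nonneg (mul_nonneg (by linarith) hq0) (mul_nonneg (hXnn k) (hWnn i))
  rw [hAv, hAv]
  linarith

end contraction

/-! ### Asymptotics of the cocycle entries -/

namespace IET

variable {m : ℕ} {T : IET m}

/-- The towers fill the interval: sum the relation between initial and induced lengths over the
rows. -/
theorem total_eq_sum_height (hT : ∀ n j, 0 < (T.iter n).len j) (n : ℕ) :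
    T.total = ∑ j, (T.height n j : ℝ) * (T.iter n).len j := by
  have h : T.total = ∑ i, (T.iter 0).len i := rfl
  rw [h, Finset.sum_congr rfl fun i _ => len_eq_sum_cocycle hT (Nat.zero_le n) i,
    Finset.sum_comm]
  refine Finset.sum_congr rfl fun j _ => ?_
  rw [height, Nat.cast_sum, Finset.sum_mul]

/-- The ratio of the images of two vectors under products of consecutive blocks. -/
theorem IsBalancedSeq.cocycle_ratio {τ ν κ D : ℝ} {n : ℕ → ℕ} {lbar : ℕ}
    (h : T.IsBalancedSeq τ n ν κ D lbar) (s : ℕ) :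
    ∀ (k : ℕ) (v w : Fin (m + 1) → ℝ), (∀ j, 0 ≤ v j) → (∀ j, 0 < w j) → ∀ i i',
      ((T.cocycle (n k) (n (k + (s + 1) * lbar))).map (Nat.cast : ℕ → ℝ)).mulVec v i *
        ((T.cocycle (n k) (n (k + (s + 1) * lbar))).map (Nat.cast : ℕ → ℝ)).mulVec w i' ≤
      (1 + (1 - Real.exp (-D)) ^ s * (Real.exp D - 1)) *
        (((T.cocycle (n k) (n (k + (s + 1) * lbar))).map (Nat.cast : ℕ → ℝ)).mulVec v i' *
        ((T.cocycle (n k) (n (k + (s + 1) * lbar))).map (Nat.cast : ℕ → ℝ)).mulVec w i) := by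
  have hexp : Real.exp (-D) ≤ 1 := Real.exp_le_one_iff.2 (by linarith [h.D_pos])
  have hexp' : 1 ≤ Real.exp D := Real.one_le_exp h.D_pos.le
  have hcross : ∀ k (i i' j l : Fin (m + 1)), Real.exp (-D) *
      ((T.cocycle (n k) (n (k + lbar))).map (Nat.cast : ℕ → ℝ) i j *
        (T.cocycle (n k) (n (k + lbar))).map (Nat.cast : ℕ → ℝ) i' l) ≤
      (T.cocycle (n k) (n (k + lbar))).map (Nat.cast : ℕ → ℝ) i l *
        (T.cocycle (n k) (n (k + lbar))).map (Nat.cast : ℕ → ℝ) i' j := by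
    intro k i i' j l
    have := mul_le_exp_mul_of_projDiam_le (h.positivity k) (h.diam_le k) i i' j l
    rw [Real.exp_neg, inv_mul_le_iff₀ (Real.exp_pos _)]
    simpa only [Matrix.map_apply] using this
  induction s with
  | zero =>
    intro k v w hv hw i i'
    rw [zero_add, one_mul, pow_zero, one_mul, add_sub_cancel]
    have := mul_mulVec_le_of_crossRatio (hcross k) hv (fun j => (hw j).le) i i'
    rwa [Real.exp_neg, inv_mul_le_iff₀ (Real.exp_pos _)] at this
  | succ s ih =>
    intro k v w hv hw i i'
    -- The additional block is split off on the left, where it acts last on the vectors; this is why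
    -- `k` varies in the induction.
    have e : k + (s + 1 + 1) * lbar = k + lbar + (s + 1) * lbar := by ring
    have hmul : (T.cocycle (n k) (n (k + (s + 1 + 1) * lbar))).map (Nat.cast : ℕ → ℝ) =
        (T.cocycle (n k) (n (k + lbar))).map (Nat.cast : ℕ → ℝ) *
        (T.cocycle (n (k + lbar)) (n (k + lbar + (s + 1) * lbar))).map (Nat.cast : ℕ → ℝ) := by
      rw [e, cocycle_mul T (h.strictMono.monotone (Nat.le_add_right k lbar))
        (h.strictMono.monotone (Nat.le_add_right _ _))]
      exact Matrix.map_mul (f := Nat.castRingHom ℝ)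
    rw [hmul, ← Matrix.mulVec_mulVec, ← Matrix.mulVec_mulVec, pow_succ', mul_assoc]
    have hnn : ∀ k (i j : Fin (m + 1)),
        0 ≤ (T.cocycle (n k) (n (k + lbar))).map (Nat.cast : ℕ → ℝ) i j := fun k i j =>
      Nat.cast_nonneg _
    refine mulVec_ratio_contraction (hnn k) hexp (hcross k) (fun j => ?_) (fun j => ?_)
      (mul_nonneg (pow_nonneg (by linarith) _) (by linarith)) (ih (k + lbar) v w hv hw) i i'
    · exact mulVec_apply_nonneg (fun _ _ => Nat.cast_nonneg _) hv j
    · have hrow : ∀ l, 0 < T.cocycle (n (k + lbar)) (n (k + lbar + (s + 1) * lbar)) j l := by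
        have h2 : ∀ s k (j l : Fin (m + 1)), 0 < T.cocycle (n k) (n (k + (s + 1) * lbar)) j l := by
          intro s
          induction s with
          | zero =>
            intro k j l
            simpa using h.positivity k j l
          | succ s ih =>
            intro k j l
            rw [show k + (s + 1 + 1) * lbar = k + lbar + (s + 1) * lbar by ring,
              cocycle_mul T (h.strictMono.monotone (Nat.le_add_right k lbar))
              (h.strictMono.monotone (Nat.le_add_right _ _)), Matrix.mul_apply]
            exact Finset.sum_pos (fun i _ => Nat.mul_pos (h.positivity k j i) (ih _ i l))
              Finset.univ_nonempty
        exact h2 s (k + lbar) j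
      exact Finset.sum_pos (fun l _ => mul_pos (Nat.cast_pos.2 (hrow l)) (hw l))
        Finset.univ_nonempty

/-- Entries of long products are, up to a factor close to one, products of heights and lengths. -/
theorem IsBalancedSeq.cocycle_asymp {τ ν κ D : ℝ} {n : ℕ → ℕ} {lbar : ℕ}
    (h : T.IsBalancedSeq τ n ν κ D lbar) (hT : T.len ∈ openSimplex m) {δ : ℝ} (hδ : 0 < δ) :
    ∃ s : ℕ, ∀ k i j,
      (T.cocycle (n k) (n (k + s * lbar)) j i : ℝ) ≤
        (1 + δ) * (T.height (n (k + s * lbar)) i * (T.iter (n k)).len j) ∧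
      (T.height (n (k + s * lbar)) i * (T.iter (n k)).len j : ℝ) ≤
        (1 + δ) * T.cocycle (n k) (n (k + s * lbar)) j i := by
  have hpos : ∀ k j, 0 < (T.iter k).len j := h.iter_len_pos hT.1
  have hexp : 0 < Real.exp (-D) := Real.exp_pos _
  have hexp1 : Real.exp (-D) ≤ 1 := Real.exp_le_one_iff.2 (by linarith [h.D_pos])
  have hlim : Tendsto (fun s : ℕ => (1 - Real.exp (-D)) ^ s * (Real.exp D - 1)) atTop (𝓝 0) := by
    have := (tendsto_pow_atTop_nhds_zero_of_lt_one (r := 1 - Real.exp (-D)) (by linarith)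
      (by linarith)).mul_const (Real.exp D - 1)
    rwa [zero_mul] at this
  obtain ⟨s, hs⟩ := (hlim.eventually (gt_mem_nhds hδ)).exists
  -- The first block only produces a finite ratio `exp D`; the remaining `s` blocks contract it.
  refine ⟨s + 1, fun k i j => ?_⟩
  have hle : n k ≤ n (k + (s + 1) * lbar) := h.strictMono.monotone (Nat.le_add_right _ _)
  have hone : ∑ j, (T.height (n k) j : ℝ) * (T.iter (n k)).len j = 1 := by
    rw [← total_eq_sum_height hpos]
    exact hT.2
  have hcol : ∀ j, ((T.cocycle (n k) (n (k + (s + 1) * lbar))).map (Nat.cast : ℕ → ℝ)).mulVec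
      (Pi.single i 1) j = T.cocycle (n k) (n (k + (s + 1) * lbar)) j i := by
    intro j
    simp
  have hlen : ∀ j, ((T.cocycle (n k) (n (k + (s + 1) * lbar))).map (Nat.cast : ℕ → ℝ)).mulVec
      (T.iter (n (k + (s + 1) * lbar))).len j = (T.iter (n k)).len j := fun j =>
    (len_eq_sum_cocycle hpos hle j).symm
  have hheight : (T.height (n (k + (s + 1) * lbar)) i : ℝ) =
      ∑ j, (T.height (n k) j : ℝ) * T.cocycle (n k) (n (k + (s + 1) * lbar)) j i := by
    rw [height_eq_sum T hle]
    push_cast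
    rfl
  -- The ratio estimate for a basis vector and the induced lengths says that the column `i` is
  -- nearly proportional to the lengths at level `k`. Averaging with weights `height` then fixes the
  -- factor, since these weights pair to one with the lengths.
  have key : ∀ a b, (T.cocycle (n k) (n (k + (s + 1) * lbar)) a i : ℝ) * (T.iter (n k)).len b ≤
      (1 + δ) * (T.cocycle (n k) (n (k + (s + 1) * lbar)) b i * (T.iter (n k)).len a) := by
    intro a b
    have := h.cocycle_ratio s k (Pi.single i 1) (T.iter (n (k + (s + 1) * lbar))).len
      (fun j => by by_cases hj : j = i <;> simp [hj]) (hpos _) a b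
    simp only [hcol, hlen] at this
    refine this.trans (mul_le_mul_of_nonneg_right (by linarith) ?_)
    exact mul_nonneg (Nat.cast_nonneg _) (hpos _ _).le
  constructor
  · calc (T.cocycle (n k) (n (k + (s + 1) * lbar)) j i : ℝ)
        = ∑ b, (T.height (n k) b : ℝ) *
          (T.cocycle (n k) (n (k + (s + 1) * lbar)) j i * (T.iter (n k)).len b) := by
          rw [Finset.sum_congr rfl fun b _ => show _ =
            (T.cocycle (n k) (n (k + (s + 1) * lbar)) j i : ℝ) *
              ((T.height (n k) b : ℝ) * (T.iter (n k)).len b) by ring,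
            ← Finset.mul_sum, hone, mul_one]
      _ ≤ ∑ b, (T.height (n k) b : ℝ) * ((1 + δ) *
          (T.cocycle (n k) (n (k + (s + 1) * lbar)) b i * (T.iter (n k)).len j)) :=
          Finset.sum_le_sum fun b _ => mul_le_mul_of_nonneg_left (key j b) (Nat.cast_nonneg _)
      _ = _ := by
          rw [hheight, Finset.sum_mul, Finset.mul_sum]
          exact Finset.sum_congr rfl fun b _ => by ring
  · calc (T.height (n (k + (s + 1) * lbar)) i * (T.iter (n k)).len j : ℝ)
        = ∑ b, (T.height (n k) b : ℝ) *
          (T.cocycle (n k) (n (k + (s + 1) * lbar)) b i * (T.iter (n k)).len j) := by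
          rw [hheight, Finset.sum_mul]
          exact Finset.sum_congr rfl fun b _ => by ring
      _ ≤ ∑ b, (T.height (n k) b : ℝ) * ((1 + δ) *
          (T.cocycle (n k) (n (k + (s + 1) * lbar)) j i * (T.iter (n k)).len b)) :=
          Finset.sum_le_sum fun b _ => mul_le_mul_of_nonneg_left (key b j) (Nat.cast_nonneg _)
      _ = (1 + δ) * T.cocycle (n k) (n (k + (s + 1) * lbar)) j i *
          ∑ b, (T.height (n k) b : ℝ) * (T.iter (n k)).len b := by
          rw [Finset.mul_sum]
          exact Finset.sum_congr rfl fun b _ => by ring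
      _ = _ := by rw [hone, mul_one]

end IET

/-! ### Counting visits to tower floors -/

theorem birkhoffSum_nonneg_of_nonneg {α : Type*} {f : α → α} {g : α → ℝ} (hg : ∀ x, 0 ≤ g x)
    (r : ℕ) (x : α) : 0 ≤ birkhoffSum f g r x :=
  Finset.sum_nonneg fun _ _ => hg _

theorem birkhoffSum_mono_nat {α : Type*} {f : α → α} {g : α → ℝ} (hg : ∀ x, 0 ≤ g x)
    {r s : ℕ} (h : r ≤ s) (x : α) : birkhoffSum f g r x ≤ birkhoffSum f g s x :=
  Finset.sum_le_sum_of_subset_of_nonneg (Finset.range_mono h) fun _ _ _ => hg _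

theorem birkhoffSum_iterate_le {α : Type*} {f : α → α} {g : α → ℝ} (hg : ∀ x, 0 ≤ g x)
    (a r : ℕ) (x : α) : birkhoffSum f g r (f^[a] x) ≤ birkhoffSum f g (a + r) x := by
  rw [birkhoffSum_add]
  linarith [birkhoffSum_nonneg_of_nonneg (f := f) hg a x]

namespace IET

variable {m : ℕ} {T S : IET m} {h : Fin (m + 1) → ℕ}

/-- The floor of index `q` of the tower over the `j`-th interval. -/
def towerFloor (T S : IET m) (j : Fin (m + 1)) (q : ℕ) : Set ℝ := T.map^[q] '' S.interval j

/-- The number of visits of the orbit segment of length `r` of `x` to a set. -/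
noncomputable def visits (T : IET m) (F : Set ℝ) (r : ℕ) (x : ℝ) : ℝ :=
  birkhoffSum T.map (F.indicator fun _ => 1) r x

theorem indicator_one_nonneg (F : Set ℝ) (x : ℝ) : 0 ≤ F.indicator (fun _ => (1 : ℝ)) x :=
  indicator_nonneg (fun _ _ => zero_le_one) x

namespace IsTower

theorem base_subset (H : IsTower T S h) (j : Fin (m + 1)) :
    S.interval j ⊆ Ico 0 T.total :=
  (interval_subset H.len_pos j).trans (Ico_subset_Ico_right H.total_le)

theorem left_mem (H : IsTower T S h) (j : Fin (m + 1)) : S.left j ∈ S.interval j :=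
  ⟨le_rfl, by linarith [H.len_pos j]⟩

theorem towerFloor_eq (H : IsTower T S h) {j : Fin (m + 1)} {q : ℕ} (hq : q ≤ h j) :
    towerFloor T S j q =
      Ico (T.map^[q] (S.left j)) (T.map^[q] (S.left j) + S.len j) := by
  ext y
  constructor
  · rintro ⟨z, hz, rfl⟩
    have := H.translate j _ (H.left_mem j) z hz q hq
    constructor <;> linarith [hz.1, hz.2]
  · intro hy
    have hz : S.left j + (y - T.map^[q] (S.left j)) ∈ S.interval j :=
      ⟨by linarith [hy.1], by linarith [hy.2]⟩
    refine ⟨_, hz, ?_⟩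
    linarith [H.translate j _ (H.left_mem j) _ hz q hq]

/-- Cancelling the smaller number of iterates would otherwise give a return to the base strictly
before the top of a tower. -/
theorem iterate_unique (H : IsTower T S h) (hT : ∀ j, 0 < T.len j) {i j : Fin (m + 1)} {q q' : ℕ}
    {z z' : ℝ} (hz : z ∈ S.interval i) (hz' : z' ∈ S.interval j) (hq : q < h i) (hq' : q' < h j)
    (e : T.map^[q] z = T.map^[q'] z') : i = j ∧ q = q' := by
  wlog hle : q ≤ q' generalizing i j q q' z z'
  · have := this hz' hz hq' hq e.symm (le_of_not_ge hle)
    exact ⟨this.1.symm, this.2.symm⟩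
  have e' : z = T.map^[q' - q] z' := by
    apply iterate_map_injOn hT (H.base_subset i hz)
      (iterate_map_mem hT (H.base_subset j hz') _) (k := q)
    rw [← Function.iterate_add_apply, Nat.add_sub_cancel' hle, e]
  have hqq : q = q' := by
    by_contra hne
    have h1 := H.avoid j z' hz' (q' - q) (by omega) (by omega)
    rw [← e'] at h1
    exact absurd (interval_subset H.len_pos i hz).2 (not_lt.2 h1)
  subst hqq
  rw [Nat.sub_self] at e'
  subst e'
  exact ⟨interval_unique H.len_pos hz hz', rfl⟩

/-- A tower floor is visited exactly once along the tower containing it. -/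
theorem visits_towerFloor (H : IsTower T S h) (hT : ∀ j, 0 < T.len j) {j : Fin (m + 1)} {q : ℕ}
    (hq : q < h j) (i : Fin (m + 1)) (z : ℝ) (hz : z ∈ S.interval i) :
    visits T (towerFloor T S j q) (h i) z = if i = j then 1 else 0 := by
  have hmem : ∀ q' < h i, (towerFloor T S j q).indicator (fun _ => (1 : ℝ)) (T.map^[q'] z) =
      if i = j ∧ q' = q then 1 else 0 := by
    classical
    intro q' hq'
    rw [indicator_apply]
    refine if_congr ⟨?_, ?_⟩ rfl rfl
    · rintro ⟨z', hz', e⟩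
      have := H.iterate_unique hT hz' hz hq hq' e
      exact ⟨this.1.symm, this.2.symm⟩
    · rintro ⟨rfl, rfl⟩
      exact ⟨z, hz, rfl⟩
  rw [visits, birkhoffSum, Finset.sum_congr rfl fun q' hq' => hmem q' (Finset.mem_range.1 hq')]
  by_cases hij : i = j
  · subst hij
    simp [hq]
  · simp [hij]

/-- From the base an orbit decomposes into full towers and one incomplete tower, which accounts for
the extra `M`. -/
theorem birkhoffSum_base_le (H : IsTower T S h) {g : ℝ → ℝ} (hg : ∀ x, 0 ≤ g x) {a : ℝ}
    (ha : 0 ≤ a) {M : ℕ} (hM : ∀ j, h j ≤ M)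
    (hgh : ∀ j, ∀ z ∈ S.interval j, birkhoffSum T.map g (h j) z ≤ a * h j) (R : ℕ) :
    ∀ z ∈ Ico 0 S.total, birkhoffSum T.map g R z ≤ a * (R + M) := by
  induction R using Nat.strong_induction_on with
  | _ R ih =>
    intro z hz
    obtain ⟨i, hi⟩ := exists_mem_interval hz
    have hMi : (h i : ℝ) ≤ M := Nat.cast_le.2 (hM i)
    rcases le_total R (h i) with hle | hge
    · calc birkhoffSum T.map g R z ≤ birkhoffSum T.map g (h i) z := birkhoffSum_mono_nat hg hle z
        _ ≤ a * h i := hgh i z hi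
        _ ≤ a * (R + M) := mul_le_mul_of_nonneg_left
          (by linarith [Nat.cast_nonneg (α := ℝ) R]) ha
    · have hpos := H.height_pos i
      have h1 := ih (R - h i) (by omega) (T.map^[h i] z)
        (by rw [H.map_eq i z hi]; exact map_mem H.len_pos hz)
      have h2 := birkhoffSum_add T.map g (h i) (R - h i) z
      rw [Nat.add_sub_cancel' hge] at h2
      rw [Nat.cast_sub hge] at h1
      linarith [hgh i z hi]

/-- The orbit is first extended backwards to the foot of its tower; this costs a second `M`. -/
theorem birkhoffSum_le (H : IsTower T S h) {g : ℝ → ℝ} (hg : ∀ x, 0 ≤ g x) {a : ℝ}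
    (ha : 0 ≤ a) {M : ℕ} (hM : ∀ j, h j ≤ M)
    (hgh : ∀ j, ∀ z ∈ S.interval j, birkhoffSum T.map g (h j) z ≤ a * h j) (r : ℕ)
    {x : ℝ} (hx : x ∈ Ico 0 T.total) : birkhoffSum T.map g r x ≤ a * (r + 2 * M) := by
  obtain ⟨j, z, hz, q, hq, rfl⟩ := H.cover x hx
  have h1 := birkhoffSum_iterate_le (f := T.map) hg q r z
  have h2 := H.birkhoffSum_base_le hg ha hM hgh (q + r) z (interval_subset H.len_pos j hz)
  have h3 : (q : ℝ) ≤ M := Nat.cast_le.2 (hq.le.trans (hM j))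
  push_cast at h2
  have h4 : a * (q + r + M) ≤ a * (r + 2 * M) := mul_le_mul_of_nonneg_left (by linarith) ha
  linarith

theorem le_birkhoffSum_base (H : IsTower T S h) {g : ℝ → ℝ} (hg : ∀ x, 0 ≤ g x) {a : ℝ}
    (ha : 0 ≤ a) {M : ℕ} (hM : ∀ j, h j ≤ M)
    (hgh : ∀ j, ∀ z ∈ S.interval j, a * h j ≤ birkhoffSum T.map g (h j) z) (R : ℕ) :
    ∀ z ∈ Ico 0 S.total, a * (R - M) ≤ birkhoffSum T.map g R z := by
  induction R using Nat.strong_induction_on with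
  | _ R ih =>
    intro z hz
    obtain ⟨i, hi⟩ := exists_mem_interval hz
    have hMi : (h i : ℝ) ≤ M := Nat.cast_le.2 (hM i)
    rcases le_total R (h i) with hle | hge
    · refine le_trans (mul_nonpos_of_nonneg_of_nonpos ha ?_)
        (birkhoffSum_nonneg_of_nonneg hg _ _)
      have : (R : ℝ) ≤ h i := Nat.cast_le.2 hle
      linarith
    · have hpos := H.height_pos i
      have h1 := ih (R - h i) (by omega) (T.map^[h i] z)
        (by rw [H.map_eq i z hi]; exact map_mem H.len_pos hz)
      have h2 := birkhoffSum_add T.map g (h i) (R - h i) z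
      rw [Nat.add_sub_cancel' hge] at h2
      rw [Nat.cast_sub hge] at h1
      linarith [hgh i z hi]

/-- Every orbit reaches the base of the towers at the end of the tower containing the point. -/
theorem exists_return (H : IsTower T S h) {x : ℝ} (hx : x ∈ Ico 0 T.total) :
    ∃ j t, t ≤ h j ∧ T.map^[t] x ∈ Ico 0 S.total ∧
      ∀ s < t, T.map^[s] x ∈ Ico 0 S.total → s = 0 ∧ x ∈ Ico 0 S.total := by
  obtain ⟨j, z, hz, q, hq, rfl⟩ := H.cover x hx
  have hzI := interval_subset H.len_pos j hz
  refine ⟨j, h j - q, Nat.sub_le _ _, ?_, fun s hs hmem => ?_⟩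
  · rw [← Function.iterate_add_apply, Nat.sub_add_cancel hq.le, H.map_eq j z hz]
    exact map_mem H.len_pos hzI
  · rw [← Function.iterate_add_apply] at hmem
    rcases Nat.eq_zero_or_pos (s + q) with h0 | h0
    · obtain rfl : q = 0 := by omega
      exact ⟨by omega, hzI⟩
    · exact absurd hmem.2 (not_lt.2 (H.avoid j z hz (s + q) h0 (by omega)))

/-- The start up to the first return to the base and the incomplete last tower are discarded, each
of length at most `M`. -/
theorem le_birkhoffSum (H : IsTower T S h) {g : ℝ → ℝ} (hg : ∀ x, 0 ≤ g x) {a : ℝ}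
    (ha : 0 ≤ a) {M : ℕ} (hM : ∀ j, h j ≤ M)
    (hgh : ∀ j, ∀ z ∈ S.interval j, a * h j ≤ birkhoffSum T.map g (h j) z) (r : ℕ)
    {x : ℝ} (hx : x ∈ Ico 0 T.total) : a * (r - 2 * M) ≤ birkhoffSum T.map g r x := by
  obtain ⟨j, t, ht, hmem, -⟩ := H.exists_return hx
  have htM : (t : ℝ) ≤ M := Nat.cast_le.2 (ht.trans (hM j))
  rcases le_total r t with hle | hge
  · refine le_trans (mul_nonpos_of_nonneg_of_nonpos ha ?_) (birkhoffSum_nonneg_of_nonneg hg _ _)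
    have : (r : ℝ) ≤ t := Nat.cast_le.2 hle
    linarith [Nat.cast_nonneg (α := ℝ) M]
  · have h1 := birkhoffSum_iterate_le (f := T.map) hg t (r - t) x
    rw [Nat.add_sub_cancel' hge] at h1
    have h2 := H.le_birkhoffSum_base hg ha hM hgh (r - t) _ hmem
    rw [Nat.cast_sub hge] at h2
    have h4 : a * (r - 2 * M) ≤ a * (r - t - M) := mul_le_mul_of_nonneg_left (by linarith) ha
    linarith

/-- Visits to a floor are at most as frequent as allowed by the smallest height. -/
theorem visits_towerFloor_le (H : IsTower T S h) (hT : ∀ j, 0 < T.len j) {M : ℕ}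
    (hM : ∀ j, h j ≤ M) {c : ℝ} (hc : 0 < c) (hch : ∀ j, c ≤ h j) {j : Fin (m + 1)} {q : ℕ}
    (hq : q < h j) (r : ℕ) {x : ℝ} (hx : x ∈ Ico 0 T.total) :
    visits T (towerFloor T S j q) r x ≤ c⁻¹ * (r + 2 * M) := by
  refine H.birkhoffSum_le (indicator_one_nonneg _) (inv_nonneg.2 hc.le) hM (fun i z hz => ?_) r hx
  have := H.visits_towerFloor hT hq i z hz
  rw [visits] at this
  rw [this, inv_mul_eq_div]
  have h1 : 1 ≤ (h i : ℝ) / c := (one_le_div hc).2 (hch i)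
  split_ifs <;> linarith

/-- A full tower meets the base only at its foot and takes at least `c` steps; the final `c` pays
for an incomplete tower. -/
theorem visits_base_add (H : IsTower T S h) {c : ℝ} (hch : ∀ j, c ≤ h j) (hc : 0 < c) (R : ℕ) :
    ∀ z ∈ Ico 0 S.total, c * visits T (Ico 0 S.total) R z ≤ R + c := by
  induction R using Nat.strong_induction_on with
  | _ R ih =>
    intro z hz
    obtain ⟨i, hi⟩ := exists_mem_interval hz
    have hone : ∀ R ≤ h i, visits T (Ico 0 S.total) R z ≤ 1 := by
      intro R hR
      have h0 : visits T (Ico 0 S.total) R z ≤ ∑ k ∈ Finset.range R, 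
          if k = 0 then (1 : ℝ) else 0 := by
        classical
        rw [visits, birkhoffSum]
        refine Finset.sum_le_sum fun k hk => ?_
        rw [indicator_apply]
        have hk' := Finset.mem_range.1 hk
        split_ifs with h1 h2 h2
        · rfl
        · exact absurd h1.2 (not_lt.2 (H.avoid i z hi k (by omega) (by omega)))
        · exact zero_le_one
        · rfl
      refine h0.trans ?_
      rw [Finset.sum_ite_eq']
      split_ifs <;> norm_num
    rcases le_total R (h i) with hle | hge
    · have := mul_le_mul_of_nonneg_left (hone R hle) hc.le
      linarith [Nat.cast_nonneg (α := ℝ) R]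
    · have hpos := H.height_pos i
      have h1 := ih (R - h i) (by omega) (T.map^[h i] z)
        (by rw [H.map_eq i z hi]; exact map_mem H.len_pos hz)
      have h2 := birkhoffSum_add T.map ((Ico 0 S.total).indicator fun _ => (1 : ℝ)) (h i)
        (R - h i) z
      rw [Nat.add_sub_cancel' hge] at h2
      rw [Nat.cast_sub hge] at h1
      have h3 := mul_le_mul_of_nonneg_left (hone _ le_rfl) hc.le
      simp only [visits] at h1 h3 ⊢
      rw [h2, mul_add]
      linarith [hch i]

/-- Visits to the base are spaced by at least the smallest height. -/
theorem visits_base_le (H : IsTower T S h) {c : ℝ} (hch : ∀ j, c ≤ h j) (hc : 0 < c) (r : ℕ)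
    {x : ℝ} (hx : x ∈ Ico 0 T.total) :
    c * visits T (Ico 0 S.total) r x ≤ r + c := by
  by_cases hxb : x ∈ Ico 0 S.total
  · exact H.visits_base_add hch hc r x hxb
  obtain ⟨j, t, ht, hmem, havoid⟩ := H.exists_return hx
  have hzero : ∀ s ≤ t, visits T (Ico 0 S.total) s x = 0 := by
    intro s hs
    rw [visits, birkhoffSum]
    refine Finset.sum_eq_zero fun k hk => indicator_of_notMem (fun hk' => ?_) _
    exact hxb (havoid k ((Finset.mem_range.1 hk).trans_le hs) hk').2
  rcases le_total r t with hle | hge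
  · rw [hzero r hle, mul_zero]
    positivity
  · have h2 := birkhoffSum_add T.map ((Ico 0 S.total).indicator fun _ => (1 : ℝ)) t (r - t) x
    rw [Nat.add_sub_cancel' hge] at h2
    have h3 := H.visits_base_add hch hc (r - t) _ hmem
    have h4 := hzero t le_rfl
    rw [Nat.cast_sub hge] at h3
    simp only [visits] at h3 h4 ⊢
    rw [h2, h4, zero_add]
    linarith [Nat.cast_nonneg (α := ℝ) t]

end IsTower

end IET

/-! ### Reciprocal sums compared with integrals -/

theorem integrableOn_one_div_add {a b : ℝ} (ha : 0 < a) (c : ℝ) :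
    IntegrableOn (fun x : ℝ => 1 / x + c / x ^ 2) (Ico a b) := by
  have hc : ContinuousOn (fun x : ℝ => 1 / x + c / x ^ 2) (Icc a b) := by
    have h0 : ∀ x ∈ Icc a b, x ≠ 0 := fun x hx => (ha.trans_le hx.1).ne'
    exact (continuousOn_const.div continuousOn_id h0).add
      (continuousOn_const.div (continuousOn_id.pow 2) fun x hx => pow_ne_zero 2 (h0 x hx))
  exact (hc.integrableOn_compact isCompact_Icc).mono_set Ico_subset_Icc_self

theorem integral_one_div_add {a b : ℝ} (ha : 0 < a) (hab : a ≤ b) (c : ℝ) :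
    ∫ x in Ico a b, (1 / x + c / x ^ 2) = Real.log (b / a) + c * (1 / a - 1 / b) := by
  have h0 : ∀ x ∈ uIcc a b, x ≠ 0 := fun x hx => by
    rw [uIcc_of_le hab] at hx
    exact (ha.trans_le hx.1).ne'
  rw [integral_Ico_eq_integral_Ioc, ← intervalIntegral.integral_of_le hab,
    intervalIntegral.integral_eq_sub_of_hasDerivAt (f := fun x => Real.log x - c / x)]
  · rw [Real.log_div (ha.trans_le hab).ne' ha.ne']
    ring
  · intro x hx
    have h : HasDerivAt (fun y => c / y) (-(c / x ^ 2)) x := by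
      simpa [div_eq_mul_inv] using (hasDerivAt_inv (h0 x hx)).const_mul c
    exact ((Real.hasDerivAt_log (h0 x hx)).sub h).congr_deriv (by ring)
  · rw [intervalIntegrable_iff_integrableOn_Ico_of_le hab]
    exact integrableOn_one_div_add ha c

namespace IET

variable {m : ℕ} {T S : IET m} {h : Fin (m + 1) → ℕ}

/-- The indices of the tower floors outside the base. -/
def upperFloors (h : Fin (m + 1) → ℕ) : Finset (Σ _ : Fin (m + 1), ℕ) :=
  Finset.univ.sigma fun j => Finset.Ico 1 (h j)

theorem mem_upperFloors {p : Σ _ : Fin (m + 1), ℕ} :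
    p ∈ upperFloors h ↔ 1 ≤ p.2 ∧ p.2 < h p.1 := by
  simp [upperFloors]

theorem total_pos (hT : ∀ j, 0 < T.len j) : 0 < T.total :=
  Finset.sum_pos (fun j _ => hT j) Finset.univ_nonempty

theorem len_le_total (hT : ∀ j, 0 < T.len j) (j : Fin (m + 1)) : T.len j ≤ T.total :=
  Finset.single_le_sum (fun i _ => (hT i).le) (Finset.mem_univ j)

theorem sum_mul_visits (T : IET m) {ι : Type*} (s : Finset ι) (F : ι → Set ℝ) (G : ι → ℝ) (r : ℕ)
    (x : ℝ) : ∑ p ∈ s, G p * visits T (F p) r x =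
      birkhoffSum T.map (fun y => ∑ p ∈ s, G p * (F p).indicator (fun _ => 1) y) r x := by
  simp only [visits, birkhoffSum, Finset.mul_sum]
  exact Finset.sum_comm

namespace IsTower

theorem towerFloor_disjoint (H : IsTower T S h) (hT : ∀ j, 0 < T.len j)
    {s : Set (Σ _ : Fin (m + 1), ℕ)} (hs : ∀ p ∈ s, p.2 < h p.1) :
    s.Pairwise (Function.onFun Disjoint fun p => towerFloor T S p.1 p.2) := by
  intro p hp p' hp' hne
  rw [Function.onFun, Set.disjoint_left]
  rintro _ ⟨z, hz, rfl⟩ ⟨z', hz', e⟩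
  have := H.iterate_unique hT hz hz' (hs p hp) (hs p' hp') e.symm
  exact hne (Sigma.ext this.1 (heq_of_eq this.2))

theorem total_le_of_mem_towerFloor (H : IsTower T S h) {p : Σ _ : Fin (m + 1), ℕ}
    (hp : p ∈ upperFloors h) {y : ℝ} (hy : y ∈ towerFloor T S p.1 p.2) : S.total ≤ y := by
  obtain ⟨z, hz, rfl⟩ := hy
  exact H.avoid p.1 z hz p.2 (mem_upperFloors.1 hp).1 (mem_upperFloors.1 hp).2

theorem lt_total_of_mem_towerFloor (H : IsTower T S h) (hT : ∀ j, 0 < T.len j)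
    {p : Σ _ : Fin (m + 1), ℕ} {y : ℝ} (hy : y ∈ towerFloor T S p.1 p.2) : y < T.total := by
  obtain ⟨z, hz, rfl⟩ := hy
  exact (iterate_map_mem hT (H.base_subset p.1 hz) _).2

theorem exists_upperFloor (H : IsTower T S h) {y : ℝ} (hy : y ∈ Ico S.total T.total) :
    ∃ p ∈ upperFloors h, y ∈ towerFloor T S p.1 p.2 := by
  have hpos := total_pos H.len_pos
  obtain ⟨j, z, hz, q, hq, rfl⟩ := H.cover y ⟨hpos.le.trans hy.1, hy.2⟩
  refine ⟨⟨j, q⟩, mem_upperFloors.2 ⟨?_, hq⟩, z, hz, rfl⟩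
  by_contra hcon
  obtain rfl : q = 0 := by simp only at hcon; omega
  exact absurd (interval_subset H.len_pos j hz).2 (not_lt.2 hy.1)

theorem towerFloor_integral_const (H : IsTower T S h) {p : Σ _ : Fin (m + 1), ℕ}
    (hp : p ∈ upperFloors h) (c : ℝ) :
    ∫ _ in towerFloor T S p.1 p.2, c = S.len p.1 * c := by
  rw [H.towerFloor_eq (mem_upperFloors.1 hp).2.le, setIntegral_const, Real.volume_real_Ico_of_le
    (by linarith [H.len_pos p.1]), smul_eq_mul]
  ring

theorem abs_sub_lt_of_mem_towerFloor (H : IsTower T S h) {p : Σ _ : Fin (m + 1), ℕ}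
    (hp : p ∈ upperFloors h) {x y : ℝ} (hx : x ∈ towerFloor T S p.1 p.2)
    (hy : y ∈ towerFloor T S p.1 p.2) : x < y + S.total := by
  rw [H.towerFloor_eq (mem_upperFloors.1 hp).2.le] at hx hy
  linarith [hx.2, hy.1, len_le_total H.len_pos p.1]

theorem measurableSet_towerFloor (H : IsTower T S h) {p : Σ _ : Fin (m + 1), ℕ}
    (hp : p ∈ upperFloors h) : MeasurableSet (towerFloor T S p.1 p.2) := by
  rw [H.towerFloor_eq (mem_upperFloors.1 hp).2.le]
  exact measurableSet_Ico

theorem integrableOn_towerFloor (H : IsTower T S h) {p : Σ _ : Fin (m + 1), ℕ}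
    (hp : p ∈ upperFloors h) (c : ℝ) :
    IntegrableOn (fun x : ℝ => 1 / x + c / x ^ 2) (towerFloor T S p.1 p.2) := by
  have hmem : T.map^[p.2] (S.left p.1) ∈ towerFloor T S p.1 p.2 := ⟨_, H.left_mem _, rfl⟩
  have := H.total_le_of_mem_towerFloor hp hmem
  rw [H.towerFloor_eq (mem_upperFloors.1 hp).2.le]
  exact integrableOn_one_div_add ((total_pos H.len_pos).trans_le this) c

theorem integrableOn_const_towerFloor (H : IsTower T S h) {p : Σ _ : Fin (m + 1), ℕ}
    (hp : p ∈ upperFloors h) (c : ℝ) :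
    IntegrableOn (fun _ : ℝ => c) (towerFloor T S p.1 p.2) := by
  rw [H.towerFloor_eq (mem_upperFloors.1 hp).2.le]
  exact integrableOn_const measure_Ico_lt_top.ne

/-- An upper bound for the sum of reciprocals of the points of an orbit segment in `[Λ, B)`, where
`Λ` is the length of the base, from upper bounds for the numbers of visits to the floors. -/
theorem birkhoffSum_one_div_le (H : IsTower T S h) (hT : ∀ j, 0 < T.len j) {B K : ℝ}
    (hB : S.total ≤ B) (hK : 0 ≤ K) {r : ℕ} {x : ℝ} (hx : x ∈ Ico 0 T.total)
    (hvis : ∀ j q, q < h j → visits T (towerFloor T S j q) r x ≤ K * S.len j) :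
    birkhoffSum T.map ((Ico S.total B).indicator fun y => 1 / y) r x ≤
      K * (Real.log (B / S.total) + 3) := by
  classical
  have hΛ := total_pos H.len_pos
  set Λ := S.total with hΛdef
  let P := (upperFloors h).filter fun p => T.map^[p.2] (S.left p.1) < B
  have hP : ∀ p ∈ P, p ∈ upperFloors h := fun p hp => (Finset.mem_filter.1 hp).1
  let F : (Σ _ : Fin (m + 1), ℕ) → Set ℝ := fun p => towerFloor T S p.1 p.2
  -- Points `t`, `y` of one upper floor are at least `Λ` and differ by less than `Λ`. The correction
  -- `2Λ/t²` is large enough that then `1/y ≤ g t`, and its integral over `[Λ, ∞)` is only `2`.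
  let g : ℝ → ℝ := fun t => 1 / t + 2 * Λ / t ^ 2
  let G : (Σ _ : Fin (m + 1), ℕ) → ℝ := fun p => (∫ t in F p, g t) / S.len p.1
  have hg0 : ∀ t, Λ ≤ t → 0 ≤ g t := fun t ht => by
    have : 0 < t := hΛ.trans_le ht
    positivity
  have hI0 : ∀ p ∈ P, 0 ≤ ∫ t in F p, g t := fun p hp =>
    setIntegral_nonneg (H.measurableSet_towerFloor (hP p hp)) fun t ht =>
      hg0 t (H.total_le_of_mem_towerFloor (hP p hp) ht)
  have hG0 : ∀ p ∈ P, 0 ≤ G p := fun p hp => div_nonneg (hI0 p hp) (H.len_pos _).le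
  have hpt : ∀ k ∈ Finset.range r, (Ico Λ B).indicator (fun y => 1 / y) (T.map^[k] x) ≤
      ∑ p ∈ P, G p * (F p).indicator (fun _ => 1) (T.map^[k] x) := by
    intro k _
    have hy := iterate_map_mem hT hx k
    set y := T.map^[k] x
    have hterm : ∀ p ∈ P, 0 ≤ G p * (F p).indicator (fun _ => 1) y := fun p hp =>
      mul_nonneg (hG0 p hp) (indicator_one_nonneg _ _)
    by_cases hyB : y ∈ Ico Λ B
    · obtain ⟨p, hp, hyp⟩ := H.exists_upperFloor (y := y) ⟨hyB.1, hy.2⟩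
      have hpP : p ∈ P := by
        refine Finset.mem_filter.2 ⟨hp, ?_⟩
        rw [H.towerFloor_eq (mem_upperFloors.1 hp).2.le] at hyp
        exact hyp.1.trans_lt hyB.2
      refine le_trans ?_ (Finset.single_le_sum hterm hpP)
      rw [indicator_of_mem hyB, indicator_of_mem hyp, mul_one, le_div_iff₀ (H.len_pos _), mul_comm,
        ← H.towerFloor_integral_const hp]
      refine setIntegral_mono_on (H.integrableOn_const_towerFloor hp _)
        (H.integrableOn_towerFloor hp _) (H.measurableSet_towerFloor hp) fun t ht => ?_
      have h1 := H.total_le_of_mem_towerFloor hp ht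
      have h2 := H.abs_sub_lt_of_mem_towerFloor hp ht hyp
      have ht0 : 0 < t := hΛ.trans_le h1
      have hy0 : 0 < y := hΛ.trans_le hyB.1
      have e : g t = (t + 2 * Λ) / t ^ 2 := by simp only [g]; field_simp
      rw [e, div_le_div_iff₀ hy0 (by positivity)]
      have h3 : t < y + Λ := h2
      have hyΛ : Λ ≤ y := hyB.1
      rcases le_total t (2 * Λ) with h4 | h4
      · nlinarith [mul_nonneg (sub_nonneg.2 h4) (by linarith : 0 ≤ Λ + t),
          mul_nonneg (sub_nonneg.2 hyΛ) (by linarith : 0 ≤ t + 2 * Λ)]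
      · nlinarith [mul_nonneg (sub_nonneg.2 h3.le) (by linarith : 0 ≤ t + 2 * Λ)]
    · rw [indicator_of_notMem hyB]
      exact Finset.sum_nonneg hterm
  -- Floors starting below `B` end before `B + Λ`. This overshoot adds at most `1` to the logarithm,
  -- since `Λ ≤ B`.
  have hint : ∑ p ∈ P, ∫ t in F p, g t ≤ Real.log (B / Λ) + 3 := by
    rw [← integral_biUnion_finset P (fun p hp => H.measurableSet_towerFloor (hP p hp))
      (H.towerFloor_disjoint hT fun p hp => (mem_upperFloors.1 (hP p hp)).2)
      (fun p hp => H.integrableOn_towerFloor (hP p hp) _)]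
    have hB0 : 0 < B := hΛ.trans_le hB
    calc ∫ t in ⋃ p ∈ P, F p, g t ≤ ∫ t in Ico Λ (B + Λ), g t := by
          refine setIntegral_mono_set (integrableOn_one_div_add hΛ _) ?_ ?_
          · exact (ae_restrict_iff' measurableSet_Ico).2 (ae_of_all _ fun t ht => hg0 t ht.1)
          · refine Eventually.of_forall fun t ht => ?_
            obtain ⟨p, hp, htp⟩ := mem_iUnion₂.1 ht
            refine ⟨H.total_le_of_mem_towerFloor (hP p hp) htp, ?_⟩
            have h1 : T.map^[p.2] (S.left p.1) ∈ towerFloor T S p.1 p.2 :=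
              ⟨_, H.left_mem _, rfl⟩
            have h2 := H.abs_sub_lt_of_mem_towerFloor (hP p hp) htp h1
            have h3 := (Finset.mem_filter.1 hp).2
            linarith
      _ = Real.log ((B + Λ) / Λ) + 2 * Λ * (1 / Λ - 1 / (B + Λ)) :=
          integral_one_div_add hΛ (by linarith) _
      _ ≤ Real.log (B / Λ) + 3 := by
          have e1 : (B + Λ) / Λ = B / Λ * (1 + Λ / B) := by field_simp
          have h1 : Real.log (1 + Λ / B) ≤ 1 := by
            have := Real.log_le_sub_one_of_pos (x := 1 + Λ / B) (by positivity)
            have h2 : Λ / B ≤ 1 := (div_le_one hB0).2 hB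
            linarith
          have h2 : 2 * Λ * (1 / Λ - 1 / (B + Λ)) ≤ 2 := by
            have e2 : 2 * Λ * (1 / Λ - 1 / (B + Λ)) = 2 - 2 * Λ / (B + Λ) := by field_simp
            have : 0 ≤ 2 * Λ / (B + Λ) := by positivity
            linarith
          rw [e1, Real.log_mul (by positivity) (by positivity)]
          linarith
  calc birkhoffSum T.map ((Ico Λ B).indicator fun y => 1 / y) r x
      ≤ birkhoffSum T.map (fun y => ∑ p ∈ P, G p * (F p).indicator (fun _ => 1) y) r x :=
        Finset.sum_le_sum hpt
    _ = ∑ p ∈ P, G p * visits T (F p) r x := (sum_mul_visits T P F G r x).symm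
    _ ≤ ∑ p ∈ P, K * ∫ t in F p, g t := by
        refine Finset.sum_le_sum fun p hp => ?_
        have h1 := mul_le_mul_of_nonneg_left (hvis p.1 p.2 (mem_upperFloors.1 (hP p hp)).2)
          (hG0 p hp)
        refine h1.trans_eq ?_
        have := (H.len_pos p.1).ne'
        simp only [G]
        field_simp
    _ = K * ∑ p ∈ P, ∫ t in F p, g t := (Finset.mul_sum _ _ _).symm
    _ ≤ _ := mul_le_mul_of_nonneg_left hint hK

/-- A lower bound for the sum of reciprocals of the points of an orbit segment outside the base,
from lower bounds for the numbers of visits to the floors. -/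
theorem le_birkhoffSum_one_div (H : IsTower T S h) (hT : ∀ j, 0 < T.len j) {K : ℝ}
    (hK : 0 ≤ K) {r : ℕ} {x : ℝ}
    (hvis : ∀ j q, q < h j → K * S.len j ≤ visits T (towerFloor T S j q) r x) :
    K * (Real.log (T.total / S.total) - 1) ≤
      birkhoffSum T.map ((Ici S.total).indicator fun y => 1 / y) r x := by
  classical
  have hΛ := total_pos H.len_pos
  set Λ := S.total with hΛdef
  let P := upperFloors h
  let F : (Σ _ : Fin (m + 1), ℕ) → Set ℝ := fun p => towerFloor T S p.1 p.2
  -- For `y < t + Λ` one has `g t ≤ 1/y`, because `(t - Λ)(t + Λ) ≤ t²`; `g` stays nonnegative for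
  -- `t ≥ Λ`.
  let g : ℝ → ℝ := fun t => 1 / t + (-Λ) / t ^ 2
  let G : (Σ _ : Fin (m + 1), ℕ) → ℝ := fun p => (∫ t in F p, g t) / S.len p.1
  have hg0 : ∀ t, Λ ≤ t → 0 ≤ g t := fun t ht => by
    have h0 : 0 < t := hΛ.trans_le ht
    have e : g t = (t - Λ) / t ^ 2 := by simp only [g]; field_simp; ring
    rw [e]
    exact div_nonneg (sub_nonneg.2 ht) (sq_nonneg t)
  have hI0 : ∀ p ∈ P, 0 ≤ ∫ t in F p, g t := fun p hp =>
    setIntegral_nonneg (H.measurableSet_towerFloor hp) fun t ht =>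
      hg0 t (H.total_le_of_mem_towerFloor hp ht)
  have hG0 : ∀ p ∈ P, 0 ≤ G p := fun p hp => div_nonneg (hI0 p hp) (H.len_pos _).le
  have hpt : ∀ k ∈ Finset.range r, ∑ p ∈ P, G p * (F p).indicator (fun _ => 1) (T.map^[k] x) ≤
      (Ici Λ).indicator (fun y => 1 / y) (T.map^[k] x) := by
    intro k _
    set y := T.map^[k] x
    by_cases hyF : ∃ p ∈ P, y ∈ F p
    · obtain ⟨p, hp, hyp⟩ := hyF
      have hyΛ := H.total_le_of_mem_towerFloor hp hyp
      have hsum : ∑ p ∈ P, G p * (F p).indicator (fun _ => 1) y = G p := by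
        rw [Finset.sum_eq_single_of_mem p hp, indicator_of_mem hyp, mul_one]
        intro p' hp' hne
        have hdis := H.towerFloor_disjoint hT (s := (P : Set (Σ _ : Fin (m + 1), ℕ)))
          (fun p hp => (mem_upperFloors.1 hp).2) hp' hp hne
        rw [indicator_of_notMem (fun hy' => (Set.disjoint_left.1 hdis) hy' hyp), mul_zero]
      rw [hsum, indicator_of_mem (show y ∈ Ici Λ from hyΛ), div_le_iff₀ (H.len_pos _), mul_comm,
        ← H.towerFloor_integral_const hp]
      refine setIntegral_mono_on (H.integrableOn_towerFloor hp _)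
        (H.integrableOn_const_towerFloor hp _) (H.measurableSet_towerFloor hp) fun t ht => ?_
      have h1 := H.total_le_of_mem_towerFloor hp ht
      have h2 := H.abs_sub_lt_of_mem_towerFloor hp hyp ht
      have ht0 : 0 < t := hΛ.trans_le h1
      have hy0 : 0 < y := hΛ.trans_le hyΛ
      have e : g t = (t - Λ) / t ^ 2 := by simp only [g]; field_simp; ring
      rw [e, div_le_div_iff₀ (by positivity) hy0]
      have h3 : y < t + Λ := h2
      nlinarith [mul_nonneg (sub_nonneg.2 (show Λ ≤ t from h1)) (sub_nonneg.2 h3.le),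
        sq_nonneg Λ]
    · rw [Finset.sum_eq_zero fun p hp => by
        rw [indicator_of_notMem (fun hy => hyF ⟨p, hp, hy⟩), mul_zero]]
      exact indicator_nonneg (fun y hy => by
        have : 0 < y := hΛ.trans_le hy
        positivity) _
  have hint : Real.log (T.total / Λ) - 1 ≤ ∑ p ∈ P, ∫ t in F p, g t := by
    rw [← integral_biUnion_finset P (fun p hp => H.measurableSet_towerFloor hp)
      (H.towerFloor_disjoint hT fun p hp => (mem_upperFloors.1 hp).2)
      (fun p hp => H.integrableOn_towerFloor hp _)]
    have hset : ⋃ p ∈ P, F p = Ico Λ T.total := by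
      ext t
      constructor
      · intro ht
        obtain ⟨p, hp, htp⟩ := mem_iUnion₂.1 ht
        exact ⟨H.total_le_of_mem_towerFloor hp htp, H.lt_total_of_mem_towerFloor hT htp⟩
      · intro ht
        obtain ⟨p, hp, htp⟩ := H.exists_upperFloor ht
        exact mem_iUnion₂.2 ⟨p, hp, htp⟩
    rw [hset, integral_one_div_add hΛ H.total_le]
    have hT0 := total_pos hT
    have e2 : -Λ * (1 / Λ - 1 / T.total) = -1 + Λ / T.total := by
      field_simp
      ring
    have : 0 ≤ Λ / T.total := by positivity
    linarith
  calc K * (Real.log (T.total / Λ) - 1) ≤ K * ∑ p ∈ P, ∫ t in F p, g t :=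
        mul_le_mul_of_nonneg_left hint hK
    _ = ∑ p ∈ P, K * ∫ t in F p, g t := Finset.mul_sum _ _ _
    _ ≤ ∑ p ∈ P, G p * visits T (F p) r x := by
        refine Finset.sum_le_sum fun p hp => ?_
        have h1 := mul_le_mul_of_nonneg_left (hvis p.1 p.2 (mem_upperFloors.1 hp).2)
          (hG0 p hp)
        refine le_trans (le_of_eq ?_) h1
        have := (H.len_pos p.1).ne'
        simp only [G]
        field_simp
    _ = birkhoffSum T.map (fun y => ∑ p ∈ P, G p * (F p).indicator (fun _ => 1) y) r x :=
        sum_mul_visits T P F G r x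
    _ ≤ _ := Finset.sum_le_sum hpt

end IsTower

end IET

/-! ### Growth of heights and equidistribution along a balanced sequence -/

namespace IET

variable {m : ℕ} {T : IET m}

theorem height_le_maxHeight (T : IET m) (k : ℕ) (j : Fin (m + 1)) :
    T.height k j ≤ T.maxHeight k := Finset.le_sup (Finset.mem_univ j)

theorem exists_height_eq_maxHeight (T : IET m) (k : ℕ) : ∃ j, T.height k j = T.maxHeight k := by
  obtain ⟨j, -, hj⟩ := Finset.exists_mem_eq_sup Finset.univ Finset.univ_nonempty (T.height k)
  exact ⟨j, hj.symm⟩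

theorem totalLen_eq_total (T : IET m) (k : ℕ) : T.totalLen k = (T.iter k).total := rfl

theorem totalLen_anti (hT : ∀ n j, 0 < (T.iter n).len j) {p q : ℕ} (h : p ≤ q) :
    T.totalLen q ≤ T.totalLen p := by
  induction q, h using Nat.le_induction with
  | base => rfl
  | succ q _ ih =>
    refine le_trans ?_ ih
    rw [totalLen_eq_total, totalLen_eq_total, iter_succ]
    exact rauzy_total_le (hT q)

/-- A zero row would make the corresponding length vanish. -/
theorem exists_cocycle_pos (hT : ∀ n j, 0 < (T.iter n).len j) {p q : ℕ} (h : p ≤ q)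
    (i : Fin (m + 1)) : ∃ j, 0 < T.cocycle p q i j := by
  by_contra! hcon
  have h1 := len_eq_sum_cocycle hT h i
  rw [Finset.sum_eq_zero fun j _ => by rw [Nat.le_zero.1 (hcon j), Nat.cast_zero, zero_mul]] at h1
  exact (hT p i).ne' h1

theorem maxHeight_mono (hT : ∀ n j, 0 < (T.iter n).len j) {p q : ℕ} (h : p ≤ q) :
    T.maxHeight p ≤ T.maxHeight q := by
  obtain ⟨j, hj⟩ := T.exists_height_eq_maxHeight p
  obtain ⟨i, hi⟩ := exists_cocycle_pos hT h j
  refine le_trans ?_ (T.height_le_maxHeight q i)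
  rw [height_eq_sum T h, ← hj]
  exact (Nat.le_mul_of_pos_right _ hi).trans
    (Finset.single_le_sum (f := fun j => T.height p j * T.cocycle p q j i)
      (fun _ _ => Nat.zero_le _) (Finset.mem_univ j))

theorem maxHeight_le_entrySum_mul (T : IET m) {p q : ℕ} (h : p ≤ q) :
    T.maxHeight q ≤ entrySum (T.cocycle p q) * T.maxHeight p := by
  refine Finset.sup_le fun i _ => ?_
  rw [height_eq_sum T h, entrySum, Finset.sum_mul]
  refine Finset.sum_le_sum fun j _ => ?_
  rw [mul_comm]
  exact Nat.mul_le_mul (Finset.single_le_sum (f := fun i => T.cocycle p q j i)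
    (fun _ _ => Nat.zero_le _) (Finset.mem_univ i)) (T.height_le_maxHeight p j)

theorem totalLen_le_entrySum_mul (hT : ∀ n j, 0 < (T.iter n).len j) {p q : ℕ} (h : p ≤ q) :
    T.totalLen p ≤ entrySum (T.cocycle p q) * T.totalLen q := by
  rw [totalLen, Finset.sum_congr rfl fun i _ => len_eq_sum_cocycle hT h i, entrySum]
  push_cast
  rw [Finset.sum_mul]
  refine Finset.sum_le_sum fun i _ => ?_
  rw [Finset.sum_mul]
  exact Finset.sum_le_sum fun j _ =>
    mul_le_mul_of_nonneg_left (len_le_total (hT q) j) (Nat.cast_nonneg _)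

theorem succ_le_entrySum (hT : ∀ n j, 0 < (T.iter n).len j) {p q : ℕ} (h : p ≤ q) :
    m + 1 ≤ entrySum (T.cocycle p q) := by
  have h1 : ∑ _i : Fin (m + 1), 1 ≤ entrySum (T.cocycle p q) := by
    refine Finset.sum_le_sum fun i _ => ?_
    obtain ⟨j, hj⟩ := exists_cocycle_pos hT h i
    exact le_trans hj (Finset.single_le_sum (f := fun j => T.cocycle p q i j)
      (fun _ _ => Nat.zero_le _) (Finset.mem_univ j))
  simpa using h1

theorem one_le_maxHeight_mul_totalLen (hT : ∀ n j, 0 < (T.iter n).len j) (h1 : T.total = 1)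
    (k : ℕ) : 1 ≤ T.maxHeight k * T.totalLen k := by
  rw [← h1, total_eq_sum_height hT k, totalLen, Finset.mul_sum]
  exact Finset.sum_le_sum fun j _ => mul_le_mul_of_nonneg_right
    (Nat.cast_le.2 (T.height_le_maxHeight k j)) (hT k j).le

theorem one_le_maxHeight (hT : ∀ n j, 0 < (T.iter n).len j) (k : ℕ) : 1 ≤ T.maxHeight k :=
  ((isTower_iter hT k).height_pos 0).trans_le (T.height_le_maxHeight k 0)

namespace IsBalancedSeq

variable {τ ν κ D : ℝ} {n : ℕ → ℕ} {lbar : ℕ}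

theorem maxHeight_le (h : T.IsBalancedSeq τ n ν κ D lbar) (hT : ∀ j, 0 < T.len j) (l : ℕ)
    (j : Fin (m + 1)) : (T.maxHeight (n l) : ℝ) ≤ κ * T.height (n l) j := by
  obtain ⟨i, hi⟩ := T.exists_height_eq_maxHeight (n l)
  have h1 := (h.height_balance l i j).2
  rw [div_le_iff₀ (Nat.cast_pos.2 ((isTower_iter (h.iter_len_pos hT) _).height_pos j)), hi] at h1
  exact h1

theorem totalLen_le (h : T.IsBalancedSeq τ n ν κ D lbar) (hT : ∀ j, 0 < T.len j) (l : ℕ)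
    (j : Fin (m + 1)) : T.totalLen (n l) ≤ (m + 1) * ν * (T.iter (n l)).len j := by
  have h1 : T.totalLen (n l) ≤ ∑ _i : Fin (m + 1), ν * (T.iter (n l)).len j :=
    Finset.sum_le_sum fun i _ =>
      (div_le_iff₀ (h.iter_len_pos hT _ j)).1 (h.len_balance l i j).2
  refine h1.trans_eq ?_
  simp
  ring

/-- The towers have total area one, and each is at least `1/κ` times as high as the highest. -/
theorem maxHeight_mul_totalLen_le (h : T.IsBalancedSeq τ n ν κ D lbar) (hT : T.len ∈ openSimplex m)
    (l : ℕ) : T.maxHeight (n l) * T.totalLen (n l) ≤ κ := by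
  have hpos := h.iter_len_pos hT.1
  have h1 : T.total = 1 := hT.2
  calc T.maxHeight (n l) * T.totalLen (n l)
      = ∑ j, (T.maxHeight (n l) : ℝ) * (T.iter (n l)).len j := Finset.mul_sum _ _ _
    _ ≤ ∑ j, κ * (T.height (n l) j * (T.iter (n l)).len j) := by
        refine Finset.sum_le_sum fun j _ => ?_
        rw [← mul_assoc]
        exact mul_le_mul_of_nonneg_right (h.maxHeight_le hT.1 l j) (hpos _ j).le
    _ = κ := by rw [← Finset.mul_sum, ← total_eq_sum_height hpos, h1, mul_one]

/-- Heights at least double along each positive block. -/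
theorem two_pow_mul_le (h : T.IsBalancedSeq τ n ν κ D lbar) (hT : ∀ j, 0 < T.len j) (hm : 1 ≤ m)
    (l s : ℕ) : ∀ j, 2 ^ s * (T.maxHeight (n l) : ℝ) ≤ κ * T.height (n (l + s * lbar)) j := by
  induction s with
  | zero =>
    intro j
    simpa using h.maxHeight_le hT l j
  | succ s ih =>
    intro j
    have e : l + (s + 1) * lbar = l + s * lbar + lbar := by ring
    have hκ : 0 < κ := zero_lt_one.trans h.one_lt_kappa
    have h1 : ∑ i, T.height (n (l + s * lbar)) i ≤ T.height (n (l + (s + 1) * lbar)) j := by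
      rw [e, height_eq_sum T (h.strictMono.monotone (Nat.le_add_right (l + s * lbar) lbar))]
      exact Finset.sum_le_sum fun i _ => Nat.le_mul_of_pos_right _ (h.positivity _ i j)
    have h2 : (m + 1) * (2 ^ s * (T.maxHeight (n l) : ℝ)) ≤
        κ * ∑ i, (T.height (n (l + s * lbar)) i : ℝ) := by
      rw [Finset.mul_sum]
      refine le_trans (le_of_eq ?_) (Finset.sum_le_sum fun i _ => ih i)
      simp
    have h3 : (∑ i, (T.height (n (l + s * lbar)) i : ℝ)) ≤ T.height (n (l + (s + 1) * lbar)) j :=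
      by exact_mod_cast h1
    have h4 := mul_le_mul_of_nonneg_left h3 hκ.le
    have h5 : (2 : ℝ) ≤ m + 1 := by exact_mod_cast Nat.succ_le_succ hm
    have h6 := mul_le_mul_of_nonneg_right h5
      (by positivity : 0 ≤ 2 ^ s * (T.maxHeight (n l) : ℝ))
    rw [pow_succ]
    linarith

/-- An empty block is the identity, which has a zero off the diagonal when there are at least two
intervals. -/
theorem lbar_pos (h : T.IsBalancedSeq τ n ν κ D lbar) (hm : 1 ≤ m) : 0 < lbar := by
  rcases Nat.eq_zero_or_pos lbar with h0 | h0
  · have h1 := h.positivity 0 (0 : Fin (m + 1)) (Fin.last m)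
    have hne : (0 : Fin (m + 1)) ≠ Fin.last m := by
      rw [Ne, Fin.ext_iff]
      simp only [Fin.val_zero, Fin.val_last]
      omega
    rw [h0, add_zero, cocycle_self, Matrix.one_apply, if_neg hne] at h1
    exact absurd h1 (lt_irrefl _)
  · exact h0

/-- Heights double over every `lbar` levels, so their logarithm grows at least linearly; the
constant `C` absorbs `κ` and the incomplete last block. -/
theorem log_maxHeight_growth (h : T.IsBalancedSeq τ n ν κ D lbar) (hT : ∀ j, 0 < T.len j)
    (hm : 1 ≤ m) : ∃ c C : ℝ, 0 < c ∧ ∀ l : ℕ, c * l - C ≤ Real.log (T.maxHeight (n l)) := by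
  have hpos := h.iter_len_pos hT
  have hl := h.lbar_pos hm
  have hl' : (0 : ℝ) < lbar := Nat.cast_pos.2 hl
  have hlog2 : 0 < Real.log 2 := Real.log_pos one_lt_two
  have hκ : 0 < κ := zero_lt_one.trans h.one_lt_kappa
  refine ⟨Real.log 2 / lbar, Real.log 2 + Real.log κ, by positivity, fun l => ?_⟩
  have h1 := h.two_pow_mul_le hT hm (l % lbar) (l / lbar) 0
  rw [Nat.mod_add_div' l lbar] at h1
  have h2 : (1 : ℝ) ≤ T.maxHeight (n (l % lbar)) := by exact_mod_cast one_le_maxHeight hpos _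
  have h3 : (T.height (n l) 0 : ℝ) ≤ T.maxHeight (n l) :=
    Nat.cast_le.2 (T.height_le_maxHeight _ _)
  have h4 : (2 : ℝ) ^ (l / lbar) ≤ κ * T.maxHeight (n l) := by
    calc (2 : ℝ) ^ (l / lbar) ≤ 2 ^ (l / lbar) * T.maxHeight (n (l % lbar)) :=
          le_mul_of_one_le_right (by positivity) h2
      _ ≤ κ * T.height (n l) 0 := h1
      _ ≤ _ := mul_le_mul_of_nonneg_left h3 hκ.le
  have hH : (0 : ℝ) < T.maxHeight (n l) := Nat.cast_pos.2 (one_le_maxHeight hpos _)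
  have h5 := Real.log_le_log (by positivity) h4
  rw [Real.log_pow, Real.log_mul hκ.ne' hH.ne'] at h5
  have h6 : (l : ℝ) / lbar ≤ (l / lbar : ℕ) + 1 := by
    rw [div_le_iff₀ hl']
    have := (Nat.lt_mul_div_succ l hl).le
    have h7 : (l : ℝ) ≤ lbar * ((l / lbar : ℕ) + 1) := by exact_mod_cast this
    linarith
  have h7 := mul_le_mul_of_nonneg_left h6 hlog2.le
  have h8 : Real.log 2 / lbar * l = Real.log 2 * (l / lbar) := by ring
  linarith

theorem tendsto_log_maxHeight (h : T.IsBalancedSeq τ n ν κ D lbar) (hT : ∀ j, 0 < T.len j)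
    (hm : 1 ≤ m) : Tendsto (fun l => Real.log (T.maxHeight (n l))) atTop atTop := by
  obtain ⟨c, C, hc, hb⟩ := h.log_maxHeight_growth hT hm
  refine tendsto_atTop_mono hb ?_
  exact tendsto_atTop_add_const_right _ _ (tendsto_natCast_atTop_atTop.const_mul_atTop hc)

theorem two_le_entrySum (h : T.IsBalancedSeq τ n ν κ D lbar) (hT : ∀ j, 0 < T.len j)
    (hm : 1 ≤ m) (l : ℕ) : 2 ≤ entrySum (T.cocycle (n l) (n (l + 1))) :=
  (Nat.succ_le_succ hm).trans
    (succ_le_entrySum (h.iter_len_pos hT) (h.strictMono.monotone l.le_succ))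

/-- The logarithm of the norms of the cocycle is negligible with respect to that of the heights. -/
theorem tendsto_log_entrySum_div (h : T.IsBalancedSeq τ n ν κ D lbar) (hT : ∀ j, 0 < T.len j)
    (hm : 1 ≤ m) (hτ : τ < 2) :
    Tendsto (fun l => Real.log (entrySum (T.cocycle (n l) (n (l + 1)))) /
      Real.log (T.maxHeight (n l))) atTop (𝓝 0) := by
  obtain ⟨c, C, hc, hb⟩ := h.log_maxHeight_growth hT hm
  have hlim : Tendsto (fun l : ℕ => 2 * Real.log l / (c * l - C)) atTop (𝓝 0) := by
    have h1 : Tendsto (fun x : ℝ => Real.log x / x) atTop (𝓝 0) :=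
      Real.isLittleO_log_id_atTop.tendsto_div_nhds_zero
    have h2 : Tendsto (fun x : ℝ => C / x) atTop (𝓝 0) := tendsto_const_nhds.div_atTop tendsto_id
    have h3 : Tendsto (fun x : ℝ => 2 * (Real.log x / x) / (c - C / x)) atTop
        (𝓝 (2 * 0 / (c - 0))) :=
      (h1.const_mul 2).div (tendsto_const_nhds.sub h2) (by simpa using hc.ne')
    rw [mul_zero, zero_div] at h3
    refine (h3.comp tendsto_natCast_atTop_atTop).congr' ?_
    filter_upwards [eventually_gt_atTop 0] with l hl
    have hl' : (l : ℝ) ≠ 0 := by exact_mod_cast hl.ne'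
    simp only [Function.comp]
    rw [show c - C / (l : ℝ) = (c * l - C) / l by field_simp, mul_div_assoc',
      div_div_div_cancel_right₀ hl']
  have hev : ∀ᶠ l : ℕ in atTop, (0 : ℝ) < c * l - C := by
    have : Tendsto (fun l : ℕ => c * (l : ℝ) - C) atTop atTop :=
      tendsto_atTop_add_const_right _ _ (tendsto_natCast_atTop_atTop.const_mul_atTop hc)
    exact this.eventually_gt_atTop 0
  refine tendsto_of_tendsto_of_tendsto_of_le_of_le' tendsto_const_nhds hlim ?_ ?_
  · filter_upwards [hev] with l hl
    exact div_nonneg (Real.log_natCast_nonneg _) (hl.le.trans (hb l))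
  · filter_upwards [hev, h.integrability.eventually (gt_mem_nhds zero_lt_one),
      eventually_ge_atTop 1] with l hl hN hl1
    have hl1' : (1 : ℝ) ≤ l := by exact_mod_cast hl1
    have hl0 : (0 : ℝ) < l := by linarith
    rw [div_lt_one (Real.rpow_pos_of_pos hl0 _)] at hN
    -- Any polynomial bound would do: it makes the logarithm of the norm `O(log l)`, against a
    -- linear denominator.
    have h2 : (entrySum (T.cocycle (n l) (n (l + 1))) : ℝ) ≤ (l : ℝ) ^ 2 := by
      refine hN.le.trans ?_
      rw [← Real.rpow_two]
      exact Real.rpow_le_rpow_of_exponent_le hl1' hτ.le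
    have h3 : (0 : ℝ) < entrySum (T.cocycle (n l) (n (l + 1))) := by
      exact_mod_cast (h.two_le_entrySum hT hm l).trans_lt' two_pos
    have h4 := Real.log_le_log h3 h2
    rw [Real.log_pow] at h4
    exact div_le_div₀ (by have := Real.log_nonneg hl1'; positivity) (by exact_mod_cast h4) hl (hb l)

/-- One level multiplies the maximal height by at most the norm of the cocycle, whose logarithm is
negligible. Hence a fixed number of levels does not change log-heights asymptotically. -/
theorem tendsto_log_maxHeight_ratio (h : T.IsBalancedSeq τ n ν κ D lbar) (hT : ∀ j, 0 < T.len j)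
    (hm : 1 ≤ m) (hτ : τ < 2) (j : ℕ) :
    Tendsto (fun l => Real.log (T.maxHeight (n (l + j))) / Real.log (T.maxHeight (n l)))
      atTop (𝓝 1) := by
  have hpos := h.iter_len_pos hT
  have hlogpos := (h.tendsto_log_maxHeight hT hm).eventually_gt_atTop 0
  have hone : Tendsto (fun l => Real.log (T.maxHeight (n (l + 1))) /
      Real.log (T.maxHeight (n l))) atTop (𝓝 1) := by
    have hlim := (h.tendsto_log_entrySum_div hT hm hτ).const_add 1
    rw [add_zero] at hlim
    refine tendsto_of_tendsto_of_tendsto_of_le_of_le' tendsto_const_nhds hlim ?_ ?_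
    · filter_upwards [hlogpos] with l hl
      rw [le_div_iff₀ hl, one_mul]
      exact Real.log_le_log (Nat.cast_pos.2 (one_le_maxHeight hpos _))
        (Nat.cast_le.2 (maxHeight_mono hpos (h.strictMono.monotone l.le_succ)))
    · filter_upwards [hlogpos] with l hl
      rw [div_le_iff₀ hl, add_mul, one_mul, div_mul_cancel₀ _ hl.ne']
      have h1 := T.maxHeight_le_entrySum_mul (h.strictMono.monotone l.le_succ)
      have h2 : (T.maxHeight (n (l + 1)) : ℝ) ≤
          entrySum (T.cocycle (n l) (n (l + 1))) * T.maxHeight (n l) := by exact_mod_cast h1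
      have h3 : (entrySum (T.cocycle (n l) (n (l + 1))) : ℝ) ≠ 0 := by
        exact_mod_cast (h.two_le_entrySum hT hm l).trans_lt' two_pos |>.ne'
      have h4 : (T.maxHeight (n l) : ℝ) ≠ 0 := by
        exact_mod_cast Nat.one_le_iff_ne_zero.1 (one_le_maxHeight hpos _)
      have h5 := Real.log_le_log (Nat.cast_pos.2 (one_le_maxHeight hpos _)) h2
      rw [Real.log_mul h3 h4] at h5
      linarith
  induction j with
  | zero =>
    refine tendsto_const_nhds.congr' ?_
    filter_upwards [hlogpos] with l hl
    rw [add_zero, div_self hl.ne']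
  | succ j ih =>
    have h1 := (hone.comp (tendsto_add_atTop_nat j)).mul ih
    rw [mul_one] at h1
    refine h1.congr' ?_
    filter_upwards [(tendsto_add_atTop_nat j).eventually hlogpos] with l hl
    simp only [Function.comp]
    rw [div_mul_div_cancel₀ hl.ne', add_assoc]

/-- Equidistribution of orbits among the floors of a lower level. -/
theorem visits_asymp (h : T.IsBalancedSeq τ n ν κ D lbar) (hT : T.len ∈ openSimplex m)
    (hm : 1 ≤ m) {δ : ℝ} (hδ : 0 < δ) :
    ∃ L : ℕ, ∀ k r : ℕ, T.maxHeight (n (k + L)) ≤ r → ∀ x ∈ Ico (0 : ℝ) T.total, ∀ j q,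
      q < T.height (n k) j →
      (1 - δ) * r * (T.iter (n k)).len j ≤ visits T (towerFloor T (T.iter (n k)) j q) r x ∧
      visits T (towerFloor T (T.iter (n k)) j q) r x ≤ (1 + δ) * r * (T.iter (n k)).len j := by
  have hpos := h.iter_len_pos hT.1
  have hκ : 0 < κ := zero_lt_one.trans h.one_lt_kappa
  -- Two errors of size `δ₁`, from the entries and from the ends of the orbit, are multiplied; with
  -- `δ₁ ≤ 1` the product stays within `1 ± 3δ₁`.
  obtain ⟨δ₁, hδ₁, hδ₁1, hδ₁δ⟩ : ∃ δ₁ : ℝ, 0 < δ₁ ∧ δ₁ ≤ 1 ∧ 3 * δ₁ ≤ δ :=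
    ⟨min 1 (δ / 3), lt_min one_pos (by linarith), min_le_left _ _, by
      linarith [min_le_right 1 (δ / 3)]⟩
  obtain ⟨s, hs⟩ := h.cocycle_asymp hT hδ₁
  -- The `s` blocks make the entries accurate; `t` more blocks make `r` so long that the two
  -- incomplete towers at its ends are a proportion at most `δ₁`.
  obtain ⟨t, ht⟩ := pow_unbounded_of_one_lt (2 * κ / δ₁) one_lt_two
  refine ⟨(s + t) * lbar, fun k r hr x hx j q hq => ?_⟩
  have hle : n k ≤ n (k + s * lbar) := h.strictMono.monotone (Nat.le_add_right _ _)
  have hcount : ∀ i, ∀ z ∈ (T.iter (n (k + s * lbar))).interval i,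
      birkhoffSum T.map ((towerFloor T (T.iter (n k)) j q).indicator fun _ => (1 : ℝ))
        (T.height (n (k + s * lbar)) i) z = T.cocycle (n k) (n (k + s * lbar)) j i := by
    intro i z hz
    have := birkhoffSum_height_eq hpos hle
      (fun i z hz => (isTower_iter hpos (n k)).visits_towerFloor hT.1 hq i z hz) i z hz
    rw [this]
    simp
  have H := isTower_iter hpos (n (k + s * lbar))
  have hM := T.height_le_maxHeight (n (k + s * lbar))
  have hlen := hpos (n k) j
  have hMr : 2 * (T.maxHeight (n (k + s * lbar)) : ℝ) ≤ δ₁ * r := by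
    have h1 := h.two_pow_mul_le hT.1 hm (k + s * lbar) t 0
    have h2 : (T.height (n (k + s * lbar + t * lbar)) 0 : ℝ) ≤ r := by
      have e : k + s * lbar + t * lbar = k + (s + t) * lbar := by ring
      rw [e]
      exact Nat.cast_le.2 ((T.height_le_maxHeight _ _).trans hr)
    rw [div_lt_iff₀ hδ₁] at ht
    have h3 := mul_le_mul_of_nonneg_left h2 hκ.le
    have h4 := mul_le_mul_of_nonneg_right ht.le
      (Nat.cast_nonneg (α := ℝ) (T.maxHeight (n (k + s * lbar))))
    have h5 : κ * (2 * (T.maxHeight (n (k + s * lbar)) : ℝ)) ≤ κ * (δ₁ * r) := by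
      have := mul_le_mul_of_nonneg_left (h1.trans h3) hδ₁.le
      linarith
    exact le_of_mul_le_mul_left h5 hκ
  have hr0 : (0 : ℝ) ≤ r := Nat.cast_nonneg r
  have hrl : 0 ≤ r * (T.iter (n k)).len j := by positivity
  constructor
  · have h1 := H.le_birkhoffSum (indicator_one_nonneg (towerFloor T (T.iter (n k)) j q))
      (a := (T.iter (n k)).len j / (1 + δ₁)) (by positivity) hM (fun i z hz => by
        rw [hcount i z hz, div_mul_eq_mul_div, div_le_iff₀ (by positivity)]
        linarith [(hs k i j).2]) r hx
    refine le_trans ?_ h1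
    rw [div_mul_eq_mul_div, le_div_iff₀ (by positivity)]
    have h2 : (T.iter (n k)).len j * ((1 - δ₁) * r) ≤
        (T.iter (n k)).len j * (r - 2 * T.maxHeight (n (k + s * lbar))) :=
      mul_le_mul_of_nonneg_left (by linarith) hlen.le
    have h3 : (1 - δ) * (1 + δ₁) ≤ 1 - δ₁ := by nlinarith
    have h4 := mul_le_mul_of_nonneg_right h3 hrl
    linarith
  · have h1 := H.birkhoffSum_le (indicator_one_nonneg (towerFloor T (T.iter (n k)) j q))
      (a := (1 + δ₁) * (T.iter (n k)).len j) (by positivity) hM (fun i z hz => by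
        rw [hcount i z hz]
        linarith [(hs k i j).1]) r hx
    refine le_trans h1 ?_
    have h2 : (1 + δ₁) * (T.iter (n k)).len j * (r + 2 * T.maxHeight (n (k + s * lbar))) ≤
        (1 + δ₁) * (T.iter (n k)).len j * ((1 + δ₁) * r) :=
      mul_le_mul_of_nonneg_left (by linarith) (by positivity)
    have h3 : (1 + δ₁) * (1 + δ₁) ≤ 1 + δ := by nlinarith
    have h4 := mul_le_mul_of_nonneg_right h3 hrl
    linarith

end IsBalancedSeq

end IET

/-! ### Splitting reciprocal sums by scale -/

theorem birkhoffSum_le_add {α : Type*} {f : α → α} {g g₁ g₂ : α → ℝ} {r : ℕ} {x : α}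
    (h : ∀ k < r, g (f^[k] x) ≤ g₁ (f^[k] x) + g₂ (f^[k] x)) :
    birkhoffSum f g r x ≤ birkhoffSum f g₁ r x + birkhoffSum f g₂ r x := by
  simp only [birkhoffSum]
  rw [← Finset.sum_add_distrib]
  exact Finset.sum_le_sum fun k hk => h k (Finset.mem_range.1 hk)

theorem indicator_Ico_add {a b c : ℝ} (hab : a ≤ b) (hbc : b ≤ c) (u : ℝ → ℝ) (y : ℝ) :
    (Ico a c).indicator u y = (Ico a b).indicator u y + (Ico b c).indicator u y := by
  rw [← Ico_union_Ico_eq_Ico hab hbc, indicator_union_of_disjoint]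
  exact Set.disjoint_left.2 fun t h1 h2 => absurd h1.2 (not_lt.2 h2.1)

namespace IET

variable {m : ℕ} {T : IET m}

namespace IsBalancedSeq

variable {τ ν κ D : ℝ} {n : ℕ → ℕ} {lbar : ℕ}

/-- The crude frequency bound, from balance alone. The auxiliary `R` serves both orbits longer than
the towers (`R = r`) and shorter ones (`R` the maximal height). -/
theorem visits_le (h : T.IsBalancedSeq τ n ν κ D lbar) (hT : T.len ∈ openSimplex m)
    {l r : ℕ} {R : ℝ} (hr : r ≤ R) (hR : T.maxHeight (n l) ≤ R) {x : ℝ} (hx : x ∈ Ico 0 T.total)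
    (j : Fin (m + 1)) (q : ℕ) (hq : q < T.height (n l) j) :
    visits T (towerFloor T (T.iter (n l)) j q) r x ≤
      3 * κ * ((m + 1) * ν) * R * (T.iter (n l)).len j := by
  have hpos := h.iter_len_pos hT.1
  have hκ : 0 < κ := zero_lt_one.trans h.one_lt_kappa
  have hH : (0 : ℝ) < T.maxHeight (n l) := Nat.cast_pos.2 (one_le_maxHeight hpos _)
  have h1 := (isTower_iter hpos (n l)).visits_towerFloor_le hT.1 (T.height_le_maxHeight (n l))
    (c := T.maxHeight (n l) / κ) (by positivity)
    (fun j => (div_le_iff₀ hκ).2 (by linarith [h.maxHeight_le hT.1 l j])) hq r hx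
  have h2 : ((T.maxHeight (n l) : ℝ) / κ)⁻¹ ≤ κ * ((m + 1) * ν * (T.iter (n l)).len j) := by
    rw [inv_div, div_le_iff₀ hH]
    have h3 := one_le_maxHeight_mul_totalLen hpos hT.2 (n l)
    have h4 := mul_le_mul_of_nonneg_left (h.totalLen_le hT.1 l j) hH.le
    have h5 := mul_le_mul_of_nonneg_left (h3.trans h4) hκ.le
    linarith
  have hR0 : 0 ≤ R := hH.le.trans hR
  calc _ ≤ ((T.maxHeight (n l) : ℝ) / κ)⁻¹ * (r + 2 * T.maxHeight (n l)) := h1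
    _ ≤ κ * ((m + 1) * ν * (T.iter (n l)).len j) * (3 * R) :=
        mul_le_mul h2 (by linarith) (by positivity) ((inv_nonneg.2 (by positivity)).trans h2)
    _ = _ := by ring

theorem visits_base_le (h : T.IsBalancedSeq τ n ν κ D lbar) (hT : T.len ∈ openSimplex m)
    (l r : ℕ) {x : ℝ} (hx : x ∈ Ico 0 T.total) :
    visits T (Ico 0 (T.totalLen (n l))) r x ≤ κ * r / T.maxHeight (n l) + 1 := by
  have hpos := h.iter_len_pos hT.1
  have hκ : 0 < κ := zero_lt_one.trans h.one_lt_kappa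
  have hH : (0 : ℝ) < T.maxHeight (n l) := Nat.cast_pos.2 (one_le_maxHeight hpos _)
  have h1 := (isTower_iter hpos (n l)).visits_base_le (c := T.maxHeight (n l) / κ)
    (fun j => (div_le_iff₀ hκ).2 (by linarith [h.maxHeight_le hT.1 l j])) (by positivity) r hx
  rw [← totalLen_eq_total, ← le_div_iff₀' (by positivity)] at h1
  refine h1.trans_eq ?_
  field_simp

/-- An orbit shorter than the maximal height meets the base at most `κ + 1` times. This is the
origin of the factor in the closest-approach terms. -/
theorem birkhoffSum_base_le (h : T.IsBalancedSeq τ n ν κ D lbar) (hT : T.len ∈ openSimplex m)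
    {l r : ℕ} (hr : r < T.maxHeight (n l)) {x a : ℝ} (hx : x ∈ Ico 0 T.total) (ha : 0 < a)
    (hax : ∀ i < r, a ≤ T.map^[i] x) :
    birkhoffSum T.map ((Ico 0 (T.totalLen (n l))).indicator fun y => 1 / y) r x ≤ (κ + 1) / a := by
  classical
  have hκ : 0 < κ := zero_lt_one.trans h.one_lt_kappa
  have hH : (0 : ℝ) < T.maxHeight (n l) := Nat.cast_pos.2 (Nat.zero_lt_of_lt hr)
  have h1 : birkhoffSum T.map ((Ico 0 (T.totalLen (n l))).indicator fun y => 1 / y) r x ≤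
      1 / a * visits T (Ico 0 (T.totalLen (n l))) r x := by
    rw [visits, birkhoffSum, birkhoffSum, Finset.mul_sum]
    refine Finset.sum_le_sum fun k hk => ?_
    rw [indicator_apply, indicator_apply]
    split_ifs
    · rw [mul_one]
      exact one_div_le_one_div_of_le ha (hax k (Finset.mem_range.1 hk))
    · rw [mul_zero]
  have h2 := h.visits_base_le hT l r hx
  have h3 : κ * r / T.maxHeight (n l) ≤ κ := by
    rw [div_le_iff₀ hH]
    exact mul_le_mul_of_nonneg_left (Nat.cast_le.2 hr.le) hκ.le
  calc _ ≤ 1 / a * visits T (Ico 0 (T.totalLen (n l))) r x := h1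
    _ ≤ 1 / a * (κ + 1) := mul_le_mul_of_nonneg_left (by linarith) (by positivity)
    _ = _ := by ring

/-- The sum of reciprocals over the part in `[0, B)` of an orbit segment shorter than the heights
of level `l`. -/
theorem birkhoffSum_Ico_zero_le (h : T.IsBalancedSeq τ n ν κ D lbar) (hT : T.len ∈ openSimplex m)
    {l r : ℕ} (hr : r < T.maxHeight (n l)) {x a B : ℝ} (hx : x ∈ Ico 0 T.total) (ha : 0 < a)
    (hax : ∀ i < r, a ≤ T.map^[i] x) (hB : T.totalLen (n l) ≤ B) :
    birkhoffSum T.map ((Ico 0 B).indicator fun y => 1 / y) r x ≤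
      3 * κ * ((m + 1) * ν) * T.maxHeight (n l) * (Real.log (B / T.totalLen (n l)) + 3) +
        (κ + 1) / a := by
  have hpos := h.iter_len_pos hT.1
  have hκ : 0 < κ := zero_lt_one.trans h.one_lt_kappa
  have hν : 0 < ν := zero_lt_one.trans h.one_lt_nu
  have h1 := (isTower_iter hpos (n l)).birkhoffSum_one_div_le hT.1 hB
    (K := 3 * κ * ((m + 1) * ν) * T.maxHeight (n l)) (by positivity) hx
    (fun j q hq => h.visits_le hT (Nat.cast_le.2 hr.le) le_rfl hx j q hq)
  have h2 := h.birkhoffSum_base_le hT hr hx ha hax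
  have h3 : birkhoffSum T.map ((Ico 0 B).indicator fun y => 1 / y) r x ≤
      birkhoffSum T.map ((Ico 0 (T.totalLen (n l))).indicator fun y => 1 / y) r x +
      birkhoffSum T.map ((Ico (T.totalLen (n l)) B).indicator fun y => 1 / y) r x :=
    birkhoffSum_le_add fun k _ =>
      (indicator_Ico_add (total_pos (hpos (n l))).le hB _ _).le
  rw [← totalLen_eq_total] at h1
  linarith

theorem birkhoffSum_eq_indicator (hT : T.len ∈ openSimplex m) {x : ℝ} (hx : x ∈ Ico 0 T.total)
    (r : ℕ) : birkhoffSum T.map (fun y => 1 / y) r x =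
      birkhoffSum T.map ((Ico 0 1).indicator fun y => 1 / y) r x := by
  refine Finset.sum_congr rfl fun k _ => ?_
  have h1 := iterate_map_mem hT.1 hx k
  have h2 : T.total = 1 := hT.2
  rw [h2] at h1
  rw [indicator_of_mem h1]

theorem totalLen_le_one (h : T.IsBalancedSeq τ n ν κ D lbar) (hT : T.len ∈ openSimplex m)
    (k : ℕ) : T.totalLen k ≤ 1 := by
  have h1 := (isTower_iter (h.iter_len_pos hT.1) k).total_le
  have h2 : T.total = 1 := hT.2
  rwa [h2] at h1

theorem log_one_div_totalLen_le (h : T.IsBalancedSeq τ n ν κ D lbar) (hT : T.len ∈ openSimplex m)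
    (k : ℕ) : Real.log (1 / T.totalLen k) ≤ Real.log (T.maxHeight k) := by
  have hpos := h.iter_len_pos hT.1
  have h0 : 0 < T.totalLen k := total_pos (hpos k)
  refine Real.log_le_log (by positivity) ?_
  rw [div_le_iff₀ h0]
  exact one_le_maxHeight_mul_totalLen hpos hT.2 k

theorem log_maxHeight_sub_le (h : T.IsBalancedSeq τ n ν κ D lbar) (hT : T.len ∈ openSimplex m)
    (k : ℕ) :
    Real.log (T.maxHeight (n k)) - Real.log κ ≤ Real.log (1 / T.totalLen (n k)) := by
  have hpos := h.iter_len_pos hT.1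
  have hκ : 0 < κ := zero_lt_one.trans h.one_lt_kappa
  have h0 : 0 < T.totalLen (n k) := total_pos (hpos _)
  have hH : (0 : ℝ) < T.maxHeight (n k) := Nat.cast_pos.2 (one_le_maxHeight hpos _)
  rw [← Real.log_div hH.ne' hκ.ne']
  refine Real.log_le_log (by positivity) ?_
  rw [div_le_div_iff₀ hκ h0, one_mul]
  exact h.maxHeight_mul_totalLen_le hT k

/-- The product of maximal height and inducing length lies in `[1, κ]`, so log-lengths are opposite
log-heights up to `log κ`. -/
theorem log_totalLen_div_le (h : T.IsBalancedSeq τ n ν κ D lbar) (hT : T.len ∈ openSimplex m)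
    (k l : ℕ) : Real.log (T.totalLen (n k) / T.totalLen (n l)) ≤
      Real.log κ + Real.log (T.maxHeight (n l)) - Real.log (T.maxHeight (n k)) := by
  have hpos := h.iter_len_pos hT.1
  have h0 : ∀ k, 0 < T.totalLen (n k) := fun k => total_pos (hpos _)
  have h1 := h.log_one_div_totalLen_le hT (n l)
  have h2 := h.log_maxHeight_sub_le hT k
  rw [one_div, Real.log_inv] at h1 h2
  rw [Real.log_div (h0 k).ne' (h0 l).ne']
  linarith

/-- The contribution of the points of the base of level `l` for an orbit segment of intermediate
length starting outside `Σ⁺`. -/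
theorem birkhoffSum_near_le (h : T.IsBalancedSeq τ n ν κ D lbar) (hT : T.len ∈ openSimplex m)
    (hm : 1 ≤ m) {τ' : ℝ} {l r : ℕ} (hr₁ : T.maxHeight (n l) ≤ r)
    (hr₂ : r < T.maxHeight (n (l + 1)))
    (hσ : 0 < T.sigma τ' n l) {x a : ℝ} (hx : x ∈ Ico 0 T.total) (hxσ : x ∉ T.sigmaPlus τ' n l)
    (ha : 0 < a) (hax : ∀ i < r, a ≤ T.map^[i] x) :
    birkhoffSum T.map ((Ico 0 (T.totalLen (n l))).indicator fun y => 1 / y) r x ≤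
      3 * κ * ((m + 1) * ν) * (r / T.sigma τ' n l) *
        (Real.log (entrySum (T.cocycle (n l) (n (l + 1)))) + 3) + (κ + 1) / a := by
  classical
  have hpos := h.iter_len_pos hT.1
  have hκ : 1 < κ := h.one_lt_kappa
  have hν : 1 < ν := h.one_lt_nu
  have hH : (0 : ℝ) < T.maxHeight (n l) := Nat.cast_pos.2 (one_le_maxHeight hpos _)
  have hΛ : ∀ l, 0 < T.totalLen (n l) := fun l => total_pos (hpos (n l))
  have hle : n l ≤ n (l + 1) := h.strictMono.monotone l.le_succ
  have hT1 : T.total = 1 := hT.2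
  have hN : (2 : ℝ) ≤ entrySum (T.cocycle (n l) (n (l + 1))) := by
    exact_mod_cast h.two_le_entrySum hT.1 hm l
  have hlogN : 0 ≤ Real.log (entrySum (T.cocycle (n l) (n (l + 1)))) :=
    Real.log_nonneg (by linarith)
  have hr0 : (0 : ℝ) ≤ r := Nat.cast_nonneg r
  set σ := T.sigma τ' n l with hσdef
  have hmν : (1 : ℝ) ≤ (m + 1) * ν := by
    have : (0 : ℝ) ≤ m := Nat.cast_nonneg m
    nlinarith
  rcases le_or_gt (r : ℝ) (σ * T.maxHeight (n (l + 1))) with hcase | hcase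
  -- All times below `r` are covered by the definition of `Σ⁺`, so no point comes within `σ Λ_l` of
  -- zero, and counting visits to the base is enough.
  · have hfar : ∀ i < r, σ * T.totalLen (n l) < T.map^[i] x := by
      intro i hi
      by_contra hcon
      refine hxσ ⟨hT1 ▸ hx, i, Nat.le_floor ?_, (iterate_map_mem hT.1 hx i).1, not_lt.1 hcon⟩
      exact le_trans (Nat.cast_le.2 hi.le) hcase
    have h1 : birkhoffSum T.map ((Ico 0 (T.totalLen (n l))).indicator fun y => 1 / y) r x ≤
        1 / (σ * T.totalLen (n l)) * visits T (Ico 0 (T.totalLen (n l))) r x := by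
      rw [visits, birkhoffSum, birkhoffSum, Finset.mul_sum]
      refine Finset.sum_le_sum fun k hk => ?_
      rw [indicator_apply, indicator_apply]
      split_ifs
      · rw [mul_one]
        exact one_div_le_one_div_of_le (mul_pos hσ (hΛ l)) (hfar k (Finset.mem_range.1 hk)).le
      · rw [mul_zero]
    have h2 := h.visits_base_le hT l r hx
    have hrH : 1 ≤ (r : ℝ) / T.maxHeight (n l) := (one_le_div hH).2 (Nat.cast_le.2 hr₁)
    have h3 : visits T (Ico 0 (T.totalLen (n l))) r x ≤ 2 * κ * (r / T.maxHeight (n l)) := by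
      rw [mul_div_assoc] at h2
      nlinarith
    have h4 : 1 / (σ * T.totalLen (n l)) ≤ T.maxHeight (n l) / σ := by
      rw [div_le_div_iff₀ (mul_pos hσ (hΛ l)) hσ]
      have := mul_le_mul_of_nonneg_left (one_le_maxHeight_mul_totalLen hpos hT1 (n l)) hσ.le
      linarith
    have hκa : 0 ≤ (κ + 1) / a := by positivity
    calc _ ≤ 1 / (σ * T.totalLen (n l)) * visits T (Ico 0 (T.totalLen (n l))) r x := h1
      _ ≤ T.maxHeight (n l) / σ * (2 * κ * (r / T.maxHeight (n l))) :=
          mul_le_mul h4 h3 (birkhoffSum_nonneg_of_nonneg (indicator_one_nonneg _) _ _)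
            (by positivity)
      _ = 3 * κ * 1 * (r / σ) * (2 / 3) := by field_simp
      _ ≤ 3 * κ * ((m + 1) * ν) * (r / σ) *
          (Real.log (entrySum (T.cocycle (n l) (n (l + 1)))) + 3) :=
          mul_le_mul (mul_le_mul_of_nonneg_right (mul_le_mul_of_nonneg_left hmν (by positivity))
            (by positivity)) (by linarith) (by norm_num) (by positivity)
      _ ≤ _ := by linarith
  -- Now the height at level `l + 1` is below `r / σ`, so its towers give the bound; only here does
  -- the closest-approach term really arise.
  · have hB := totalLen_anti hpos hle
    refine (h.birkhoffSum_Ico_zero_le hT hr₂ hx ha hax hB).trans ?_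
    have h1 : Real.log (T.totalLen (n l) / T.totalLen (n (l + 1))) ≤
        Real.log (entrySum (T.cocycle (n l) (n (l + 1)))) := by
      refine Real.log_le_log (div_pos (hΛ _) (hΛ _)) ?_
      rw [div_le_iff₀ (hΛ _)]
      exact totalLen_le_entrySum_mul hpos hle
    have h2 : (T.maxHeight (n (l + 1)) : ℝ) ≤ r / σ := by
      rw [le_div_iff₀ hσ]
      linarith
    have h3 : 0 ≤ Real.log (T.totalLen (n l) / T.totalLen (n (l + 1))) :=
      Real.log_nonneg ((one_le_div (hΛ _)).2 hB)
    gcongr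

/-- Heights are monotone, so a large `r` can only lie below the height of a large level. -/
theorem eventually_level (h : T.IsBalancedSeq τ n ν κ D lbar) (hT : T.len ∈ openSimplex m)
    {p : ℕ → Prop} (hp : ∀ᶠ l in atTop, p l) :
    ∃ r₀, ∀ r, r₀ ≤ r → ∀ l, r < T.maxHeight (n (l + 1)) → p l := by
  obtain ⟨l₀, hl₀⟩ := eventually_atTop.1 hp
  refine ⟨T.maxHeight (n l₀), fun r hr l hl => hl₀ l ?_⟩
  by_contra hcon
  have := maxHeight_mono (h.iter_len_pos hT.1) (h.strictMono.monotone (by omega : l + 1 ≤ l₀))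
  omega

theorem exists_level (h : T.IsBalancedSeq τ n ν κ D lbar) (hT : T.len ∈ openSimplex m)
    (hm : 1 ≤ m) {r : ℕ} (hr : T.maxHeight (n 0) ≤ r) :
    ∃ l, T.maxHeight (n l) ≤ r ∧ r < T.maxHeight (n (l + 1)) := by
  classical
  have hex : ∃ l, r < T.maxHeight (n l) := by
    obtain ⟨l, hl⟩ := ((h.tendsto_log_maxHeight hT.1 hm).eventually_gt_atTop (Real.log r)).exists
    refine ⟨l, ?_⟩
    by_contra hcon
    refine absurd hl (not_lt.2 (Real.log_le_log ?_ (Nat.cast_le.2 (not_lt.1 hcon))))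
    exact Nat.cast_pos.2 (one_le_maxHeight (h.iter_len_pos hT.1) _)
  have h0 : Nat.find hex ≠ 0 := by
    intro h0
    have := Nat.find_spec hex
    rw [h0] at this
    omega
  obtain ⟨l, hl⟩ := Nat.exists_eq_succ_of_ne_zero h0
  refine ⟨l, not_lt.1 (Nat.find_min hex (by omega)), ?_⟩
  have := Nat.find_spec hex
  rwa [hl] at this

end IsBalancedSeq

end IET

/-! ### Birkhoff sums of the reciprocal function -/

namespace IET

variable {m : ℕ} {T : IET m}

theorem indicator_le_self_of_nonneg {F : Set ℝ} {u : ℝ → ℝ} {y : ℝ} (h : 0 ≤ u y) :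
    F.indicator u y ≤ u y := by
  classical
  rw [indicator_apply]
  split_ifs <;> linarith

namespace IsBalancedSeq

variable {τ ν κ D : ℝ} {n : ℕ → ℕ} {lbar : ℕ}

/-- Dividing by `σ = ρ ^ τ'`, with `ρ` the ratio of logarithms, leaves `ρ ^ (1 - τ')`, which tends
to zero. The norm is at least `2`, so the added `3` costs only a constant factor, for which `6`
suffices. -/
theorem tendsto_log_entrySum_div_sigma (h : T.IsBalancedSeq τ n ν κ D lbar)
    (hT : ∀ j, 0 < T.len j) (hm : 1 ≤ m) (hτ : τ < 2) {τ' : ℝ} (hτ' : τ' < 1) :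
    Tendsto (fun l => (Real.log (entrySum (T.cocycle (n l) (n (l + 1)))) + 3) /
      T.sigma τ' n l / Real.log (T.maxHeight (n l))) atTop (𝓝 0) := by
  have hlim := (h.tendsto_log_entrySum_div hT hm hτ).rpow_const (p := 1 - τ')
    (Or.inr (by linarith))
  rw [Real.zero_rpow (by linarith)] at hlim
  have hlim6 := hlim.const_mul 6
  rw [mul_zero] at hlim6
  have hlogpos := (h.tendsto_log_maxHeight hT hm).eventually_gt_atTop 0
  have hlogN : ∀ l, Real.log 2 ≤ Real.log (entrySum (T.cocycle (n l) (n (l + 1)))) := fun l =>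
    Real.log_le_log two_pos (by exact_mod_cast h.two_le_entrySum hT hm l)
  have hlog2 := Real.log_two_gt_d9
  refine tendsto_of_tendsto_of_tendsto_of_le_of_le' tendsto_const_nhds hlim6 ?_ ?_
  · filter_upwards [hlogpos] with l hl
    have h1 := hlogN l
    have h2 : 0 ≤ T.sigma τ' n l := Real.rpow_nonneg (div_nonneg (by linarith) hl.le) _
    exact div_nonneg (div_nonneg (by linarith) h2) hl.le
  · filter_upwards [hlogpos] with l hl
    have h1 := hlogN l
    set N := Real.log (entrySum (T.cocycle (n l) (n (l + 1))))
    set Y := Real.log (T.maxHeight (n l))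
    have hρ : 0 < N / Y := div_pos (by linarith) hl
    have hσ : 0 < T.sigma τ' n l := Real.rpow_pos_of_pos hρ _
    have h2 : (N / Y) ^ (1 - τ') = N / Y / T.sigma τ' n l := by
      rw [Real.rpow_sub hρ, Real.rpow_one]
      rfl
    rw [h2, div_div, div_div, mul_comm Y, mul_div_assoc']
    exact div_le_div_of_nonneg_right (by linarith) (by positivity)

theorem sigma_pos (h : T.IsBalancedSeq τ n ν κ D lbar) (hT : ∀ j, 0 < T.len j) (hm : 1 ≤ m)
    (τ' : ℝ) {l : ℕ} (hl : 0 < Real.log (T.maxHeight (n l))) : 0 < T.sigma τ' n l := by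
  refine Real.rpow_pos_of_pos (div_pos (Real.log_pos ?_) hl) _
  exact_mod_cast h.two_le_entrySum hT hm l

/-- Upper bound for the Birkhoff sums of `1 / x` outside `Σ⁺`. -/
theorem birkhoffSum_one_div_le (h : T.IsBalancedSeq τ n ν κ D lbar) (hT : T.len ∈ openSimplex m)
    (hm : 1 ≤ m) (hτ : τ < 2) {τ' : ℝ} (hτ' : τ' < 1) {η : ℝ} (hη : 0 < η) :
    ∃ r₀ : ℕ, ∀ r, r₀ ≤ r → ∀ l, T.maxHeight (n l) ≤ r → r < T.maxHeight (n (l + 1)) →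
      ∀ x ∈ Ico (0 : ℝ) 1, x ∉ T.sigmaPlus τ' n l → ∀ a, 0 < a → (∀ i < r, a ≤ T.map^[i] x) →
      birkhoffSum T.map (fun y => 1 / y) r x ≤
        (1 + η) * (r * Real.log r) + (κ + 1) / a := by
  have hpos := h.iter_len_pos hT.1
  have hT1 : T.total = 1 := hT.2
  have hκ : 1 < κ := h.one_lt_kappa
  have hν : 1 < ν := h.one_lt_nu
  -- The far piece loses `2δ`, the middle piece `2δ` and the near piece `δ`.
  obtain ⟨δ, hδ, hδη⟩ : ∃ δ : ℝ, 0 < δ ∧ 5 * δ = η := ⟨η / 5, by linarith, by ring⟩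
  set C₀ := 3 * κ * ((m + 1) * ν) with hC₀
  have hC₀pos : 0 < C₀ := by positivity
  obtain ⟨L, hL⟩ := h.visits_asymp hT hm hδ
  have htend := h.tendsto_log_maxHeight hT.1 hm
  have hratio := (h.tendsto_log_maxHeight_ratio hT.1 hm hτ L).eventually
    (gt_mem_nhds (show (1 : ℝ) < 1 + δ / C₀ by linarith [div_pos hδ hC₀pos]))
  have hsig := (h.tendsto_log_entrySum_div_sigma hT.1 hm hτ hτ').eventually
    (gt_mem_nhds (div_pos hδ hC₀pos))
  have hE : ∀ᶠ l in atTop, L ≤ l ∧ 0 < Real.log (T.maxHeight (n (l - L))) ∧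
      3 * (1 + δ) / δ ≤ Real.log (T.maxHeight (n l)) ∧
      C₀ * (Real.log κ + 3) / δ ≤ Real.log (T.maxHeight (n l)) ∧
      Real.log (T.maxHeight (n (l - L + L))) / Real.log (T.maxHeight (n (l - L))) < 1 + δ / C₀ ∧
      (Real.log (entrySum (T.cocycle (n l) (n (l + 1)))) + 3) /
        T.sigma τ' n l / Real.log (T.maxHeight (n l)) < δ / C₀ := by
    have hsub : Tendsto (fun l => l - L) atTop atTop := tendsto_sub_atTop_nat L
    filter_upwards [eventually_ge_atTop L, hsub.eventually (htend.eventually_gt_atTop 0),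
      htend.eventually_ge_atTop _, htend.eventually_ge_atTop _, hsub.eventually hratio, hsig]
      with l h1 h2 h3 h4 h5 h6
    exact ⟨h1, h2, h3, h4, h5, h6⟩
  obtain ⟨r₀, hr₀⟩ := h.eventually_level hT hE
  refine ⟨r₀, fun r hr l hr₁ hr₂ x hx hxσ a ha hax => ?_⟩
  obtain ⟨hLl, hlogk, e3, e4, e5, e6⟩ := hr₀ r hr l hr₂
  rw [← hT1] at hx
  obtain ⟨k, rfl⟩ : ∃ k, l = k + L := ⟨l - L, (Nat.sub_add_cancel hLl).symm⟩
  rw [Nat.add_sub_cancel] at hlogk e5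
  have hmono : ∀ {a b : ℕ}, a ≤ b → Real.log (T.maxHeight (n a)) ≤ Real.log (T.maxHeight (n b)) :=
    fun hab => Real.log_le_log (Nat.cast_pos.2 (one_le_maxHeight hpos _))
      (Nat.cast_le.2 (maxHeight_mono hpos (h.strictMono.monotone hab)))
  have hY : 0 < Real.log (T.maxHeight (n (k + L))) := hlogk.trans_le (hmono (Nat.le_add_right k L))
  have hYk := hmono (Nat.le_add_right k L)
  have hYX : Real.log (T.maxHeight (n (k + L))) ≤ Real.log r :=
    Real.log_le_log (Nat.cast_pos.2 (one_le_maxHeight hpos _)) (Nat.cast_le.2 hr₁)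
  have hσ := h.sigma_pos hT.1 hm τ' hY
  have hΛ : ∀ l, 0 < T.totalLen (n l) := fun l => total_pos (hpos (n l))
  have hr0 : (0 : ℝ) ≤ r := Nat.cast_nonneg r
  have htot := totalLen_anti hpos (h.strictMono.monotone (Nat.le_add_right k L))
  have hfar := (isTower_iter hpos (n k)).birkhoffSum_one_div_le hT.1
    (h.totalLen_le_one hT (n k)) (K := (1 + δ) * r) (by positivity) hx
    (fun j q hq => (hL k r hr₁ x hx j q hq).2)
  have hmid := (isTower_iter hpos (n (k + L))).birkhoffSum_one_div_le hT.1 htot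
    (K := C₀ * r) (by positivity) hx
    (fun j q hq => h.visits_le hT le_rfl (Nat.cast_le.2 hr₁) hx j q hq)
  have hnear := h.birkhoffSum_near_le hT hm hr₁ hr₂ hσ hx hxσ ha hax
  rw [← totalLen_eq_total] at hfar hmid
  have hsplit : birkhoffSum T.map (fun y => 1 / y) r x ≤
      birkhoffSum T.map ((Ico 0 (T.totalLen (n k))).indicator fun y => 1 / y) r x +
      birkhoffSum T.map ((Ico (T.totalLen (n k)) 1).indicator fun y => 1 / y) r x := by
    rw [birkhoffSum_eq_indicator hT hx]
    exact birkhoffSum_le_add fun i _ =>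
      (indicator_Ico_add (hΛ k).le (h.totalLen_le_one hT _) _ _).le
  have hsplit' : birkhoffSum T.map ((Ico 0 (T.totalLen (n k))).indicator fun y => 1 / y) r x ≤
      birkhoffSum T.map ((Ico 0 (T.totalLen (n (k + L)))).indicator fun y => 1 / y) r x +
      birkhoffSum T.map ((Ico (T.totalLen (n (k + L))) (T.totalLen (n k))).indicator
        fun y => 1 / y) r x :=
    birkhoffSum_le_add fun i _ => (indicator_Ico_add (hΛ _).le htot _ _).le
  have b1 := h.log_one_div_totalLen_le hT (n k)
  have b2 := h.log_totalLen_div_le hT k (k + L)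
  rw [div_lt_iff₀ hlogk] at e5
  rw [div_lt_iff₀ hY] at e6
  rw [div_le_iff₀ hδ] at e3 e4
  set X := Real.log r
  set Y := Real.log (T.maxHeight (n (k + L)))
  set Z := Real.log (T.maxHeight (n k))
  have c1 : (1 + δ) * (Real.log (1 / T.totalLen (n k)) + 3) ≤ (1 + 2 * δ) * X := by
    have : (1 + δ) * Real.log (1 / T.totalLen (n k)) ≤ (1 + δ) * X :=
      mul_le_mul_of_nonneg_left (by linarith) (by linarith)
    have h2 : Y * δ ≤ X * δ := mul_le_mul_of_nonneg_right hYX hδ.le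
    linarith
  have c2 : C₀ * (Real.log (T.totalLen (n k) / T.totalLen (n (k + L))) + 3) ≤ 2 * δ * X := by
    have h1 : Y - Z ≤ δ / C₀ * X := by
      have : δ / C₀ * Z ≤ δ / C₀ * X :=
        mul_le_mul_of_nonneg_left (hYk.trans hYX) (by positivity)
      linarith
    have h2 : C₀ * (Y - Z) ≤ δ * X := by
      have := mul_le_mul_of_nonneg_left h1 hC₀pos.le
      rwa [← mul_assoc, mul_div_cancel₀ _ hC₀pos.ne'] at this
    have h3 := mul_le_mul_of_nonneg_left b2 hC₀pos.le
    have h4 : Y * δ ≤ X * δ := mul_le_mul_of_nonneg_right hYX hδ.le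
    linarith
  have c3 : C₀ * (r / T.sigma τ' n (k + L)) *
      (Real.log (entrySum (T.cocycle (n (k + L)) (n (k + L + 1)))) + 3) ≤ r * (δ * X) := by
    have h1 : C₀ * ((Real.log (entrySum (T.cocycle (n (k + L)) (n (k + L + 1)))) + 3) /
        T.sigma τ' n (k + L)) ≤ δ * X := by
      have := mul_le_mul_of_nonneg_left (e6.le.trans
        (mul_le_mul_of_nonneg_left hYX (by positivity))) hC₀pos.le
      rwa [← mul_assoc C₀ (δ / C₀), mul_div_cancel₀ _ hC₀pos.ne'] at this
    have := mul_le_mul_of_nonneg_left h1 hr0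
    refine le_trans (le_of_eq ?_) this
    ring
  have d1 := mul_le_mul_of_nonneg_left c1 hr0
  have d2 := mul_le_mul_of_nonneg_left c2 hr0
  rw [← hδη]
  linarith

/-- Lower bound for the Birkhoff sums of `1 / x`. -/
theorem le_birkhoffSum_one_div (h : T.IsBalancedSeq τ n ν κ D lbar) (hT : T.len ∈ openSimplex m)
    (hm : 1 ≤ m) (hτ : τ < 2) {η : ℝ} (hη : 0 < η) :
    ∃ r₀ : ℕ, ∀ r, r₀ ≤ r → ∀ x ∈ Ico (0 : ℝ) 1,
      (1 - η) * (r * Real.log r) ≤ birkhoffSum T.map (fun y => 1 / y) r x := by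
  have hpos := h.iter_len_pos hT.1
  have hT1 : T.total = 1 := hT.2
  have hκ : 1 < κ := h.one_lt_kappa
  -- One `δ` is lost in the frequency, one in replacing the logarithm of the length by that of the
  -- height, and one in comparing the height at level `k` with `r`; `4δ` covers their combination.
  obtain ⟨δ, hδ, hδ1, hδη⟩ : ∃ δ : ℝ, 0 < δ ∧ δ ≤ 1 / 2 ∧ 4 * δ ≤ η :=
    ⟨min (1 / 2) (η / 4), lt_min (by norm_num) (by linarith), min_le_left _ _, by
      linarith [min_le_right (1 / 2) (η / 4)]⟩
  obtain ⟨L, hL⟩ := h.visits_asymp hT hm hδ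
  have htend := h.tendsto_log_maxHeight hT.1 hm
  have hratio := (h.tendsto_log_maxHeight_ratio hT.1 hm hτ (L + 1)).eventually
    (gt_mem_nhds (show (1 : ℝ) < 1 + δ by linarith))
  have hE : ∀ᶠ l in atTop, L ≤ l ∧ 0 < Real.log (T.maxHeight (n (l - L))) ∧
      (Real.log κ + 1) / δ ≤ Real.log (T.maxHeight (n (l - L))) ∧
      Real.log (T.maxHeight (n (l - L + (L + 1)))) / Real.log (T.maxHeight (n (l - L))) <
        1 + δ := by
    have hsub : Tendsto (fun l => l - L) atTop atTop := tendsto_sub_atTop_nat L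
    filter_upwards [eventually_ge_atTop L, hsub.eventually (htend.eventually_gt_atTop 0),
      hsub.eventually (htend.eventually_ge_atTop _), hsub.eventually hratio] with l h1 h2 h3 h4
    exact ⟨h1, h2, h3, h4⟩
  obtain ⟨r₀, hr₀⟩ := h.eventually_level hT hE
  refine ⟨max r₀ (T.maxHeight (n 0)), fun r hr x hx => ?_⟩
  obtain ⟨l, hr₁, hr₂⟩ := h.exists_level hT hm ((le_max_right _ _).trans hr)
  obtain ⟨hLl, hlogk, e3, e4⟩ := hr₀ r ((le_max_left _ _).trans hr) l hr₂
  rw [← hT1] at hx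
  obtain ⟨k, rfl⟩ : ∃ k, l = k + L := ⟨l - L, (Nat.sub_add_cancel hLl).symm⟩
  rw [Nat.add_sub_cancel] at hlogk e3 e4
  have hrpos : 0 < r := (one_le_maxHeight hpos _).trans hr₁
  have hXH : Real.log r ≤ Real.log (T.maxHeight (n (k + (L + 1)))) :=
    Real.log_le_log (Nat.cast_pos.2 hrpos) (Nat.cast_le.2 hr₂.le)
  have hX0 : 0 ≤ Real.log r := Real.log_natCast_nonneg r
  have hr0 : (0 : ℝ) ≤ r := Nat.cast_nonneg r
  have hfar := (isTower_iter hpos (n k)).le_birkhoffSum_one_div hT.1 (K := (1 - δ) * r)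
    (mul_nonneg (by linarith) hr0) (fun j q hq => (hL k r hr₁ x hx j q hq).1)
  rw [← totalLen_eq_total, hT1] at hfar
  have hind : birkhoffSum T.map ((Ici (T.totalLen (n k))).indicator fun y => 1 / y) r x ≤
      birkhoffSum T.map (fun y => 1 / y) r x := by
    refine Finset.sum_le_sum fun i _ => ?_
    exact indicator_le_self_of_nonneg (one_div_nonneg.2 (iterate_map_mem hT.1 hx i).1)
  have b1 := h.log_maxHeight_sub_le hT k
  rw [div_lt_iff₀ hlogk] at e4
  rw [div_le_iff₀ hδ] at e3
  set X := Real.log r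
  set Z := Real.log (T.maxHeight (n k))
  have c1 : (1 - δ) * Z ≤ Real.log (1 / T.totalLen (n k)) - 1 := by linarith
  have c2 : (1 - η) * X ≤ (1 - δ) * (Real.log (1 / T.totalLen (n k)) - 1) := by
    have h1 : (1 - η) * X ≤ (1 - 4 * δ) * X := mul_le_mul_of_nonneg_right (by linarith) hX0
    have h2 : (1 - δ) * ((1 - δ) * Z) ≤ (1 - δ) * (Real.log (1 / T.totalLen (n k)) - 1) :=
      mul_le_mul_of_nonneg_left c1 (by linarith)
    have h3 : X ≤ (1 + δ) * Z := hXH.trans e4.le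
    rcases le_total 0 (1 - 4 * δ) with h0 | h0
    · have h4 : (1 - 4 * δ) * X ≤ (1 - 4 * δ) * ((1 + δ) * Z) := mul_le_mul_of_nonneg_left h3 h0
      have h5 : 0 ≤ (δ + 5 * δ ^ 2) * Z := by positivity
      linarith
    · have h4 : (1 - 4 * δ) * X ≤ 0 := mul_nonpos_of_nonpos_of_nonneg h0 hX0
      have h5 : 0 ≤ (1 - δ) * ((1 - δ) * Z) :=
        mul_nonneg (by linarith) (mul_nonneg (by linarith) hlogk.le)
      linarith
  have d1 := mul_le_mul_of_nonneg_left c2 hr0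
  linarith

/-- A bound for the Birkhoff sums of `1 / x` valid for all points. -/
theorem birkhoffSum_one_div_le_sq (h : T.IsBalancedSeq τ n ν κ D lbar)
    (hT : T.len ∈ openSimplex m) (hm : 1 ≤ m) (hτ : τ < 2) :
    ∃ r₀ : ℕ, ∀ r, r₀ ≤ r → ∀ x ∈ Ico (0 : ℝ) 1, ∀ a, 0 < a → (∀ i < r, a ≤ T.map^[i] x) →
      birkhoffSum T.map (fun y => 1 / y) r x ≤ (r : ℝ) ^ 2 + (κ + 1) / a := by
  have hpos := h.iter_len_pos hT.1
  have hT1 : T.total = 1 := hT.2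
  have hκ : 1 < κ := h.one_lt_kappa
  have hν : 1 < ν := h.one_lt_nu
  set C₀ := 3 * κ * ((m + 1) * ν) with hC₀
  have hC₀pos : 0 < C₀ := by positivity
  have htend := h.tendsto_log_maxHeight hT.1 hm
  have hratio := (h.tendsto_log_maxHeight_ratio hT.1 hm hτ 1).eventually
    (gt_mem_nhds (show (1 : ℝ) < 3 / 2 by norm_num))
  -- With `Y` the current log-height, the next height is at most `exp (3Y/2)`; the remaining factor
  -- must fit into `exp (Y/2)` for the product to be at most `exp (2Y) ≤ r²`.
  have hlogsmall : ∀ᶠ Y : ℝ in atTop, C₀ * (3 / 2 * Y + 3) ≤ Real.exp (Y / 2) := by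
    have h1 : Tendsto (fun Y : ℝ => Y * Real.exp (-(1 / 2) * Y)) atTop (𝓝 0) := by
      simpa using tendsto_rpow_mul_exp_neg_mul_atTop_nhds_zero 1 (1 / 2) (by norm_num)
    have h2 : Tendsto (fun Y : ℝ => Real.exp (-(1 / 2) * Y)) atTop (𝓝 0) := by
      simpa using tendsto_rpow_mul_exp_neg_mul_atTop_nhds_zero 0 (1 / 2) (by norm_num)
    have h3 := (h1.const_mul (C₀ * (3 / 2))).add (h2.const_mul (C₀ * 3))
    rw [mul_zero, mul_zero, add_zero] at h3
    filter_upwards [h3.eventually (gt_mem_nhds zero_lt_one)] with Y hY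
    have h4 := mul_le_mul_of_nonneg_right hY.le (Real.exp_pos (Y / 2)).le
    have h5 : Real.exp (-(1 / 2) * Y) * Real.exp (Y / 2) = 1 := by
      rw [← Real.exp_add, show -(1 / 2) * Y + Y / 2 = 0 by ring, Real.exp_zero]
    calc C₀ * (3 / 2 * Y + 3)
        = (C₀ * (3 / 2) * Y + C₀ * 3) * (Real.exp (-(1 / 2) * Y) * Real.exp (Y / 2)) := by
          rw [h5]; ring
      _ = (C₀ * (3 / 2) * (Y * Real.exp (-(1 / 2) * Y)) + C₀ * 3 * Real.exp (-(1 / 2) * Y)) *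
          Real.exp (Y / 2) := by ring
      _ ≤ 1 * Real.exp (Y / 2) := h4
      _ = _ := one_mul _
  obtain ⟨r₀, hr₀⟩ := h.eventually_level hT
    ((htend.eventually_gt_atTop 0).and (hratio.and (htend.eventually hlogsmall)))
  refine ⟨max r₀ (T.maxHeight (n 0)), fun r hr x hx a ha hax => ?_⟩
  obtain ⟨l, hr₁, hr₂⟩ := h.exists_level hT hm ((le_max_right _ _).trans hr)
  obtain ⟨hY, e1, e2⟩ := hr₀ r ((le_max_left _ _).trans hr) l hr₂
  rw [← hT1] at hx
  have hH : ∀ l, (0 : ℝ) < T.maxHeight (n l) := fun l => Nat.cast_pos.2 (one_le_maxHeight hpos _)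
  have h1 := h.birkhoffSum_Ico_zero_le hT hr₂ hx ha hax (h.totalLen_le_one hT _)
  rw [birkhoffSum_eq_indicator hT hx]
  refine h1.trans ?_
  have b1 := h.log_one_div_totalLen_le hT (n (l + 1))
  rw [div_lt_iff₀ hY] at e1
  set Y := Real.log (T.maxHeight (n l)) with hYdef
  have hHl : (T.maxHeight (n l) : ℝ) = Real.exp Y := (Real.exp_log (hH l)).symm
  have hHl' : (T.maxHeight (n (l + 1)) : ℝ) ≤ Real.exp (3 / 2 * Y) := by
    rw [← Real.exp_log (hH (l + 1))]
    exact Real.exp_le_exp.2 e1.le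
  have hrY : Real.exp Y ≤ r := by
    rw [← hHl]
    exact Nat.cast_le.2 hr₁
  have h0 : 0 ≤ Real.log (1 / T.totalLen (n (l + 1))) := by
    refine Real.log_nonneg ?_
    exact (one_le_div (total_pos (hpos _))).2 (h.totalLen_le_one hT _)
  have h2 : C₀ * T.maxHeight (n (l + 1)) * (Real.log (1 / T.totalLen (n (l + 1))) + 3) ≤
      (r : ℝ) ^ 2 := by
    calc C₀ * T.maxHeight (n (l + 1)) * (Real.log (1 / T.totalLen (n (l + 1))) + 3)
        ≤ C₀ * Real.exp (3 / 2 * Y) * (3 / 2 * Y + 3) := by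
          have h3 : Real.log (1 / T.totalLen (n (l + 1))) ≤ 3 / 2 * Y := b1.trans e1.le
          gcongr
      _ = Real.exp (3 / 2 * Y) * (C₀ * (3 / 2 * Y + 3)) := by ring
      _ ≤ Real.exp (3 / 2 * Y) * Real.exp (Y / 2) :=
          mul_le_mul_of_nonneg_left e2 (Real.exp_pos _).le
      _ = Real.exp Y ^ 2 := by
          rw [← Real.exp_add, ← Real.exp_nat_mul]
          congr 1
          push_cast
          ring
      _ ≤ (r : ℝ) ^ 2 := pow_le_pow_left₀ (Real.exp_pos _).le hrY 2
  linarith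

end IsBalancedSeq

end IET

/-! ### The derivative of a roof function -/

section roof

/-- Integrating an asymptotic equivalence `φ' ~ C / x²` near the origin. -/
theorem abs_add_div_le_of_deriv_tendsto {φ : ℝ → ℝ} {C : ℝ} (hφ : DifferentiableOn ℝ φ (Ioo 0 1))
    (hlim : Tendsto (fun x => deriv φ x / (1 / x ^ 2)) (𝓝[>] 0) (𝓝 C)) {ε : ℝ} (hε : 0 < ε) :
    ∃ δ ∈ Ioo (0 : ℝ) 1, ∃ M : ℝ, ∀ x ∈ Ioo 0 δ, |φ x + C / x| ≤ ε / x + M := by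
  have hev := hlim.eventually (Metric.ball_mem_nhds C hε)
  obtain ⟨δ₀, hδ₀, hδ⟩ := mem_nhdsGT_iff_exists_Ioo_subset.1 hev
  have hδ₀' : (0 : ℝ) < δ₀ := hδ₀
  set δ₁ := min δ₀ 1 with hδ₁
  have hδ₁pos : 0 < δ₁ := lt_min hδ₀' one_pos
  have hsub : Ioo 0 δ₁ ⊆ Ioo (0 : ℝ) 1 := Ioo_subset_Ioo_right (min_le_right _ _)
  have hderiv : ∀ c, ∀ x ∈ Ioo 0 δ₁,
      HasDerivAt (fun x => φ x + c / x) (deriv φ x - c / x ^ 2) x := by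
    intro c x hx
    have h1 : HasDerivAt φ (deriv φ x) x :=
      ((hφ x (hsub hx)).differentiableAt (isOpen_Ioo.mem_nhds (hsub hx))).hasDerivAt
    have h2 : HasDerivAt (fun y => c / y) (-(c / x ^ 2)) x := by
      simpa [div_eq_mul_inv] using (hasDerivAt_inv hx.1.ne').const_mul c
    exact (h1.add h2).congr_deriv (by ring)
  have hbd : ∀ x ∈ Ioo 0 δ₁, (C - ε) / x ^ 2 ≤ deriv φ x ∧ deriv φ x ≤ (C + ε) / x ^ 2 := by
    intro x hx
    have hxpos : 0 < x := hx.1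
    have h1 : |deriv φ x / (1 / x ^ 2) - C| < ε := by
      have : dist (deriv φ x / (1 / x ^ 2)) C < ε := hδ ⟨hx.1, hx.2.trans_le (min_le_left _ _)⟩
      rwa [Real.dist_eq] at this
    rw [div_div_eq_mul_div, div_one, abs_lt] at h1
    constructor
    · rw [div_le_iff₀ (by positivity)]
      linarith [h1.1]
    · rw [le_div_iff₀ (by positivity)]
      linarith [h1.2]
  -- Adding `(C ± ε)/x` makes the function monotone in opposite directions; comparing with the value
  -- at the midpoint gives the two one-sided bounds.
  have hanti : AntitoneOn (fun x => φ x + (C + ε) / x) (Ioo 0 δ₁) := by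
    refine antitoneOn_of_deriv_nonpos (convex_Ioo _ _)
      (fun x hx => (hderiv _ x hx).continuousAt.continuousWithinAt) ?_ ?_
    · rw [interior_Ioo]
      exact fun x hx => (hderiv _ x hx).differentiableAt.differentiableWithinAt
    · rw [interior_Ioo]
      intro x hx
      rw [(hderiv _ x hx).deriv]
      linarith [(hbd x hx).2]
  have hmono : MonotoneOn (fun x => φ x + (C - ε) / x) (Ioo 0 δ₁) := by
    refine monotoneOn_of_deriv_nonneg (convex_Ioo _ _)
      (fun x hx => (hderiv _ x hx).continuousAt.continuousWithinAt) ?_ ?_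
    · rw [interior_Ioo]
      exact fun x hx => (hderiv _ x hx).differentiableAt.differentiableWithinAt
    · rw [interior_Ioo]
      intro x hx
      rw [(hderiv _ x hx).deriv]
      linarith [(hbd x hx).1]
  have hmid : δ₁ / 2 ∈ Ioo 0 δ₁ := ⟨by linarith, by linarith⟩
  refine ⟨δ₁ / 2, hsub hmid, max |φ (δ₁ / 2) + (C + ε) / (δ₁ / 2)|
    |φ (δ₁ / 2) + (C - ε) / (δ₁ / 2)|, fun x hx => ?_⟩
  have hx' : x ∈ Ioo 0 δ₁ := ⟨hx.1, hx.2.trans hmid.2⟩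
  have h1 := hanti hx' hmid hx.2.le
  have h2 := hmono hx' hmid hx.2.le
  simp only at h1 h2
  rw [add_div C ε x] at h1
  rw [sub_div C ε x] at h2
  have h3 := neg_abs_le (φ (δ₁ / 2) + (C + ε) / (δ₁ / 2))
  have h4 := le_abs_self (φ (δ₁ / 2) + (C - ε) / (δ₁ / 2))
  have h5 := le_max_left |φ (δ₁ / 2) + (C + ε) / (δ₁ / 2)| |φ (δ₁ / 2) + (C - ε) / (δ₁ / 2)|
  have h6 := le_max_right |φ (δ₁ / 2) + (C + ε) / (δ₁ / 2)| |φ (δ₁ / 2) + (C - ε) / (δ₁ / 2)|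
  rw [abs_le]
  constructor <;> linarith

/-- The derivative of a roof function is `-C⁺ / x + C⁻ / (1 - x)` up to a small multiple of the
singular terms and a bounded term. -/
theorem IsLogRoof.abs_deriv_le {f : ℝ → ℝ} {Cp Cm : ℝ} (hf : IsLogRoof f Cp Cm) {ε : ℝ}
    (hε : 0 < ε) (hCp : 0 < Cp) (hCm : 0 < Cm) :
    ∃ M : ℝ, ∀ x ∈ Ioo (0 : ℝ) 1,
      |deriv f x + Cp * (1 / x) - Cm * (1 / (1 - x))| ≤ ε * (1 / x + 1 / (1 - x)) + M := by
  have hC1 : ContDiffOn ℝ 1 (deriv f) (Ioo 0 1) :=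
    hf.contDiffOn.deriv_of_isOpen isOpen_Ioo (by norm_num)
  have hd : DifferentiableOn ℝ (deriv f) (Ioo 0 1) := hC1.differentiableOn (by norm_num)
  have hrefl : ∀ t ∈ Ioo (0 : ℝ) 1, 1 - t ∈ Ioo (0 : ℝ) 1 := fun t ht =>
    ⟨by linarith [ht.2], by linarith [ht.1]⟩
  obtain ⟨δ, hδ, M₁, hM₁⟩ := abs_add_div_le_of_deriv_tendsto hd hf.tendsto_zero hε
  -- The sign is chosen so that the derivative of this function is `f''(1 - t)`, and the estimate at
  -- zero applies to the other singularity.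
  have hd' : DifferentiableOn ℝ (fun t => -deriv f (1 - t)) (Ioo 0 1) :=
    (hd.comp (differentiableOn_id.const_sub 1) hrefl).neg
  have hlim' : Tendsto (fun t => deriv (fun t => -deriv f (1 - t)) t / (1 / t ^ 2)) (𝓝[>] 0)
      (𝓝 Cm) := by
    have h1 : Tendsto (fun t : ℝ => 1 - t) (𝓝[>] 0) (𝓝[<] 1) := by
      refine tendsto_nhdsWithin_iff.2 ⟨?_, ?_⟩
      · have : Continuous fun t : ℝ => 1 - t := by fun_prop
        have h2 := this.tendsto 0
        rw [sub_zero] at h2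
        exact h2.mono_left nhdsWithin_le_nhds
      · filter_upwards [self_mem_nhdsWithin] with t ht
        have : (0 : ℝ) < t := ht
        exact show 1 - t < 1 by linarith
    refine (hf.tendsto_one.comp h1).congr fun t => ?_
    simp only [Function.comp]
    rw [deriv.fun_neg, deriv_comp_const_sub, neg_neg, sub_sub_cancel, div_pow, one_pow]
  obtain ⟨δ', hδ', M₂, hM₂⟩ := abs_add_div_le_of_deriv_tendsto hd' hlim' hε
  obtain ⟨M₃, hM₃⟩ := (isCompact_Icc (a := δ) (b := 1 - δ')).exists_bound_of_continuousOn
    (f := deriv f) (hd.continuousOn.mono fun x hx =>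
      ⟨hδ.1.trans_le hx.1, hx.2.trans_lt (by linarith [hδ'.1])⟩)
  refine ⟨(|M₁| + Cm / (1 - δ)) + (|M₂| + Cp / (1 - δ')) + (|M₃| + Cp / δ + Cm / δ'),
    fun x hx => ?_⟩
  have hx0 := hx.1
  have hx1 : 0 < 1 - x := by linarith [hx.2]
  have hδ0 := hδ.1
  have hδ1 : 0 < 1 - δ := by linarith [hδ.2]
  have hδ'0 := hδ'.1
  have hδ'1 : 0 < 1 - δ' := by linarith [hδ'.2]
  have p1 : 0 ≤ Cm / (1 - δ) := by positivity
  have p2 : 0 ≤ Cp / (1 - δ') := by positivity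
  have p3 : 0 ≤ Cp / δ := by positivity
  have p4 : 0 ≤ Cm / δ' := by positivity
  have p5 : 0 < Cp * (1 / x) := by positivity
  have p6 : 0 < Cm * (1 / (1 - x)) := by positivity
  have p7 : 0 < ε * (1 / x) := by positivity
  have p8 : 0 < ε * (1 / (1 - x)) := by positivity
  have a1 := abs_nonneg M₁
  have a2 := abs_nonneg M₂
  have a3 := abs_nonneg M₃
  have b1 := le_abs_self M₁
  have b2 := le_abs_self M₂
  have b3 := le_abs_self M₃
  rw [mul_add]
  by_cases hxδ : x < δ
  · have h1 := hM₁ x ⟨hx0, hxδ⟩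
    have h2 : Cm * (1 / (1 - x)) ≤ Cm / (1 - δ) := by
      rw [mul_one_div]
      exact div_le_div_of_nonneg_left hCm.le hδ1 (by linarith)
    rw [div_eq_mul_one_div Cp x, div_eq_mul_one_div ε x, abs_le] at h1
    rw [abs_le]
    constructor <;> linarith [h1.1, h1.2]
  by_cases hxδ' : 1 - δ' < x
  · have h1 := hM₂ (1 - x) ⟨hx1, by linarith⟩
    have h2 : Cp * (1 / x) ≤ Cp / (1 - δ') := by
      rw [mul_one_div]
      exact div_le_div_of_nonneg_left hCp.le hδ'1 (by linarith)
    rw [sub_sub_cancel, div_eq_mul_one_div Cm, div_eq_mul_one_div ε (1 - x), abs_le] at h1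
    rw [abs_le]
    constructor <;> linarith [h1.1, h1.2]
  · have h1 := hM₃ x ⟨not_lt.1 hxδ, not_lt.1 hxδ'⟩
    have h2 : Cp * (1 / x) ≤ Cp / δ := by
      rw [mul_one_div]
      exact div_le_div_of_nonneg_left hCp.le hδ0 (not_lt.1 hxδ)
    have h3 : Cm * (1 / (1 - x)) ≤ Cm / δ' := by
      rw [mul_one_div]
      exact div_le_div_of_nonneg_left hCm.le hδ'0 (by linarith [not_lt.1 hxδ'])
    rw [Real.norm_eq_abs, abs_le] at h1
    rw [abs_le]
    constructor <;> linarith [h1.1, h1.2]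

end roof

/-! ### Reflection, and passage to the singularity at one -/

namespace IET

variable {m : ℕ} {T : IET m}

theorem sum_filter_lt_eq {σ : Equiv.Perm (Fin (m + 1))} (w : Fin (m + 1) → ℝ) (j : Fin (m + 1)) :
    ∑ i ∈ Finset.univ.filter (fun i => σ j < σ i), w i = ∑ i, w i - (blockLeft σ w j + w j) := by
  rw [blockLeft_add, ← Finset.sum_filter_add_sum_filter_not Finset.univ (fun i => σ i ≤ σ j)]
  simp only [not_le]
  ring

theorem reflect_left_rev (T : IET m) (j : Fin (m + 1)) :
    T.reflect.left (Fin.rev j) = T.total - (T.left j + T.len j) := by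
  rw [left_eq_blockLeft T, total, ← sum_filter_lt_eq, left, Finset.sum_filter, Finset.sum_filter,
    ← Equiv.sum_comp Fin.revPerm]
  refine Finset.sum_congr rfl fun i _ => ?_
  simp only [reflect, Fin.revPerm_apply, Fin.rev_lt_rev, Fin.rev_rev, Equiv.refl_apply]
  congr

theorem reflect_imageLeft_rev (T : IET m) (j : Fin (m + 1)) :
    T.reflect.imageLeft (Fin.rev j) = T.total - (T.imageLeft j + T.len j) := by
  rw [imageLeft_eq_blockLeft T, total, ← sum_filter_lt_eq, imageLeft, Finset.sum_filter,
    Finset.sum_filter, ← Equiv.sum_comp Fin.revPerm]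
  refine Finset.sum_congr rfl fun i _ => ?_
  simp [reflect]

/-- The reflected map conjugates the map, up to a small displacement that avoids endpoints. -/
theorem eventually_reflect_map (hT : ∀ j, 0 < T.len j) {y : ℝ} (hy : y ∈ Ico 0 T.total) :
    ∀ᶠ ε in 𝓝[>] (0 : ℝ), T.reflect.map (T.total - y - ε) = T.total - T.map y - ε := by
  obtain ⟨j, hj⟩ := exists_mem_interval hy
  have hT' : ∀ j, 0 < T.reflect.len j := fun j => hT _
  filter_upwards [Ioo_mem_nhdsGT (sub_pos.2 hj.2)] with ε hε
  have hlen : T.reflect.len (Fin.rev j) = T.len j := by simp [reflect]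
  have hmem : T.total - y - ε ∈ T.reflect.interval (Fin.rev j) := by
    rw [interval, reflect_left_rev, hlen]
    exact ⟨by linarith [hε.2], by linarith [hj.1, hε.1]⟩
  rw [map_of_mem hT' hmem, reflect_left_rev, reflect_imageLeft_rev, map_of_mem hT hj]
  ring

theorem eventually_reflect_iterate (hT : ∀ j, 0 < T.len j) {x : ℝ} (hx : x ∈ Ico 0 T.total)
    (R : ℕ) : ∀ᶠ ε in 𝓝[>] (0 : ℝ), ∀ i ∈ Finset.range R,
      T.reflect.map^[i] (T.total - x - ε) = T.total - T.map^[i] x - ε := by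
  rw [Filter.eventually_all_finset]
  intro i hi
  clear hi
  induction i with
  | zero => exact Eventually.of_forall fun _ => rfl
  | succ i ih =>
    filter_upwards [ih, eventually_reflect_map hT (iterate_map_mem hT hx i)] with ε h1 h2
    rw [Function.iterate_succ_apply', Function.iterate_succ_apply', h1, h2]

/-- Half-open intervals are reversed by the reflection, so conjugacy may fail at endpoints. A small
displacement to the left is valid for finitely many iterates, and the summands are continuous since
no `T^i x` equals one. -/
theorem tendsto_birkhoffSum_reflect (hT : T.len ∈ openSimplex m) {x : ℝ} (hx : x ∈ Ico (0 : ℝ) 1)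
    (r : ℕ) : Tendsto (fun ε => birkhoffSum T.reflect.map (fun y => 1 / y) r (1 - x - ε)) (𝓝[>] 0)
      (𝓝 (birkhoffSum T.map (fun y => 1 / (1 - y)) r x)) := by
  have hT1 : T.total = 1 := hT.2
  rw [← hT1] at hx
  have h1 : Tendsto (fun ε => ∑ i ∈ Finset.range r, 1 / (1 - T.map^[i] x - ε)) (𝓝[>] 0)
      (𝓝 (birkhoffSum T.map (fun y => 1 / (1 - y)) r x)) := by
    refine tendsto_finsetSum _ fun i _ => ?_
    have h2 : Tendsto (fun ε => 1 - T.map^[i] x - ε) (𝓝[>] 0) (𝓝 (1 - T.map^[i] x)) := by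
      have : Continuous fun ε : ℝ => 1 - T.map^[i] x - ε := by fun_prop
      have h3 := this.tendsto 0
      rw [sub_zero] at h3
      exact h3.mono_left nhdsWithin_le_nhds
    have h4 := (iterate_map_mem hT.1 hx i).2
    rw [hT1] at h4
    exact tendsto_const_nhds.div h2 (sub_pos.2 h4).ne'
  refine h1.congr' ?_
  filter_upwards [eventually_reflect_iterate hT.1 hx r] with ε hε
  rw [hT1] at hε
  exact Finset.sum_congr rfl fun i hi => by rw [hε i hi]

theorem eventually_reflect_mem {x : ℝ} (hx : x ∈ Ico (0 : ℝ) 1) :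
    ∀ᶠ ε in 𝓝[>] (0 : ℝ), 1 - x - ε ∈ Ico (0 : ℝ) 1 := by
  filter_upwards [Ioo_mem_nhdsGT (sub_pos.2 hx.2)] with ε hε
  exact ⟨by linarith [hε.2], by linarith [hx.1, hε.1]⟩

theorem tendsto_add_div_sub {E c b : ℝ} (hb : 0 < b) :
    Tendsto (fun ε => E + c / (b - ε)) (𝓝[>] 0) (𝓝 (E + c / b)) := by
  have h2 : Tendsto (fun ε => b - ε) (𝓝[>] 0) (𝓝 b) := by
    have : Continuous fun ε : ℝ => b - ε := by fun_prop
    have h3 := this.tendsto 0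
    rw [sub_zero] at h3
    exact h3.mono_left nhdsWithin_le_nhds
  exact tendsto_const_nhds.add (tendsto_const_nhds.div h2 hb.ne')

/-- Transfer of upper bounds for the reflected exchange. -/
theorem birkhoffSum_reflect_le (hT : T.len ∈ openSimplex m) {x : ℝ} (hx : x ∈ Ico (0 : ℝ) 1)
    {r : ℕ} {E c b : ℝ} (hb : 0 < b) (hbx : ∀ i < r, b ≤ 1 - T.map^[i] x)
    {p : ℝ → Prop} (hp : ∀ᶠ ε in 𝓝[>] (0 : ℝ), p (1 - x - ε))
    (hbound : ∀ y ∈ Ico (0 : ℝ) 1, p y → ∀ a, 0 < a → (∀ i < r, a ≤ T.reflect.map^[i] y) →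
      birkhoffSum T.reflect.map (fun y => 1 / y) r y ≤ E + c / a) :
    birkhoffSum T.map (fun y => 1 / (1 - y)) r x ≤ E + c / b := by
  have hT1 : T.total = 1 := hT.2
  refine le_of_tendsto_of_tendsto (tendsto_birkhoffSum_reflect hT hx r)
    (tendsto_add_div_sub hb) ?_
  have hx' := hx
  rw [← hT1] at hx'
  filter_upwards [hp, eventually_reflect_mem hx, eventually_reflect_iterate hT.1 hx' r,
    Ioo_mem_nhdsGT hb] with ε h1 h2 h3 h4
  rw [hT1] at h3
  refine hbound _ h2 h1 _ (sub_pos.2 h4.2) fun i hi => ?_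
  rw [h3 i (Finset.mem_range.2 hi)]
  linarith [hbx i hi]

/-- Avoiding `Σ⁻` is a finite set of strict inequalities, as the target interval is closed; these
survive a small displacement. -/
theorem eventually_notMem_sigmaPlus_reflect (hT : T.len ∈ openSimplex m) {τ' : ℝ} {n : ℕ → ℕ}
    {l : ℕ} {x : ℝ} (hx : x ∈ Ico (0 : ℝ) 1) (hxσ : x ∉ T.sigmaMinus τ' n l) :
    ∀ᶠ ε in 𝓝[>] (0 : ℝ), 1 - x - ε ∉ T.reflect.sigmaPlus τ' n l := by
  have hT1 : T.total = 1 := hT.2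
  have hx' := hx
  rw [← hT1] at hx'
  set N := ⌊T.reflect.sigma τ' n l * (T.reflect.maxHeight (n (l + 1)) : ℝ)⌋₊ with hN
  have hsep : ∀ i ∈ Finset.range (N + 1),
      ∀ᶠ ε in 𝓝[>] (0 : ℝ), T.map^[i] x < 1 - T.reflect.sigma τ' n l * T.reflect.totalLen (n l) - ε
      := by
    intro i hi
    have h1 : T.map^[i] x < 1 - T.reflect.sigma τ' n l * T.reflect.totalLen (n l) := by
      by_contra hcon
      have h2 := (iterate_map_mem hT.1 hx' i).2
      rw [hT1] at h2
      exact hxσ ⟨hx, i, Nat.lt_succ_iff.1 (Finset.mem_range.1 hi), not_lt.1 hcon, h2.le⟩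
    filter_upwards [Ioo_mem_nhdsGT (sub_pos.2 h1)] with ε hε
    linarith [hε.2]
  filter_upwards [(Filter.eventually_all_finset _).2 hsep,
    eventually_reflect_iterate hT.1 hx' (N + 1)] with ε h1 h2
  rintro ⟨-, i, hi, hmem⟩
  have hi' : i ∈ Finset.range (N + 1) := Finset.mem_range.2 (Nat.lt_succ_of_le hi)
  rw [hT1] at h2
  rw [h2 i hi'] at hmem
  linarith [h1 i hi', hmem.2]

/-- The Birkhoff sums of the derivative of a roof function compared with those of the two singular
model functions. -/
theorem abs_birkhoffSum_deriv_le {f : ℝ → ℝ} {Cp Cm ε M : ℝ}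
    (hM : ∀ x ∈ Ioo (0 : ℝ) 1,
      |deriv f x + Cp * (1 / x) - Cm * (1 / (1 - x))| ≤ ε * (1 / x + 1 / (1 - x)) + M)
    {r : ℕ} {x : ℝ} (hx : ∀ i < r, T.map^[i] x ∈ Ioo (0 : ℝ) 1) :
    |birkhoffSum T.map (deriv f) r x + Cp * birkhoffSum T.map (fun y => 1 / y) r x -
      Cm * birkhoffSum T.map (fun y => 1 / (1 - y)) r x| ≤
    ε * (birkhoffSum T.map (fun y => 1 / y) r x +
      birkhoffSum T.map (fun y => 1 / (1 - y)) r x) + r * M := by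
  have e1 : birkhoffSum T.map (deriv f) r x + Cp * birkhoffSum T.map (fun y => 1 / y) r x -
      Cm * birkhoffSum T.map (fun y => 1 / (1 - y)) r x =
      ∑ i ∈ Finset.range r, (deriv f (T.map^[i] x) + Cp * (1 / T.map^[i] x) -
        Cm * (1 / (1 - T.map^[i] x))) := by
    simp only [birkhoffSum, Finset.sum_sub_distrib, Finset.sum_add_distrib, Finset.mul_sum]
  have e2 : ε * (birkhoffSum T.map (fun y => 1 / y) r x +
      birkhoffSum T.map (fun y => 1 / (1 - y)) r x) + r * M =
      ∑ i ∈ Finset.range r, (ε * (1 / T.map^[i] x + 1 / (1 - T.map^[i] x)) + M) := by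
    simp only [birkhoffSum, Finset.sum_add_distrib, Finset.mul_sum, Finset.sum_const,
      Finset.card_range, nsmul_eq_mul, mul_add]
  rw [e1, e2]
  exact (Finset.abs_sum_le_sum_abs _ _).trans
    (Finset.sum_le_sum fun i hi => hM _ (hx i (Finset.mem_range.1 hi)))

theorem orbitMin_le (T : IET m) {r i : ℕ} (hi : i < r) (x : ℝ) :
    T.orbitMin r x ≤ T.map^[i] x :=
  ciInf_le (f := fun i : Fin r => T.map^[i] x) (finite_range _).bddBelow ⟨i, hi⟩

theorem le_orbitMax (T : IET m) {r i : ℕ} (hi : i < r) (x : ℝ) :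
    T.map^[i] x ≤ T.orbitMax r x :=
  le_ciSup (f := fun i : Fin r => T.map^[i] x) (finite_range _).bddAbove ⟨i, hi⟩

theorem orbitMin_pos (T : IET m) {r : ℕ} (hr : 0 < r) {x : ℝ} (hx : ∀ i < r, 0 < T.map^[i] x) :
    0 < T.orbitMin r x := by
  have : Nonempty (Fin r) := ⟨⟨0, hr⟩⟩
  obtain ⟨i, hi⟩ := exists_eq_ciInf_of_finite (f := fun i : Fin r => T.map^[i] x)
  rw [orbitMin, ← hi]
  exact hx i i.isLt

theorem orbitMax_lt_one (T : IET m) {r : ℕ} (hr : 0 < r) {x : ℝ}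
    (hx : ∀ i < r, T.map^[i] x < 1) : T.orbitMax r x < 1 := by
  have : Nonempty (Fin r) := ⟨⟨0, hr⟩⟩
  obtain ⟨i, hi⟩ := exists_eq_ciSup_of_finite (f := fun i : Fin r => T.map^[i] x)
  rw [orbitMax, ← hi]
  exact hx i i.isLt

end IET

/-! ### Combination of the two singular sums -/

theorem mainTheorem5 {m : ℕ} (hm : 1 ≤ m)
    (τ τ' : ℝ) (hτ₁ : 1 < τ) (hτ₂ : τ < 2) (hτ'₁ : τ / 2 < τ') (hτ'₂ : τ' < 1)
    (T : IET m) (hT : T ∈ IET.MSet (m := m) τ)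
    (n : ℕ → ℕ) (ν κ D : ℝ) (lbar : ℕ) (hn : T.IsBalancedSeq τ n ν κ D lbar)
    (n' : ℕ → ℕ) (ν' κ' D' : ℝ) (lbar' : ℕ)
    (hn' : T.reflect.IsBalancedSeq τ n' ν' κ' D' lbar')
    (Cp Cm : ℝ) (hCp : 0 < Cp) (hCm : 0 < Cm) (hne : Cp ≠ Cm) :
    ∃ C₁ C₂ C₃ : ℝ, 0 < C₁ ∧ 0 < C₂ ∧ 0 < C₃ ∧
      ∀ f : ℝ → ℝ, IsLogRoof f Cp Cm → ∃ r₀ : ℕ, ∀ r : ℕ, r₀ ≤ r →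
        (∀ (l l' : ℕ) (x : ℝ), x ∈ Set.Ico (0 : ℝ) 1 →
          T.maxHeight (n l) ≤ r → r < T.maxHeight (n (l + 1)) →
          T.reflect.maxHeight (n' l') ≤ r → r < T.reflect.maxHeight (n' (l' + 1)) →
          x ∉ T.sigmaPlus τ' n l ∪ T.sigmaMinus τ' n' l' →
          ¬ T.IsSingularity r x →
          (Cm < Cp → birkhoffSum T.map (deriv f) r x ≤
            -C₁ * (r * Real.log r) + Cp * (κ' + 1) / (1 - T.orbitMax r x)) ∧
          (Cp < Cm → birkhoffSum T.map (deriv f) r x ≥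
            C₁ * (r * Real.log r) - Cm * (κ + 1) / T.orbitMin r x) ∧
          |birkhoffSum T.map (deriv f) r x| ≤
            C₂ * (r * Real.log r) + C₂ * (κ + 1) / T.orbitMin r x +
              C₂ * (κ' + 1) / (1 - T.orbitMax r x)) ∧
        (∀ x : ℝ, x ∈ Set.Ico (0 : ℝ) 1 → ¬ T.IsSingularity r x →
          |birkhoffSum T.map (deriv f) r x| ≤
            C₃ * (r : ℝ) ^ 2 + C₃ * (κ + 1) / T.orbitMin r x +
              C₃ * (κ' + 1) / (1 - T.orbitMax r x)) := by
  have hTs : T.len ∈ openSimplex m := hT.1.1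
  have hTs' : T.reflect.len ∈ openSimplex m := hT.2.1
  have hT1 : T.total = 1 := hTs.2
  have hκ : 0 < κ := zero_lt_one.trans hn.one_lt_kappa
  have hκ' : 0 < κ' := zero_lt_one.trans hn'.one_lt_kappa
  obtain ⟨Δ, hΔ, hΔeq⟩ : ∃ Δ : ℝ, 0 < Δ ∧ Δ = |Cp - Cm| :=
    ⟨_, abs_pos.2 (sub_ne_zero.2 hne), rfl⟩
  obtain ⟨S, hS, hSeq⟩ : ∃ S : ℝ, 0 < S ∧ S = Cp + Cm := ⟨_, add_pos hCp hCm, rfl⟩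
  have hΔS : Δ ≤ S := by
    rw [hΔeq, hSeq, abs_le]
    constructor <;> linarith
  obtain ⟨ε, hε, hεeq⟩ : ∃ ε : ℝ, 0 < ε ∧ 8 * ε = Δ := ⟨Δ / 8, by positivity, by ring⟩
  obtain ⟨η, hη, hηeq⟩ : ∃ η : ℝ, 0 < η ∧ 4 * (η * S) = Δ :=
    ⟨Δ / (4 * S), by positivity, by field_simp⟩
  have hη4 : η ≤ 1 / 4 := by
    by_contra hcon
    have := mul_lt_mul_of_pos_right (not_le.1 hcon) hS
    linarith
  -- From the coefficient `Δ` one subtracts `2ε = Δ/4` for the approximation of `f'`, `ηS = Δ/4` for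
  -- the asymptotics of the sums and `Δ/4` for `r * M`; `Δ/4` remains. The function `f` enters only
  -- through `M` and the threshold `r₀`.
  refine ⟨Δ / 4, 3 * S, 3 * S + 1, by positivity, by positivity, by positivity,
    fun f hf => ?_⟩
  obtain ⟨M, hM⟩ := hf.abs_deriv_le hε hCp hCm
  obtain ⟨r₁, hr₁⟩ := hn.birkhoffSum_one_div_le hTs hm hτ₂ hτ'₂ hη
  obtain ⟨r₂, hr₂⟩ := hn.le_birkhoffSum_one_div hTs hm hτ₂ hη
  obtain ⟨r₃, hr₃⟩ := hn.birkhoffSum_one_div_le_sq hTs hm hτ₂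
  obtain ⟨r₁', hr₁'⟩ := hn'.birkhoffSum_one_div_le hTs' hm hτ₂ hτ'₂ hη
  obtain ⟨r₂', hr₂'⟩ := hn'.le_birkhoffSum_one_div hTs' hm hτ₂ hη
  obtain ⟨r₃', hr₃'⟩ := hn'.birkhoffSum_one_div_le_sq hTs' hm hτ₂
  have hlarge : ∀ᶠ r : ℕ in atTop, 0 < r ∧ M ≤ Δ / 4 * Real.log r ∧ M ≤ r := by
    have h1 : Tendsto (fun r : ℕ => Δ / 4 * Real.log r) atTop atTop :=
      (Real.tendsto_log_atTop.comp tendsto_natCast_atTop_atTop).const_mul_atTop (by positivity)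
    filter_upwards [eventually_gt_atTop 0, h1.eventually_ge_atTop M,
      tendsto_natCast_atTop_atTop.eventually_ge_atTop M] with r h1 h2 h3
    exact ⟨h1, h2, h3⟩
  obtain ⟨r₀, hr₀⟩ := eventually_atTop.1 (hlarge.and ((eventually_ge_atTop r₁).and
    ((eventually_ge_atTop r₂).and ((eventually_ge_atTop r₃).and ((eventually_ge_atTop r₁').and
    ((eventually_ge_atTop r₂').and (eventually_ge_atTop r₃')))))))
  refine ⟨r₀, fun r hr => ?_⟩
  obtain ⟨⟨hrpos, hMlog, hMr⟩, g₁, g₂, g₃, g₁', g₂', g₃'⟩ := hr₀ r hr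
  have hr0 : (0 : ℝ) < r := Nat.cast_pos.2 hrpos
  have hlog0 : 0 ≤ Real.log r := Real.log_natCast_nonneg r
  have horb : ∀ x ∈ Ico (0 : ℝ) 1, ¬T.IsSingularity r x → ∀ i < r, T.map^[i] x ∈ Ioo (0 : ℝ) 1 := by
    intro x hx hsing i hi
    rw [← hT1] at hx
    have h1 := IET.iterate_map_mem hTs.1 hx i
    rw [hT1] at h1
    exact ⟨lt_of_le_of_ne h1.1 fun h0 => hsing ⟨i, hi, h0.symm⟩, h1.2⟩
  have hsetup : ∀ x ∈ Ico (0 : ℝ) 1, ¬T.IsSingularity r x →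
      0 < T.orbitMin r x ∧ 0 < 1 - T.orbitMax r x ∧
      |birkhoffSum T.map (deriv f) r x + Cp * birkhoffSum T.map (fun y => 1 / y) r x -
        Cm * birkhoffSum T.map (fun y => 1 / (1 - y)) r x| ≤
      ε * (birkhoffSum T.map (fun y => 1 / y) r x +
        birkhoffSum T.map (fun y => 1 / (1 - y)) r x) + r * M ∧
      0 ≤ birkhoffSum T.map (fun y => 1 / y) r x ∧
      0 ≤ birkhoffSum T.map (fun y => 1 / (1 - y)) r x := by
    intro x hx hsing
    have ho := horb x hx hsing
    refine ⟨T.orbitMin_pos hrpos fun i hi => (ho i hi).1,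
      sub_pos.2 (T.orbitMax_lt_one hrpos fun i hi => (ho i hi).2),
      IET.abs_birkhoffSum_deriv_le hM ho, ?_, ?_⟩
    · exact Finset.sum_nonneg fun i hi => one_div_nonneg.2 (ho i (Finset.mem_range.1 hi)).1.le
    · exact Finset.sum_nonneg fun i hi =>
        one_div_nonneg.2 (sub_pos.2 (ho i (Finset.mem_range.1 hi)).2).le
  constructor
  · intro l l' x hx hl₁ hl₂ hl₁' hl₂' hxσ hsing
    obtain ⟨ha, hb, hS1, hU0, hV0⟩ := hsetup x hx hsing
    have hU := hr₁ r g₁ l hl₁ hl₂ x hx (fun h => hxσ (Or.inl h)) _ ha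
      fun i hi => T.orbitMin_le hi x
    have hUlow := hr₂ r g₂ x hx
    have hV := IET.birkhoffSum_reflect_le hTs hx hb
      (fun i hi => by linarith [T.le_orbitMax hi x])
      (IET.eventually_notMem_sigmaPlus_reflect hTs hx fun h => hxσ (Or.inr h))
      (fun y hy hyσ a ha hay => hr₁' r g₁' l' hl₁' hl₂' y hy hyσ a ha hay)
    have hVlow : (1 - η) * (r * Real.log r) ≤
        birkhoffSum T.map (fun y => 1 / (1 - y)) r x := by
      refine ge_of_tendsto (IET.tendsto_birkhoffSum_reflect hTs hx r) ?_
      filter_upwards [IET.eventually_reflect_mem hx] with e he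
      exact hr₂' r g₂' _ he
    set U := birkhoffSum T.map (fun y => 1 / y) r x
    set V := birkhoffSum T.map (fun y => 1 / (1 - y)) r x
    set W := birkhoffSum T.map (deriv f) r x
    have hQ0 : 0 ≤ r * Real.log r := by positivity
    have hrM : r * M ≤ Δ / 4 * (r * Real.log r) := by
      have := mul_le_mul_of_nonneg_left hMlog hr0.le
      linarith
    have hA0 : 0 ≤ (κ + 1) / T.orbitMin r x := by positivity
    have hB0 : 0 ≤ (κ' + 1) / (1 - T.orbitMax r x) := by positivity
    simp only [mul_div_assoc]
    set Q := r * Real.log r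
    set A := (κ + 1) / T.orbitMin r x
    set B := (κ' + 1) / (1 - T.orbitMax r x)
    have hηQ : η * S * Q = Δ / 4 * Q := by rw [show η * S = Δ / 4 by linarith]
    have hεQ : ε * Q = Δ / 8 * Q := by rw [show ε = Δ / 8 by linarith]
    obtain ⟨s1, s2⟩ := abs_le.1 hS1
    refine ⟨fun hlt => ?_, fun hlt => ?_, ?_⟩
    · have hΔ' : Δ = Cp - Cm := by rw [hΔeq, abs_of_pos (sub_pos.2 hlt)]
      have t1 := mul_le_mul_of_nonneg_left hUlow (by linarith : 0 ≤ Cp - ε)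
      have t2 := mul_le_mul_of_nonneg_left hV (by linarith : 0 ≤ Cm + ε)
      -- The closest-approach term carries `Cm + ε`; since `ε` is an eighth of the gap, the larger
      -- constant dominates it.
      have t3 := mul_le_mul_of_nonneg_right (by linarith : Cm + ε ≤ Cp) hB0
      have hΔQ : Δ * Q = Cp * Q - Cm * Q := by rw [hΔ']; ring
      rw [hSeq] at hηQ
      linarith
    · have hΔ' : Δ = Cm - Cp := by rw [hΔeq, abs_sub_comm, abs_of_pos (sub_pos.2 hlt)]
      have t1 := mul_le_mul_of_nonneg_left hVlow (by linarith : 0 ≤ Cm - ε)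
      have t2 := mul_le_mul_of_nonneg_left hU (by linarith : 0 ≤ Cp + ε)
      have t3 := mul_le_mul_of_nonneg_right (by linarith : Cp + ε ≤ Cm) hA0
      have hΔQ : Δ * Q = Cm * Q - Cp * Q := by rw [hΔ']; ring
      rw [hSeq] at hηQ
      linarith
    · have t1 : U ≤ 5 / 4 * Q + A := by
        have := mul_le_mul_of_nonneg_right hη4 hQ0
        linarith
      have t2 : V ≤ 5 / 4 * Q + B := by
        have := mul_le_mul_of_nonneg_right hη4 hQ0
        linarith
      have t3 : |W| ≤ (Cp + ε) * U + (Cm + ε) * V + r * M := by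
        rw [abs_le]
        have := mul_nonneg hCp.le hU0
        have := mul_nonneg hCm.le hV0
        constructor <;> linarith
      have t4 := mul_le_mul_of_nonneg_left t1 (by linarith : 0 ≤ Cp + ε)
      have t5 := mul_le_mul_of_nonneg_left t2 (by linarith : 0 ≤ Cm + ε)
      have t6 := mul_le_mul_of_nonneg_right (by linarith : Cp + ε ≤ 3 * S) hA0
      have t7 := mul_le_mul_of_nonneg_right (by linarith : Cm + ε ≤ 3 * S) hB0
      have t8 := mul_le_mul_of_nonneg_right
        (by linarith : 5 / 4 * (Cp + ε + (Cm + ε)) + Δ / 4 ≤ 3 * S) hQ0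
      linarith
  · intro x hx hsing
    obtain ⟨ha, hb, hS1, hU0, hV0⟩ := hsetup x hx hsing
    have hU := hr₃ r g₃ x hx _ ha fun i hi => T.orbitMin_le hi x
    have hV := IET.birkhoffSum_reflect_le hTs hx hb
      (fun i hi => by linarith [T.le_orbitMax hi x]) (p := fun _ => True)
      (Eventually.of_forall fun _ => trivial)
      (fun y hy _ a ha hay => hr₃' r g₃' y hy a ha hay)
    set U := birkhoffSum T.map (fun y => 1 / y) r x
    set V := birkhoffSum T.map (fun y => 1 / (1 - y)) r x
    set W := birkhoffSum T.map (deriv f) r x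
    have hrM : r * M ≤ (r : ℝ) ^ 2 := by
      have := mul_le_mul_of_nonneg_left hMr hr0.le
      rwa [← sq] at this
    have hQ0 : (0 : ℝ) ≤ (r : ℝ) ^ 2 := by positivity
    have hA0 : 0 ≤ (κ + 1) / T.orbitMin r x := by positivity
    have hB0 : 0 ≤ (κ' + 1) / (1 - T.orbitMax r x) := by positivity
    simp only [mul_div_assoc]
    set Q := (r : ℝ) ^ 2
    set A := (κ + 1) / T.orbitMin r x
    set B := (κ' + 1) / (1 - T.orbitMax r x)
    obtain ⟨s1, s2⟩ := abs_le.1 hS1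
    have t3 : |W| ≤ (Cp + ε) * U + (Cm + ε) * V + r * M := by
      rw [abs_le]
      have := mul_nonneg hCp.le hU0
      have := mul_nonneg hCm.le hV0
      constructor <;> linarith
    have t4 := mul_le_mul_of_nonneg_left hU (by linarith : 0 ≤ Cp + ε)
    have t5 := mul_le_mul_of_nonneg_left hV (by linarith : 0 ≤ Cm + ε)
    have t6 := mul_le_mul_of_nonneg_right (by linarith : Cp + ε ≤ 3 * S + 1) hA0
    have t7 := mul_le_mul_of_nonneg_right (by linarith : Cm + ε ≤ 3 * S + 1) hB0
    have t8 := mul_le_mul_of_nonneg_right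
      (by linarith : Cp + ε + (Cm + ε) + 1 ≤ 3 * S + 1) hQ0
    linarith
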